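/- **Setting.** Let $I_v$ be a finite set of variable-node (VN) types. A type-$t$ VN is an injective binary linear encoder $\mathbb F_2^{k_t}\to\mathbb F_2^{q_t}$, $k_t\ge 1$; let $B^{(t)}_{u,v}$ be the number of inputs of weight $u$ whose output has weight $v$, and $B^{(t)}(x,y)=\sum_{u,v}B^{(t)}_{u,v}x^uy^v$, the same for all VNs of type $t$. All check nodes (CNs) are nonzero binary linear codes of the same length $s\ge1$ with the same weight enumerator $A(z)=\sum_u A_uz^u$. Let $\lambda_t>0$ be rational with $\sum_t\lambda_t=1$ (fractions of edges), $\int\lambda=\int_0^1\sum_t\lambda_tx^{q_t-1}\,dx$, $\int\rho=\int_0^1x^{s-1}\,dx=1/s$, $\delta_t=\lambda_t/(q_t\int\lambda)$. For those $n\ge1$ for which all $\delta_tn$ and $m=n\int\rho/\int\lambda$ are integers, the ensemble $\mathcal M_n$ has $\delta_tn$ VNs of type $t$ for each $t$, $m$ CNs, and a uniformly random permutation matching the $E=n/\int\lambda$ VN sockets with the $E$ CN sockets. A word consists of the local inputs of all VNs; it is a codeword if the VN output bits, carried along the edges, form a local codeword at every CN; its weight is the number of ones in the word. Let $N_w$ be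 the number of codewords of weight $w$. The growth rate is $G(\alpha)=\lim\frac1n\log\mathbb E_{\mathcal M_n}[N_w]$ as $n\to\infty$ and $w/n\to\alpha$ (in particular along $w=\alpha n$), over the pairs $(n,w)$ for which $\mathcal M_n$ exists and $\mathbb E_{\mathcal M_n}[N_w]>0$. Let $U^{(t)}_i$ and $V^{(t)}_i$ be the minimum and maximum output weight over the inputs of weight $i$ of a type-$t$ VN. For $0\le a\le k_t$ let $m^{(t)}(a)=\min_\omega\sum_{i=1}^{k_t}U^{(t)}_i\omega_i$ and $M^{(t)}(a)=\max_\omega\sum_{i=1}^{k_t}V^{(t)}_i\omega_i$, both over $\omega_i\ge0$, $\sum_i\omega_i\le1$, $\sum_ii\omega_i=a$. Let $\beta_{\max}=\frac{\int\rho}{\int\lambda}\max\{u:A_u>0\}$. **Proposition.** (1) For $0<\beta<\beta_{\max}$ the equation $\frac{A'(z_0)}{A(z_0)}z_0=\beta\frac{\int\lambda}{\int\rho}$ has a unique solution $z_0>0$. (2) For $t\in I_v$, $0<\alpha_t<\delta_tk_t$ and $\delta_tm^{(t)}(\alpha_t/\delta_t)<\beta_t<\delta_tM^{(t)}(\alpha_t/\delta_t)$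 the equations $$\frac{\partial B^{(t)}}{\partial x}(x_0,y_0)\frac{x_0}{B^{(t)}(x_0,y_0)}=\frac{\alpha_t}{\delta_t},\qquad \frac{\partial B^{(t)}}{\partial y}(x_0,y_0)\frac{y_0}{B^{(t)}(x_0,y_0)}=\frac{\beta_t}{\delta_t}$$ have a unique solution with $x_0,y_0>0$. If instead $\delta_tm^{(t)}(\alpha_t/\delta_t)=\beta_t=\delta_tM^{(t)}(\alpha_t/\delta_t)$ (as for repetition codes), a positive solution exists, not necessarily unique. (3) There are continuous functions $X_t^{(\delta_t)}$ on $\{(\alpha_t,\beta_t):0\le\alpha_t\le\delta_tk_t,\ \delta_tm^{(t)}(\alpha_t/\delta_t)\le\beta_t\le\delta_tM^{(t)}(\alpha_t/\delta_t)\}$ and $Y$ on $[0,\beta_{\max}]$ such that, with $h$ the binary entropy function in nats, $$X_t^{(\delta_t)}(\alpha_t,\beta_t)=\log\frac{B^{(t)}(x_0,y_0)^{\delta_t}}{x_0^{\alpha_t}y_0^{\beta_t}},\qquad Y(\beta)=\log\frac{A(z_0)^{\int\rho/\int\lambda}}{z_0^{\beta}}-\frac{h(\beta\int\lambda)}{\int\lambda}$$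 for every positive solution $(x_0,y_0)$, resp. $z_0$, of the equations above (for whichever $(\alpha_t,\beta_t)$, resp. $\beta$, one exists), and such that for every real $\alpha$ whose constraint set below is nonempty the growth rate exists (pairs $(n,w)$ as above exist with $n\to\infty$, $w/n\to\alpha$) and $$G(\alpha)=\max_{(\alpha_t),(\beta_t)}\Big(\sum_{t\in I_v}X_t^{(\delta_t)}(\alpha_t,\beta_t)+Y(\beta)\Big),\qquad \beta=\sum_{t\in I_v}\beta_t,$$ the maximum, which is attained, being over all $(\alpha_t),(\beta_t)$ with $0\le\alpha_t\le\delta_tk_t$ and $\delta_tm^{(t)}(\alpha_t/\delta_t)\le\beta_t\le\delta_tM^{(t)}(\alpha_t/\delta_t)$ for all $t$, $\sum_t\alpha_t=\alpha$ and $\beta\le\beta_{\max}$. -/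

import Mathlib

open Filter Topology

noncomputable section

/-- A sequence `(M_n)` of doubly-generalized LDPC ensembles with a uniform check-node (CN) set.
Variable-node (VN) types are indexed by `ι`.  The type of a CN is its weight enumerator and the
type of a VN is its input-output weight enumerator, so two nodes of one type may carry different
local codes: `cn n j` is the code of the `j`-th CN of `M_n`, and `vn n t i` is the encoder
(generator matrix) of the `i`-th VN of type `t` of `M_n`. -/
structure DGLDPC (ι : Type*) [Fintype ι] where
  /-- CN length -/
  s : ℕ
  /-- VN lengths -/
  q : ι → ℕ
  /-- VN dimensions -/
  k : ι → ℕ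
  /-- fraction of the edges connected to VNs of a given type; rational, since numbers of nodes are
  integers -/
  lam : ι → ℚ
  /-- `A u`: number of weight-`u` local codewords of each CN -/
  A : ℕ → ℕ
  /-- `B t u v`: number of weight-`u` local inputs of a type-`t` VN with a weight-`v` codeword -/
  B : ι → ℕ → ℕ → ℕ
  cn : ℕ → ℕ → Submodule (ZMod 2) (Fin s → ZMod 2)
  vn : ℕ → (t : ι) → ℕ → ((Fin (k t) → ZMod 2) →ₗ[ZMod 2] (Fin (q t) → ZMod 2))
  s_pos : 0 < s
  k_pos : ∀ t, 0 < k t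
  lam_pos : ∀ t, 0 < lam t
  lam_sum : ∑ t, lam t = 1
  cn_ne_bot : ∀ n j, cn n j ≠ ⊥
  vn_injective : ∀ n t i, Function.Injective (vn n t i)
  cn_wef : ∀ n j u, Nat.card {c : Fin s → ZMod 2 // c ∈ cn n j ∧ hammingNorm c = u} = A u
  vn_iowef : ∀ n t i u v,
    Nat.card {x : Fin (k t) → ZMod 2 // hammingNorm x = u ∧ hammingNorm (vn n t i x) = v} = B t u v

namespace DGLDPC

variable {ι : Type*} [Fintype ι] (D : DGLDPC ι)

/-- `∫ λ`, the integral over `[0, 1]` of `λ(x) = ∑ t, λ_t x ^ (q_t - 1)`. -/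
def lamInt : ℝ := ∫ x in (0 : ℝ)..1, ∑ t, (D.lam t : ℝ) * x ^ (D.q t - 1)

/-- `∫ ρ`, the integral over `[0, 1]` of `ρ(x) = x ^ (s - 1)`. -/
def rhoInt : ℝ := ∫ x in (0 : ℝ)..1, x ^ (D.s - 1)

/-- The fraction of VNs that have type `t`. -/
def delta (t : ι) : ℝ := D.lam t / (D.q t * D.lamInt)

/-! ### The ensemble and its expected weight distribution -/

/-- The number of type-`t` VNs when there are `n` VNs (meaningful for admissible `n`). -/
def numVN (n : ℕ) (t : ι) : ℕ := ⌊(n : ℝ) * D.delta t⌋₊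

/-- The number of CNs when there are `n` VNs (meaningful for admissible `n`). -/
def numCN (n : ℕ) : ℕ := ⌊(n : ℝ) * (D.rhoInt / D.lamInt)⌋₊

/-- `M_n` exists: the prescribed numbers of nodes are integers. -/
def Admissible (n : ℕ) : Prop :=
  0 < n ∧ (∀ t, (D.numVN n t : ℝ) = n * D.delta t) ∧
    (D.numCN n : ℝ) = n * (D.rhoInt / D.lamInt)

/-- The VNs of a member of `M_n`. -/
abbrev VNode (n : ℕ) : Type _ := Σ t : ι, Fin (D.numVN n t)

/-- The edge ends at the VNs. -/
abbrev VSocket (n : ℕ) : Type _ := Σ p : D.VNode n, Fin (D.q p.1)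

/-- The edge ends at the CNs. -/
abbrev CSocket (n : ℕ) : Type := Fin (D.numCN n) × Fin D.s

/-- A word of a code in `M_n`: its bits are the local input bits of the VNs. -/
abbrev Word (n : ℕ) : Type _ := (p : D.VNode n) → Fin (D.k p.1) → ZMod 2

/-- The bit that a word puts on an edge. -/
def edgeBit (n : ℕ) (u : D.Word n) (e : D.VSocket n) : ZMod 2 :=
  D.vn n e.1.1 e.1.2 (u e.1) e.2

/-- `u` is a codeword of the member of `M_n` given by the edge permutation `π`. -/
def IsCodeword (n : ℕ) (π : D.VSocket n ≃ D.CSocket n) (u : D.Word n) : Prop :=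
  ∀ j : Fin (D.numCN n), (fun l : Fin D.s => D.edgeBit n u (π.symm (j, l))) ∈ D.cn n j

/-- `N_w`, the number of codewords of Hamming weight `w` of one member of `M_n`. -/
def numCodewords (n : ℕ) (π : D.VSocket n ≃ D.CSocket n) (w : ℕ) : ℕ :=
  Nat.card {u : D.Word n // D.IsCodeword n π u ∧ ∑ p, hammingNorm (u p) = w}

open Classical in
/-- The expectation of `N_w` over `M_n`, all edge permutations being equally likely. -/
def expNum (n w : ℕ) : ℝ :=
  (∑ π : D.VSocket n ≃ D.CSocket n, (D.numCodewords n π w : ℝ)) /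
    Fintype.card (D.VSocket n ≃ D.CSocket n)

/-- Pairs `(n, w)` with `M_n` defined, `n → ∞`, `w / n → α` and a positive expected number of
codewords of weight `w`.  The pairs with `w = α n` are among them; for general `w` irrational `α`
are covered as well.  Positivity leaves out the `w` that are impossible for divisibility reasons
(such as an odd number of ones on edges that meet even-weight check codes), where the
logarithm is `-∞`. -/
def growthFilter (α : ℝ) : Filter (ℕ × ℕ) :=
  comap Prod.fst atTop ⊓ comap (fun p : ℕ × ℕ => (p.2 : ℝ) / p.1) (𝓝 α) ⊓
    𝓟 {p | D.Admissible p.1 ∧ 0 < D.expNum p.1 p.2}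

/-- `g` is the growth rate of the weight distribution at `α`. -/
def IsGrowthRate (α g : ℝ) : Prop :=
  (D.growthFilter α).NeBot ∧
    Tendsto (fun p : ℕ × ℕ => 1 / (p.1 : ℝ) * Real.log (D.expNum p.1 p.2))
      (D.growthFilter α) (𝓝 g)

/-! ### Weight enumerators and saddle points -/

/-- The weight enumerating function `A(z)` of each CN. -/
def wef (z : ℝ) : ℝ := ∑ u ∈ Finset.range (D.s + 1), (D.A u : ℝ) * z ^ u

/-- The input-output weight enumerating function `B⁽ᵗ⁾(x, y)` of type-`t` VNs. -/
def iowef (t : ι) (x y : ℝ) : ℝ :=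
  ∑ u ∈ Finset.range (D.k t + 1), ∑ v ∈ Finset.range (D.q t + 1), (D.B t u v : ℝ) * x ^ u * y ^ v

/-- `z` is a positive solution `z₀` of the CN saddle-point equation at `β`. -/
def IsSaddleCN (β z : ℝ) : Prop :=
  0 < z ∧ deriv D.wef z / D.wef z * z = β * (D.lamInt / D.rhoInt)

/-- `p = (x, y)` is a positive solution `(x₀, y₀)` of the pair of type-`t` VN saddle-point
equations at `(a, b)`. -/
def IsSaddleVN (t : ι) (a b : ℝ) (p : ℝ × ℝ) : Prop :=
  0 < p.1 ∧ 0 < p.2 ∧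
    deriv (fun x => D.iowef t x p.2) p.1 * (p.1 / D.iowef t p.1 p.2) = a / D.delta t ∧
    deriv (fun y => D.iowef t p.1 y) p.2 * (p.2 / D.iowef t p.1 p.2) = b / D.delta t

/-- The expression for `Y(β)` in terms of the saddle point `z`. -/
def valY (β z : ℝ) : ℝ :=
  Real.log (D.wef z ^ (D.rhoInt / D.lamInt) / z ^ β) -
    Real.binEntropy (β * D.lamInt) / D.lamInt

/-- The expression for `X_t(a, b)` in terms of the saddle point `p = (x, y)`. -/
def valX (t : ι) (a b : ℝ) (p : ℝ × ℝ) : ℝ :=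
  Real.log (D.iowef t p.1 p.2 ^ D.delta t / (p.1 ^ a * p.2 ^ b))

/-! ### The constraint set -/

/-- Minimum codeword weight over the local inputs of weight `i`. -/
def U (t : ι) (i : ℕ) : ℕ := sInf {j | 0 < D.B t i j}

/-- Maximum codeword weight over the local inputs of weight `i`. -/
def V (t : ι) (i : ℕ) : ℕ := sSup {j | 0 < D.B t i j}

/-- The feasible points `ω` of the two linear programs at `a` (nonempty iff `0 ≤ a ≤ k_t`). -/
def lpSet (t : ι) (a : ℝ) : Set (ℕ → ℝ) :=
  {ω | (∀ i ∈ Finset.Icc 1 (D.k t), 0 ≤ ω i) ∧ ∑ i ∈ Finset.Icc 1 (D.k t), ω i ≤ 1 ∧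
    ∑ i ∈ Finset.Icc 1 (D.k t), (i : ℝ) * ω i = a}

/-- The minimum of the linear program with the weights `U`. -/
def lpMin (t : ι) (a : ℝ) : ℝ :=
  sInf ((fun ω : ℕ → ℝ => ∑ i ∈ Finset.Icc 1 (D.k t), (D.U t i : ℝ) * ω i) '' D.lpSet t a)

/-- The maximum of the linear program with the weights `V`. -/
def lpMax (t : ι) (a : ℝ) : ℝ :=
  sSup ((fun ω : ℕ → ℝ => ∑ i ∈ Finset.Icc 1 (D.k t), (D.V t i : ℝ) * ω i) '' D.lpSet t a)

/-- Lower bound on `β_t`: there are `δ_t n` VNs of type `t`, each with average local input weight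
`α_t / δ_t`. -/
def lower (t : ι) (a : ℝ) : ℝ := D.delta t * D.lpMin t (a / D.delta t)

/-- Upper bound on `β_t`. -/
def upper (t : ι) (a : ℝ) : ℝ := D.delta t * D.lpMax t (a / D.delta t)

/-- The pairs `(α_t, β_t)` allowed for type `t`; the bound `α_t ≤ δ_t k_t` says that the linear
programs are feasible. -/
def vnRegion (t : ι) : Set (ℝ × ℝ) :=
  {p | 0 ≤ p.1 ∧ p.1 ≤ D.delta t * D.k t ∧ D.lower t p.1 ≤ p.2 ∧ p.2 ≤ D.upper t p.1}

/-- The largest value of `β` that the CNs allow: `∫ρ / ∫λ` times the maximum weight of a local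
codeword of a CN. -/
def betaMax : ℝ := D.rhoInt / D.lamInt * (sSup {u | 0 < D.A u} : ℕ)

/-- The constraint set of the maximization: pairs of vectors `(α_t)`, `(β_t)`. -/
def feasible (α : ℝ) : Set ((ι → ℝ) × (ι → ℝ)) :=
  {p | (∀ t, (p.1 t, p.2 t) ∈ D.vnRegion t) ∧ ∑ t, p.1 t = α ∧ ∑ t, p.2 t ≤ D.betaMax}

end DGLDPC

end

/-! The expectation is a counting problem. Fix a local input at every VN and a local codeword at
every CN. The number of edge permutations that match them is `l! (E - l)!` if both sides carry the
same number `l` of ones on the `E` edges, and zero otherwise. This number and the weight of the word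
depend only on the profile, which records how often each symbol occurs (a weight pair at a VN of a
given type, or a weight at a CN). So the expectation is a sum over integer profiles of factorials
and powers (`expNum_eq`). By Stirling each term is `exp (n F(x))` up to a polynomial factor, where
`x` is the profile divided by `n` and `F` is the continuous function `exponent`
(`abs_log_profileTerm_sub_le`). There are polynomially many profiles, so the growth rate is the
maximum of `F` over a polytope: class masses prescribed, input weight `α`, equal edge weights on
both sides (`tendsto_log_expNum`).

Two points need care. Along `w / n → α` the maximum must depend continuously on the right-hand
sides. The lower bound needs an integer profile near the real maximizer that satisfies the
constraints exactly, despite divisibility obstructions. Both come from a Hoffman error bound,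
derived from a conformal decomposition of kernel vectors (`exists_conformal_generators`). Its real
form gives `continuousOn_valueFn`. Its integer form `exists_hoffman_nat` only asks for one integer
solution, which positivity of the expectation supplies. With `n` and `w` as further unknowns of a
homogeneous system, it also produces the pairs `(n, w)` (`growthFilter_neBot`).

Maximizing `F` first with all `α_t`, `β_t` fixed splits it into one entropy maximization per VN type
and one for the CNs, minus the entropy of the edge bits (`exponent_eq`). The values of these
problems are taken as `X_t` and `Y`, so they are continuous up to the boundary. The linear programs
describe exactly which statistics are achievable (`mem_vnRegion_iff`). If a positive distribution
has the given statistics, Lagrange multipliers put the maximizer in an exponential family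
(`exists_exponential_mem`), and its parameters are the logarithms of a saddle point. Monotonicity of
`exp` gives uniqueness (`exponential_injective`), and the Gibbs inequality with its equality case
evaluates the maximum (`entFn_le`, `entFn_eq`). -/

/-! ### Conformal decomposition and Hoffman error bounds -/

section Conformal

variable {J R : Type*} [Fintype J]

/-- A real vector in the kernel of an integer matrix has the sign pattern of an integer vector in
that kernel. -/
theorem exists_int_kernel_sign (T : R → J → ℤ) (v : J → ℝ) (hv : ∀ r, ∑ j, (T r j : ℝ) * v j = 0) :
    ∃ g : J → ℤ, (∀ r, ∑ j, T r j * g j = 0) ∧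
      ∀ j, SignType.sign (g j) = SignType.sign (v j) := by
  classical
  -- Over a rational basis `e` of the span of the entries, the real kernel relations become rational
  -- ones for each coordinate, since `T` is integral. Replacing `e` by nearby rationals therefore
  -- stays in the kernel.
  let W : Submodule ℚ ℝ := Submodule.span ℚ (Set.range v)
  have : FiniteDimensional ℚ W := FiniteDimensional.span_of_finite ℚ (Set.finite_range v)
  let e := Module.finBasis ℚ W
  let vW : J → W := fun j => ⟨v j, Submodule.subset_span ⟨j, rfl⟩⟩
  let c : J → Fin (Module.finrank ℚ W) → ℚ := fun j => e.repr (vW j)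
  have hc : ∀ j, v j = ∑ i, (e i : ℝ) * (c j i : ℝ) := by
    intro j
    have h := congrArg (Subtype.val) (e.sum_repr (vW j))
    rw [AddSubmonoidClass.coe_finsetSum] at h
    change _ = v j at h
    rw [← h]
    refine Finset.sum_congr rfl fun i _ => ?_
    rw [Submodule.coe_smul, Rat.smul_def, mul_comm]
  have hker : ∀ r i, ∑ j, (T r j : ℚ) * c j i = 0 := by
    intro r i
    have h0 : ∑ j, (T r j : ℚ) • vW j = 0 := by
      apply Subtype.ext
      rw [AddSubmonoidClass.coe_finsetSum, ZeroMemClass.coe_zero, ← hv r]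
      refine Finset.sum_congr rfl fun j _ => ?_
      rw [Submodule.coe_smul, Rat.smul_def]
      simp [vW]
    have h1 := congrArg (fun w => e.repr w i) h0
    simpa [c] using h1
  have hzero : ∀ j, v j = 0 → ∀ i, c j i = 0 := by
    intro j hj i
    have : vW j = 0 := Subtype.ext hj
    simp [c, this]
  -- rational approximations of the basis that keep the signs
  have hopen : ∀ᶠ a : Fin (Module.finrank ℚ W) → ℝ in 𝓝 (fun i => (e i : ℝ)),
      ∀ j, SignType.sign (∑ i, a i * (c j i : ℝ)) = SignType.sign (v j) := by
    rw [eventually_all]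
    intro j
    have hcont : Continuous fun a : Fin (Module.finrank ℚ W) → ℝ => ∑ i, a i * (c j i : ℝ) := by
      fun_prop
    have hlim := hcont.tendsto (fun i => (e i : ℝ))
    simp only [← hc j] at hlim
    rcases lt_trichotomy (v j) 0 with h | h | h
    · filter_upwards [hlim.eventually (gt_mem_nhds h)] with a ha
      rw [sign_neg h, sign_neg ha]
    -- A zero entry has zero coordinates, so it stays zero under every perturbation.
    · refine Eventually.of_forall fun a => ?_
      simp [hzero j h, h]
    · filter_upwards [hlim.eventually (lt_mem_nhds h)] with a ha
      rw [sign_pos h, sign_pos ha]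
  have hdense : DenseRange (fun a : Fin (Module.finrank ℚ W) → ℚ => fun i => ((a i : ℚ) : ℝ)) :=
    DenseRange.piMap fun _ => Rat.denseRange_cast
  obtain ⟨a, ha⟩ := hdense.exists_mem_open isOpen_interior
    ⟨_, mem_interior_iff_mem_nhds.2 hopen⟩
  have ha := interior_subset ha
  simp only [Set.mem_ofPred_eq] at ha
  let h : J → ℚ := fun j => ∑ i, a i * c j i
  let N : ℕ := ∏ j, (h j).den
  have hN : 0 < N := Finset.prod_pos fun j _ => (h j).den_pos
  have hclear : ∀ j, ∃ z : ℤ, (z : ℚ) = N * h j := by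
    intro j
    obtain ⟨m, hm⟩ := Finset.dvd_prod_of_mem (fun j => (h j).den) (Finset.mem_univ j)
    refine ⟨m * (h j).num, ?_⟩
    have : (N : ℚ) = (h j).den * m := by exact_mod_cast hm
    rw [this]
    push_cast
    have h2 := Rat.mul_den_eq_num (h j)
    linear_combination -(m : ℚ) * h2
  choose g hg using hclear
  refine ⟨g, fun r => ?_, fun j => ?_⟩
  · have : ((∑ j, T r j * g j : ℤ) : ℚ) = 0 := by
      push_cast
      simp_rw [hg]
      have : ∀ j, (T r j : ℚ) * (N * h j) = N * ∑ i, a i * ((T r j : ℚ) * c j i) := by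
        intro j
        simp only [h]
        rw [Finset.mul_sum, Finset.mul_sum, Finset.mul_sum]
        exact Finset.sum_congr rfl fun i _ => by ring
      simp_rw [this]
      rw [← Finset.mul_sum, Finset.sum_comm]
      simp_rw [← Finset.mul_sum, hker]
      simp
    exact_mod_cast this
  · rw [← ha j]
    have h1 : ((g j : ℤ) : ℝ) = N * ∑ i, (a i : ℝ) * (c j i : ℝ) := by
      have := congrArg (Rat.cast : ℚ → ℝ) (hg j)
      push_cast [h] at this
      exact this
    have hN' : (0 : ℝ) < N := by exact_mod_cast hN
    have h2 : SignType.sign ((g j : ℤ) : ℝ) = SignType.sign (g j) := by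
      rcases lt_trichotomy (g j) 0 with h | h | h
      · rw [sign_neg h, sign_neg (by exact_mod_cast h)]
      · simp [h]
      · rw [sign_pos h, sign_pos (by exact_mod_cast h)]
    rw [← h2, h1, sign_mul, sign_pos hN', one_mul]

variable [DecidableEq J]

/-- Conformal decomposition: finitely many integer vectors generate the kernel of an integer matrix
by nonnegative combinations without cancellation. -/
theorem exists_conformal_generators (T : R → J → ℤ) :
    ∃ g : (J → SignType) → J → ℤ, (∀ k r, ∑ j, T r j * g k j = 0) ∧
      ∀ v : J → ℝ, (∀ r, ∑ j, (T r j : ℝ) * v j = 0) →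
        ∃ μ : (J → SignType) → ℝ, (∀ k, 0 ≤ μ k) ∧ (∀ j, v j = ∑ k, μ k * g k j) ∧
          ∀ k j, (0 ≤ v j → 0 ≤ μ k * g k j) ∧ (v j ≤ 0 → μ k * g k j ≤ 0) := by
  have key : ∀ σ : J → SignType, ∃ g : J → ℤ, (∀ r, ∑ j, T r j * g j = 0) ∧
      ∀ v : J → ℝ, (∀ r, ∑ j, (T r j : ℝ) * v j = 0) → (∀ j, SignType.sign (v j) = σ j) →
        ∀ j, SignType.sign (g j) = SignType.sign (v j) := by
    intro σ
    by_cases h : ∃ v : J → ℝ, (∀ r, ∑ j, (T r j : ℝ) * v j = 0) ∧ ∀ j, SignType.sign (v j) = σ j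
    · obtain ⟨v, hv, hσ⟩ := h
      obtain ⟨g, hg, hs⟩ := exists_int_kernel_sign T v hv
      exact ⟨g, hg, fun w _ hw j => by rw [hs, hσ, hw]⟩
    · exact ⟨0, by simp, fun v hv hσ => absurd ⟨v, hv, hσ⟩ h⟩
  choose g hg hs using key
  -- One generator per sign pattern suffices. Subtracting the largest multiple of the generator with
  -- the signs of `v` that does not overshoot kills an entry and reverses no sign, so induction on
  -- the support applies.
  refine ⟨g, hg, ?_⟩
  intro v
  induction hn : (Finset.univ.filter fun j => v j ≠ 0).card using Nat.strong_induction_on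
    generalizing v with
  | _ n ih =>
  intro hv
  by_cases h0 : ∀ j, v j = 0
  · exact ⟨0, by simp, by simp [h0], by simp⟩
  push Not at h0
  obtain ⟨j₀, hj₀⟩ := h0
  set σ : J → SignType := fun j => SignType.sign (v j) with hσ
  have hgs := hs σ v hv fun j => rfl
  obtain ⟨i, hi, hmin⟩ := Finset.exists_min_image (Finset.univ.filter fun j => v j ≠ 0)
    (fun j => v j / g σ j) ⟨j₀, by simpa using hj₀⟩
  simp only [Finset.mem_filter, Finset.mem_univ, true_and] at hi hmin
  set c : ℝ := v i / g σ i with hc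
  have hpos : ∀ j, 0 < v j → (0 : ℝ) < g σ j := fun j hj => by
    have := hgs j
    rw [sign_pos hj, sign_eq_one_iff] at this
    exact_mod_cast this
  have hneg : ∀ j, v j < 0 → (g σ j : ℝ) < 0 := fun j hj => by
    have := hgs j
    rw [sign_neg hj, sign_eq_neg_one_iff] at this
    exact_mod_cast this
  have hzer : ∀ j, v j = 0 → (g σ j : ℝ) = 0 := fun j hj => by
    have := hgs j
    rw [hj, sign_zero, sign_eq_zero_iff] at this
    exact_mod_cast this
  have hc0 : 0 ≤ c := by
    rcases lt_or_gt_of_ne hi with h | h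
    · exact (div_pos_of_neg_of_neg h (hneg i h)).le
    · exact (div_pos h (hpos i h)).le
  have hgi : (g σ i : ℝ) ≠ 0 := by
    rcases lt_or_gt_of_ne hi with h | h
    · exact (hneg i h).ne
    · exact (hpos i h).ne'
  have hvp : ∀ j, 0 ≤ v j → 0 ≤ v j - c * g σ j ∧ 0 ≤ c * g σ j := by
    intro j hj
    rcases hj.eq_or_lt with h | h
    · simp [← h, hzer j h.symm]
    · have h2 := hmin j h.ne'
      rw [le_div_iff₀ (hpos j h)] at h2
      exact ⟨by linarith, mul_nonneg hc0 (hpos j h).le⟩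
  have hvn : ∀ j, v j ≤ 0 → v j - c * g σ j ≤ 0 ∧ c * g σ j ≤ 0 := by
    intro j hj
    rcases hj.eq_or_lt with h | h
    · simp [h, hzer j h]
    · have h2 := hmin j h.ne
      rw [le_div_iff_of_neg (hneg j h)] at h2
      exact ⟨by linarith, mul_nonpos_of_nonneg_of_nonpos hc0 (hneg j h).le⟩
  obtain ⟨μ, hμ0, hμs, hμc⟩ := ih _ (by
      rw [← hn]
      apply Finset.card_lt_card
      rw [Finset.ssubset_iff_of_subset]
      · refine ⟨i, by simpa using hi, ?_⟩
        simp only [Finset.mem_filter, Finset.mem_univ, true_and, not_not]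
        rw [hc, div_mul_cancel₀ _ hgi, sub_self]
      · intro j
        simp only [Finset.mem_filter, Finset.mem_univ, true_and]
        intro hj h
        exact hj (by rw [h, hzer j h]; simp)) (fun j => v j - c * g σ j) rfl (by
      intro r
      have : ((∑ j, T r j * g σ j : ℤ) : ℝ) = 0 := by rw [hg σ r]; simp
      push_cast at this
      have h2 : ∀ j, (T r j : ℝ) * (v j - c * g σ j) = T r j * v j - c * (T r j * g σ j) :=
        fun j => by ring
      simp_rw [h2]
      rw [Finset.sum_sub_distrib, hv r, ← Finset.mul_sum, this]
      simp)
  refine ⟨fun k => μ k + if k = σ then c else 0, fun k => ?_, fun j => ?_, fun k j => ⟨fun h => ?_,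
    fun h => ?_⟩⟩
  · have := hμ0 k
    dsimp only
    split_ifs <;> linarith
  · simp only [add_mul, ite_mul, zero_mul, Finset.sum_add_distrib, Finset.sum_ite_eq',
      Finset.mem_univ, if_true]
    rw [← hμs j]
    ring
  · have h1 := (hμc k j).1 (hvp j h).1
    have h2 := (hvp j h).2
    rw [add_mul]
    split_ifs with hk
    · rw [hk] at h1 ⊢; linarith
    · linarith
  · have h1 := (hμc k j).2 (hvn j h).1
    have h2 := (hvn j h).2
    rw [add_mul]
    split_ifs with hk
    · rw [hk] at h1 ⊢; linarith
    · linarith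

variable [Fintype R] [DecidableEq R]

/-- The Hoffman error bound, with the coefficients of the correction rounded by `ρ`. -/
theorem exists_hoffman_rounding (T : R → J → ℤ) :
    ∃ (K : ℝ) (g : (J ⊕ R → SignType) → J → ℤ), 0 ≤ K ∧
      ∀ (ρ : ℝ → ℝ) (ε : ℝ), 0 ≤ ε → (∀ x, 0 ≤ x → 0 ≤ ρ x ∧ ρ x ≤ x ∧ x - ρ x ≤ ε) →
      ∀ y z : J → ℝ, (∀ j, 0 ≤ y j) → (∀ j, 0 ≤ z j) →
      ∃ μ : (J ⊕ R → SignType) → ℝ,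
        (∀ j, 0 ≤ z j + ∑ k, ρ (μ k) * g k j) ∧
        (∀ r, ∑ j, (T r j : ℝ) * (z j + ∑ k, ρ (μ k) * g k j) = ∑ j, (T r j : ℝ) * z j) ∧
        ∀ j, |z j + ∑ k, ρ (μ k) * g k j - y j| ≤
          K * (ε + ∑ r, |∑ j, (T r j : ℝ) * y j - ∑ j, (T r j : ℝ) * z j|) := by
  -- Slack coordinates record the image under `T`, so that `y - z` together with its residual
  -- becomes a kernel vector of `T` augmented by minus the identity.
  obtain ⟨G, hG, hdec⟩ := exists_conformal_generators (J := J ⊕ R) (R := R)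
    (fun r => Sum.elim (T r) (fun r' => if r = r' then -1 else 0))
  have hG' : ∀ k r, ∑ j, T r j * G k (.inl j) = G k (.inr r) := by
    intro k r
    have := hG k r
    simp only [Fintype.sum_sum_type, Sum.elim_inl, Sum.elim_inr, ite_mul, zero_mul,
      Finset.sum_ite_eq, Finset.mem_univ, if_true] at this
    linarith
  -- Generators without slack lie in the kernel of `T`. Only these are added to `z`, which leaves
  -- its image under `T` unchanged.
  let good : (J ⊕ R → SignType) → Prop := fun k => ∀ r, G k (.inr r) = 0
  let g : (J ⊕ R → SignType) → J → ℤ := fun k j => if good k then G k (.inl j) else 0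
  refine ⟨∑ k, ∑ j, |(G k (.inl j) : ℝ)|, g, by positivity, ?_⟩
  intro ρ ε hε hρ y z hy hz
  set Δ : R → ℝ := fun r => ∑ j, (T r j : ℝ) * y j - ∑ j, (T r j : ℝ) * z j with hΔ
  obtain ⟨μ, hμ0, hμs, hμc⟩ := hdec (Sum.elim (fun j => y j - z j) Δ) (by
    intro r
    simp only [Fintype.sum_sum_type, Sum.elim_inl, Sum.elim_inr, Int.cast_ite, ite_mul,
      Finset.sum_ite_eq, Finset.mem_univ, if_true, Int.cast_zero, zero_mul, mul_sub,
      Finset.sum_sub_distrib, hΔ]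
    simp)
  -- A bad generator has an integer slack entry of absolute value at least one, and conformality
  -- excludes cancellation there, so its coefficient is bounded by a residual.
  have hbad : ∀ k, ¬ good k → μ k ≤ ∑ r, |Δ r| := by
    intro k hk
    simp only [good, not_forall] at hk
    obtain ⟨r, hr⟩ := hk
    have h1 : (1 : ℝ) ≤ |(G k (.inr r) : ℝ)| := by exact_mod_cast Int.one_le_abs hr
    have h2 : |μ k * G k (.inr r)| ≤ |Δ r| := by
      have hs : Δ r = ∑ k, μ k * G k (.inr r) := hμs (.inr r)
      rcases le_total 0 (Δ r) with h | h
      · rw [abs_of_nonneg h, abs_of_nonneg ((hμc k (.inr r)).1 h), hs]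
        exact Finset.single_le_sum (f := fun k => μ k * (G k (.inr r) : ℝ))
          (fun k _ => (hμc k (.inr r)).1 h) (Finset.mem_univ k)
      · rw [abs_of_nonpos h, abs_of_nonpos ((hμc k (.inr r)).2 h), hs, neg_le_neg_iff,
          ← neg_le_neg_iff, ← Finset.sum_neg_distrib]
        exact Finset.single_le_sum (f := fun k => -(μ k * (G k (.inr r) : ℝ)))
          (fun k _ => neg_nonneg.2 ((hμc k (.inr r)).2 h)) (Finset.mem_univ k)
    rw [abs_mul, abs_of_nonneg (hμ0 k)] at h2
    calc μ k = μ k * 1 := (mul_one _).symm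
      _ ≤ μ k * |(G k (.inr r) : ℝ)| := mul_le_mul_of_nonneg_left h1 (hμ0 k)
      _ ≤ |Δ r| := h2
      _ ≤ ∑ r, |Δ r| := Finset.single_le_sum (f := fun r => |Δ r|) (fun _ _ => abs_nonneg _)
          (Finset.mem_univ r)
  have hS : 0 ≤ ∑ r, |Δ r| := Finset.sum_nonneg fun _ _ => abs_nonneg _
  -- a rounded coefficient contributes between nothing and its full share
  have hterm : ∀ k j, (0 ≤ y j - z j → 0 ≤ ρ (μ k) * g k j) ∧
      (y j - z j ≤ 0 → ρ (μ k) * g k j ≤ 0 ∧ μ k * G k (.inl j) ≤ ρ (μ k) * g k j) := by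
    intro k j
    obtain ⟨hr0, hr1, -⟩ := hρ (μ k) (hμ0 k)
    have hcon := hμc k (.inl j)
    simp only [Sum.elim_inl] at hcon
    simp only [g]
    split_ifs with hk
    · rcases (hμ0 k).eq_or_lt with h | h
      · have : ρ (μ k) = 0 := le_antisymm (hr1.trans h.ge) hr0
        rw [this, ← h]
        simp
      · constructor
        · intro hh
          exact mul_nonneg hr0 (nonneg_of_mul_nonneg_right (hcon.1 hh) h)
        · intro hh
          have hG0 : (G k (.inl j) : ℝ) ≤ 0 := by
            by_contra hcc
            push Not at hcc
            exact absurd (hcon.2 hh) (not_le.2 (mul_pos h hcc))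
          exact ⟨mul_nonpos_of_nonneg_of_nonpos hr0 hG0, mul_le_mul_of_nonpos_right hr1 hG0⟩
    · simpa using hcon.2
  refine ⟨μ, fun j => ?_, fun r => ?_, fun j => ?_⟩
  · rcases le_total 0 (y j - z j) with h | h
    · exact add_nonneg (hz j) (Finset.sum_nonneg fun k _ => (hterm k j).1 h)
    -- All terms are nonpositive here, so dropping them or rounding them down leaves the sum above
    -- `y j`, which is nonnegative.
    · have h1 : y j - z j = ∑ k, μ k * G k (.inl j) := hμs (.inl j)
      have h2 : ∑ k, μ k * (G k (.inl j) : ℝ) ≤ ∑ k, ρ (μ k) * g k j :=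
        Finset.sum_le_sum fun k _ => ((hterm k j).2 h).2
      linarith [hy j]
  · simp only [mul_add, Finset.sum_add_distrib, Finset.mul_sum]
    have : ∀ k, ∑ j, (T r j : ℝ) * (ρ (μ k) * g k j) = 0 := by
      intro k
      have h1 : ∑ j, T r j * g k j = 0 := by
        simp only [g]
        split_ifs with hk
        · rw [hG' k r]; exact hk r
        · simp
      have h2 : ((∑ j, T r j * g k j : ℤ) : ℝ) = 0 := by rw [h1]; simp
      push_cast at h2
      calc ∑ j, (T r j : ℝ) * (ρ (μ k) * g k j) = ρ (μ k) * ∑ j, (T r j : ℝ) * g k j := by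
            rw [Finset.mul_sum]; exact Finset.sum_congr rfl fun j _ => by ring
        _ = 0 := by rw [h2, mul_zero]
    rw [Finset.sum_comm (s := (Finset.univ : Finset J))]
    simp [this]
  · have h1 : y j - z j = ∑ k, μ k * G k (.inl j) := hμs (.inl j)
    have h2 : z j + ∑ k, ρ (μ k) * g k j - y j = ∑ k, (ρ (μ k) * g k j - μ k * G k (.inl j)) := by
      rw [Finset.sum_sub_distrib, ← h1]; ring
    rw [h2]
    refine (Finset.abs_sum_le_sum_abs _ _).trans ?_
    rw [Finset.sum_mul]
    refine Finset.sum_le_sum fun k _ => ?_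
    have h3 : |ρ (μ k) * (g k j : ℝ) - μ k * G k (.inl j)| ≤
        |(G k (.inl j) : ℝ)| * (ε + ∑ r, |Δ r|) := by
      obtain ⟨hr0, hr1, hr2⟩ := hρ (μ k) (hμ0 k)
      simp only [g]
      split_ifs with hk
      · rw [← sub_mul, abs_mul, mul_comm, abs_sub_comm, abs_of_nonneg (sub_nonneg.2 hr1)]
        exact mul_le_mul_of_nonneg_left (by linarith) (abs_nonneg _)
      · rw [Int.cast_zero, mul_zero, zero_sub, abs_neg, abs_mul, mul_comm, abs_of_nonneg (hμ0 k)]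
        exact mul_le_mul_of_nonneg_left (by linarith [hbad k hk]) (abs_nonneg _)
    refine h3.trans (mul_le_mul_of_nonneg_right ?_ (by positivity))
    exact Finset.single_le_sum (f := fun j => |(G k (.inl j) : ℝ)|) (fun _ _ => abs_nonneg _)
      (Finset.mem_univ j)

/-- The Hoffman error bound for the system `T x = c`, `0 ≤ x`. -/
theorem exists_hoffman (T : R → J → ℤ) :
    ∃ K : ℝ, 0 ≤ K ∧ ∀ y z : J → ℝ, (∀ j, 0 ≤ y j) → (∀ j, 0 ≤ z j) →
      ∃ x : J → ℝ, (∀ j, 0 ≤ x j) ∧ (∀ r, ∑ j, (T r j : ℝ) * x j = ∑ j, (T r j : ℝ) * z j) ∧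
        ∀ j, |x j - y j| ≤ K * ∑ r, |∑ j, (T r j : ℝ) * y j - ∑ j, (T r j : ℝ) * z j| := by
  obtain ⟨K, g, hK, h⟩ := exists_hoffman_rounding T
  refine ⟨K, hK, fun y z hy hz => ?_⟩
  obtain ⟨μ, h1, h2, h3⟩ := h id 0 le_rfl (fun x hx => by simp [hx]) y z hy hz
  exact ⟨_, h1, h2, fun j => by simpa using h3 j⟩

/-- Integer points of `T x = c`, `0 ≤ x` approximate its real points, provided there are any. -/
theorem exists_hoffman_nat (T : R → J → ℤ) :
    ∃ K : ℝ, 0 ≤ K ∧ ∀ (y : J → ℝ) (z : J → ℕ), (∀ j, 0 ≤ y j) →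
      ∃ x : J → ℕ, (∀ r, ∑ j, (T r j : ℝ) * x j = ∑ j, (T r j : ℝ) * z j) ∧
        ∀ j, |(x j : ℝ) - y j| ≤
          K * (1 + ∑ r, |∑ j, (T r j : ℝ) * y j - ∑ j, (T r j : ℝ) * z j|) := by
  obtain ⟨K, g, hK, h⟩ := exists_hoffman_rounding T
  refine ⟨K, hK, fun y z hy => ?_⟩
  obtain ⟨μ, h1, h2, h3⟩ := h (fun x => (⌊x⌋ : ℝ)) 1 zero_le_one (fun x hx =>
    ⟨by exact_mod_cast Int.floor_nonneg.2 hx, Int.floor_le x, by linarith [Int.lt_floor_add_one x]⟩)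
    y (fun j => z j) hy (fun j => Nat.cast_nonneg _)
  have hx : ∀ j, ∃ m : ℕ, (m : ℝ) = (z j : ℝ) + ∑ k, (⌊μ k⌋ : ℝ) * g k j := by
    intro j
    have h0 : (0 : ℤ) ≤ (z j : ℤ) + ∑ k, ⌊μ k⌋ * g k j := by exact_mod_cast h1 j
    obtain ⟨m, hm⟩ := Int.eq_ofNat_of_zero_le h0
    exact ⟨m, by exact_mod_cast hm.symm⟩
  choose x hx using hx
  exact ⟨x, fun r => by simpa only [hx] using h2 r, fun j => by simpa only [hx] using h3 j⟩

end Conformal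

noncomputable section

/-! ### Continuity of optimal values over polyhedra -/

section ValueFunction

variable {J R : Type*} [Fintype J]

/-- The polyhedron `T x = c`, `0 ≤ x`. -/
def polySet (T : R → J → ℤ) (c : R → ℝ) : Set (J → ℝ) :=
  {x | (∀ j, 0 ≤ x j) ∧ ∀ r, ∑ j, (T r j : ℝ) * x j = c r}

/-- The supremum of `F` over the polyhedron `T x = c`, `0 ≤ x`. -/
def valueFn (T : R → J → ℤ) (F : (J → ℝ) → ℝ) (c : R → ℝ) : ℝ := sSup (F '' polySet T c)

theorem isClosed_polySet (T : R → J → ℤ) (c : R → ℝ) : IsClosed (polySet T c) := by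
  have : polySet T c = (⋂ j, {x | 0 ≤ x j}) ∩ ⋂ r, {x | ∑ j, (T r j : ℝ) * x j = c r} := by
    ext x; simp [polySet]
  rw [this]
  refine (isClosed_iInter fun j => isClosed_le continuous_const (continuous_apply j)).inter
    (isClosed_iInter fun r => isClosed_eq ?_ continuous_const)
  fun_prop

theorem isCompact_polySet {T : R → J → ℤ} {c : R → ℝ} {M : J → ℝ}
    (hM : ∀ x ∈ polySet T c, ∀ j, x j ≤ M j) : IsCompact (polySet T c) :=
  (isCompact_Icc (a := (0 : J → ℝ)) (b := M)).of_isClosed_subset (isClosed_polySet T c)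
    fun x hx => ⟨fun j => hx.1 j, fun j => hM x hx j⟩

theorem le_valueFn {T : R → J → ℤ} {F : (J → ℝ) → ℝ} (hF : Continuous F) {c : R → ℝ} {M : J → ℝ}
    (hM : ∀ x ∈ polySet T c, ∀ j, x j ≤ M j) {x : J → ℝ} (hx : x ∈ polySet T c) :
    F x ≤ valueFn T F c :=
  le_csSup ((isCompact_polySet hM).image hF).bddAbove ⟨x, hx, rfl⟩

theorem exists_eq_valueFn {T : R → J → ℤ} {F : (J → ℝ) → ℝ} (hF : Continuous F) {c : R → ℝ}
    {M : J → ℝ} (hM : ∀ x ∈ polySet T c, ∀ j, x j ≤ M j) (hne : (polySet T c).Nonempty) :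
    ∃ x ∈ polySet T c, F x = valueFn T F c :=
  ((isCompact_polySet hM).image hF).sSup_mem (hne.image F)

theorem valueFn_eq {T : R → J → ℤ} {F : (J → ℝ) → ℝ} {c : R → ℝ} {x : J → ℝ}
    (hx : x ∈ polySet T c) (hmax : ∀ y ∈ polySet T c, F y ≤ F x) : valueFn T F c = F x :=
  IsGreatest.csSup_eq ⟨⟨x, hx, rfl⟩, by rintro _ ⟨y, hy, rfl⟩; exact hmax y hy⟩

/-- The value function of a continuous objective over bounded polyhedra `T x = c`, `0 ≤ x` depends
continuously on `c`. -/
theorem continuousOn_valueFn [Fintype R] {T : R → J → ℤ} {F : (J → ℝ) → ℝ} (hF : Continuous F)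
    {Dom : Set (R → ℝ)} {M : J → ℝ} (hM : ∀ c ∈ Dom, ∀ x ∈ polySet T c, ∀ j, x j ≤ M j)
    (hne : ∀ c ∈ Dom, (polySet T c).Nonempty) : ContinuousOn (valueFn T F) Dom := by
  classical
  obtain ⟨K, hK, hH⟩ := exists_hoffman T
  have huc : UniformContinuousOn F (Set.Icc 0 M) :=
    isCompact_Icc.uniformContinuousOn_of_continuous hF.continuousOn
  rw [Metric.uniformContinuousOn_iff] at huc
  -- one-sided estimate
  have key : ∀ ε > 0, ∃ δ > 0, ∀ c ∈ Dom, ∀ c' ∈ Dom, K * ∑ r, |c r - c' r| < δ →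
      valueFn T F c < valueFn T F c' + ε := by
    intro ε hε
    obtain ⟨δ, hδ, h⟩ := huc ε hε
    refine ⟨δ, hδ, fun c hc c' hc' hcc => ?_⟩
    obtain ⟨y, hy, hyv⟩ := exists_eq_valueFn hF (hM c hc) (hne c hc)
    -- Any feasible point for `c'` will do: the error bound depends only on its statistics, and it
    -- moves the maximizer for `c` to a nearby point feasible for `c'`.
    obtain ⟨z, hz⟩ := hne c' hc'
    obtain ⟨x, hx0, hxT, hxy⟩ := hH y z hy.1 hz.1
    have hx : x ∈ polySet T c' := ⟨hx0, fun r => (hxT r).trans (hz.2 r)⟩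
    have hd : dist y x < δ := by
      refine (dist_pi_lt_iff hδ).2 fun j => ?_
      rw [Real.dist_eq, abs_sub_comm]
      refine (hxy j).trans_lt ?_
      simpa only [hy.2, hz.2] using hcc
    have h1 := h y ⟨fun j => hy.1 j, fun j => hM c hc y hy j⟩ x
      ⟨fun j => hx.1 j, fun j => hM c' hc' x hx j⟩ hd
    rw [Real.dist_eq] at h1
    have h2 := le_valueFn hF (hM c' hc') hx
    linarith [(abs_lt.1 h1).2]
  intro c hc
  rw [ContinuousWithinAt, Metric.tendsto_nhds]
  intro ε hε
  obtain ⟨δ, hδ, h⟩ := key ε hε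
  have hlim : Tendsto (fun c' : R → ℝ => K * ∑ r, |c r - c' r|) (𝓝[Dom] c) (𝓝 0) := by
    have : Continuous (fun c' : R → ℝ => K * ∑ r, |c r - c' r|) := by fun_prop
    have h0 := this.tendsto c
    simp only [sub_self, abs_zero, Finset.sum_const_zero, mul_zero] at h0
    exact h0.mono_left nhdsWithin_le_nhds
  filter_upwards [hlim.eventually (gt_mem_nhds hδ), self_mem_nhdsWithin] with c' h1 h2
  have h3 := h c hc c' h2 h1
  have h4 := h c' h2 c hc (by simpa only [abs_sub_comm] using h1)
  rw [Real.dist_eq, abs_lt]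
  constructor <;> linarith

end ValueFunction

/-! ### Entropy maximization and exponential families -/

section Entropy

variable {S : Type*} [Fintype S]

/-- The exponential growth rate of the number of sequences with empirical distribution proportional
to `x`, each symbol `s` being available in `c s` variants. -/
def entFn (c : S → ℝ) (x : S → ℝ) : ℝ :=
  ∑ s, (Real.negMulLog (x s) + x s * Real.log (c s)) - Real.negMulLog (∑ s, x s)

theorem continuous_entFn (c : S → ℝ) : Continuous (entFn c) := by
  unfold entFn
  refine Continuous.sub (continuous_finsetSum _ fun s _ => ?_) ?_
  · exact (Real.continuous_negMulLog.comp (continuous_apply s)).add (by fun_prop)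
  · exact Real.continuous_negMulLog.comp (by fun_prop)

/-- This is `log u ≤ u - 1` at `u = r / x`, multiplied by `x`; `x = 0` needs the convention
`negMulLog 0 = 0`. Summed over symbols it yields the Gibbs inequality. -/
theorem negMulLog_add_mul_log_le {x r : ℝ} (hx : 0 ≤ x) (hr : 0 < r) :
    Real.negMulLog x + x * Real.log r ≤ r - x := by
  rcases hx.eq_or_lt with rfl | hx
  · simp [hr.le]
  · have h := Real.log_le_sub_one_of_pos (div_pos hr hx)
    rw [Real.log_div hr.ne' hx.ne'] at h
    have h2 := mul_le_mul_of_nonneg_left h hx.le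
    have h3 : x * (r / x - 1) = r - x := by field_simp
    rw [h3] at h2
    rw [Real.negMulLog]
    linarith

/-- The Gibbs inequality. -/
theorem entFn_le {c : S → ℝ} (hc : ∀ s, 0 < c s) (g : S → ℝ) {x : S → ℝ} (hx : ∀ s, 0 ≤ x s)
    {d : ℝ} (hd : 0 < d) (hsum : ∑ s, x s = d) :
    entFn c x ≤ d * Real.log (∑ s, c s * Real.exp (g s)) - ∑ s, x s * g s := by
  have hS : Nonempty S := by
    by_contra h
    rw [not_nonempty_iff] at h
    simp at hsum
    linarith
  set Z := ∑ s, c s * Real.exp (g s) with hZ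
  have hZ0 : 0 < Z := Finset.sum_pos (fun s _ => mul_pos (hc s) (Real.exp_pos _))
    Finset.univ_nonempty
  -- The comparison weights `d * c * exp g / Z` have the same total mass as `x`, so the right-hand
  -- sides add up to zero.
  have h1 : ∑ s, (Real.negMulLog (x s) + x s * Real.log (d * (c s * Real.exp (g s)) / Z)) ≤
      ∑ s, (d * (c s * Real.exp (g s)) / Z - x s) :=
    Finset.sum_le_sum fun s _ => negMulLog_add_mul_log_le (hx s)
      (div_pos (mul_pos hd (mul_pos (hc s) (Real.exp_pos _))) hZ0)
  have h2 : ∑ s, (d * (c s * Real.exp (g s)) / Z - x s) = 0 := by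
    rw [Finset.sum_sub_distrib, hsum, ← Finset.sum_div, ← Finset.mul_sum, ← hZ]
    field_simp
    simp
  have h3 : ∀ s, Real.log (d * (c s * Real.exp (g s)) / Z) =
      Real.log (c s) + g s + (Real.log d - Real.log Z) := by
    intro s
    rw [Real.log_div (by have := hc s; positivity) hZ0.ne', Real.log_mul hd.ne'
      (by have := hc s; positivity), Real.log_mul (hc s).ne' (Real.exp_ne_zero _), Real.log_exp]
    ring
  simp only [h3, mul_add, Finset.sum_add_distrib, ← Finset.sum_mul, hsum] at h1
  rw [h2] at h1
  simp only [entFn, Finset.sum_add_distrib, hsum]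
  rw [Real.negMulLog]
  linarith

/-- The case of equality in the Gibbs inequality. -/
theorem entFn_eq {c : S → ℝ} (hc : ∀ s, 0 < c s) (g : S → ℝ) {x : S → ℝ} {d : ℝ} (hd : 0 < d)
    (hx : ∀ s, x s = d * (c s * Real.exp (g s)) / ∑ s, c s * Real.exp (g s))
    (hsum : ∑ s, x s = d) :
    entFn c x = d * Real.log (∑ s, c s * Real.exp (g s)) - ∑ s, x s * g s := by
  have hS : Nonempty S := by
    by_contra h
    rw [not_nonempty_iff] at h
    simp at hsum
    linarith
  set Z := ∑ s, c s * Real.exp (g s) with hZ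
  have hZ0 : 0 < Z := Finset.sum_pos (fun s _ => mul_pos (hc s) (Real.exp_pos _))
    Finset.univ_nonempty
  have h3 : ∀ s, Real.log (x s) = Real.log (c s) + g s + (Real.log d - Real.log Z) := by
    intro s
    rw [hx, Real.log_div (by have := hc s; positivity) hZ0.ne', Real.log_mul hd.ne'
      (by have := hc s; positivity), Real.log_mul (hc s).ne' (Real.exp_ne_zero _), Real.log_exp]
    ring
  have h4 : ∀ s, Real.negMulLog (x s) + x s * Real.log (c s) =
      x s * (Real.log Z - Real.log d) - x s * g s := by
    intro s
    rw [Real.negMulLog, h3]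
    ring
  simp only [entFn, h4]
  rw [Finset.sum_sub_distrib, ← Finset.sum_mul, hsum, Real.negMulLog]
  ring

variable {R : Type*}

/-- A row of ones among the statistics makes the polyhedron bounded, since no nonnegative entry
exceeds the total mass. -/
theorem le_sum_of_mem_polySet {T : R → S → ℤ} {r₀ : R} (hr₀ : ∀ s, T r₀ s = 1) {c : R → ℝ}
    {x : S → ℝ} (hx : x ∈ polySet T c) (s : S) : x s ≤ c r₀ := by
  have h : ∑ s, x s = c r₀ := by simpa [hr₀] using hx.2 r₀
  rw [← h]
  exact Finset.single_le_sum (fun s _ => hx.1 s) (Finset.mem_univ s)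

/-- A maximizer of the entropy over a polyhedron that contains a positive point is positive. -/
theorem pos_of_isMaxOn_entFn {c : S → ℝ} {x y : S → ℝ} (hx : ∀ s, 0 ≤ x s) (hy : ∀ s, 0 < y s)
    (hsum : ∑ s, x s = ∑ s, y s)
    (hmax : ∀ ε ∈ Set.Ioo (0 : ℝ) 1, entFn c (fun s => (1 - ε) * x s + ε * y s) ≤ entFn c x)
    (s₀ : S) : 0 < x s₀ := by
  classical
  by_contra hs₀
  have hs₀ : x s₀ = 0 := le_antisymm (not_lt.1 hs₀) (hx s₀)
  -- `m` is the mass of `y` where `x` vanishes. A step of size `ε` from `x` towards `y` gains `-ε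
  -- log ε * m` there, and by concavity loses at most a multiple of `ε` otherwise.
  set m : ℝ := ∑ s, if x s = 0 then y s else 0 with hm
  have hm0 : 0 < m := by
    refine Finset.sum_pos' (fun s _ => ?_) ⟨s₀, Finset.mem_univ _, by simp [hs₀, hy s₀]⟩
    split_ifs
    exacts [(hy s).le, le_rfl]
  have hlow : ∀ ε ∈ Set.Ioo (0 : ℝ) 1, entFn c x + ε * (entFn c y - entFn c x - Real.log ε * m) ≤
      entFn c (fun s => (1 - ε) * x s + ε * y s) := by
    intro ε hε
    have hs : ∑ s, ((1 - ε) * x s + ε * y s) = ∑ s, x s := by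
      rw [Finset.sum_add_distrib, ← Finset.mul_sum, ← Finset.mul_sum, ← hsum]; ring
    have hterm : ∀ s, (1 - ε) * (Real.negMulLog (x s) + x s * Real.log (c s)) +
        ε * (Real.negMulLog (y s) + y s * Real.log (c s)) +
          (-(ε * Real.log ε)) * (if x s = 0 then y s else 0) ≤
        Real.negMulLog ((1 - ε) * x s + ε * y s) + ((1 - ε) * x s + ε * y s) * Real.log (c s) := by
      intro s
      split_ifs with h
      · rw [h, mul_zero, zero_add, Real.negMulLog_mul]
        simp only [Real.negMulLog]
        apply le_of_eq
        simp
        ring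
      · have hconc := Real.concaveOn_negMulLog.2 (Set.mem_Ici.2 (hx s)) (Set.mem_Ici.2 (hy s).le)
          (show 0 ≤ 1 - ε by linarith [hε.2]) hε.1.le (by ring)
        simp only [smul_eq_mul] at hconc
        linarith
    have hsumm := Finset.sum_le_sum fun s (_ : s ∈ Finset.univ) => hterm s
    rw [Finset.sum_add_distrib, Finset.sum_add_distrib, ← Finset.mul_sum, ← Finset.mul_sum,
      ← Finset.mul_sum, ← hm] at hsumm
    simp only [entFn, hs]
    rw [← hsum]
    linarith
  set C := entFn c x - entFn c y with hC
  -- Chosen so that `-log ε * m = |C| + 1`, which beats the linear loss `C`.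
  set ε := Real.exp (-((|C| + 1) / m)) with hε
  have hε01 : ε ∈ Set.Ioo (0 : ℝ) 1 := by
    have h : 0 < (|C| + 1) / m := by positivity
    exact ⟨Real.exp_pos _, Real.exp_lt_one_iff.2 (neg_lt_zero.2 h)⟩
  have h1 := (hlow ε hε01).trans (hmax ε hε01)
  have h2 : Real.log ε * m = -(|C| + 1) := by
    rw [hε, Real.log_exp]; field_simp
  rw [h2] at h1
  have h3 : 0 < entFn c y - entFn c x - -(|C| + 1) := by
    have := le_abs_self C
    linarith
  have := mul_pos hε01.1 h3
  linarith

/-- If the polyhedron of a family of statistics `T`, one of which is the total mass, contains a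
positive point, it contains a member of the exponential family of `T`. -/
theorem exists_exponential_mem {T : R → S → ℤ} [Fintype R] {r₀ : R} (hr₀ : ∀ s, T r₀ s = 1)
    {c : S → ℝ} (hc : ∀ s, 0 < c s) {y : S → ℝ} (hy : ∀ s, 0 < y s) :
    ∃ g : R → ℝ, ∀ r, ∑ s, (T r s : ℝ) * (c s * Real.exp (∑ r, g r * T r s)) =
      ∑ s, (T r s : ℝ) * y s := by
  classical
  set b : R → ℝ := fun r => ∑ s, (T r s : ℝ) * y s with hb
  have hyb : y ∈ polySet T b := ⟨fun s => (hy s).le, fun r => rfl⟩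
  have hM : ∀ x ∈ polySet T b, ∀ s, x s ≤ b r₀ := fun x hx s => le_sum_of_mem_polySet hr₀ hx s
  obtain ⟨x, hx, hxv⟩ := exists_eq_valueFn (continuous_entFn c) (M := fun _ => b r₀) hM ⟨y, hyb⟩
  have hmax : ∀ z ∈ polySet T b, entFn c z ≤ entFn c x := fun z hz => by
    rw [hxv]; exact le_valueFn (continuous_entFn c) (M := fun _ => b r₀) hM hz
  have hmass : ∀ z ∈ polySet T b, ∑ s, z s = b r₀ := fun z hz => by simpa [hr₀] using hz.2 r₀
  have hpos : ∀ s, 0 < x s := by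
    refine pos_of_isMaxOn_entFn (c := c) hx.1 hy (by rw [hmass x hx, hmass y hyb]) ?_
    intro ε hε
    refine hmax _ ⟨fun s => ?_, fun r => ?_⟩
    · have := hx.1 s
      have := (hy s).le
      have := hε.1.le
      have : 0 ≤ 1 - ε := by linarith [hε.2]
      positivity
    · have h1 := hx.2 r
      have h2 := hyb.2 r
      simp only [mul_add, Finset.sum_add_distrib]
      simp only [mul_left_comm _ (1 - ε), mul_left_comm _ ε, ← Finset.mul_sum]
      rw [h1, h2]; ring
  -- stationarity
  have hstat : ∀ v : S → ℝ, (∀ r, ∑ s, (T r s : ℝ) * v s = 0) →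
      ∑ s, v s * (Real.log (x s) - Real.log (c s)) = 0 := by
    intro v hv
    -- Total mass is one of the statistics, so the constant terms of the derivative drop out.
    have hv0 : ∑ s, v s = 0 := by simpa [hr₀] using hv r₀
    have hderiv : HasDerivAt (fun t : ℝ => entFn c (fun s => x s + t * v s))
        (∑ s, ((-Real.log (x s) - 1) * v s + v s * Real.log (c s)) - 0) 0 := by
      have hconst : ∀ t : ℝ, ∑ s, (x s + t * v s) = ∑ s, x s := by
        intro t
        rw [Finset.sum_add_distrib, ← Finset.mul_sum, hv0]; simp
      simp only [entFn, hconst]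
      refine HasDerivAt.sub (HasDerivAt.fun_sum fun s _ => ?_) (hasDerivAt_const _ _)
      have hlin : HasDerivAt (fun t : ℝ => x s + t * v s) (v s) 0 := by
        simpa using ((hasDerivAt_id (0 : ℝ)).mul_const (v s)).const_add (x s)
      refine HasDerivAt.add ?_ (hlin.mul_const _)
      have h1 := Real.hasDerivAt_negMulLog (hpos s).ne'
      have h2 : HasDerivAt Real.negMulLog (-Real.log (x s) - 1) (x s + 0 * v s) := by simpa using h1
      exact h2.comp (0 : ℝ) hlin
    have hloc : IsLocalMax (fun t : ℝ => entFn c (fun s => x s + t * v s)) 0 := by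
      have hev : ∀ᶠ t : ℝ in 𝓝 0, ∀ s, 0 < x s + t * v s := by
        rw [eventually_all]
        intro s
        have : Continuous fun t : ℝ => x s + t * v s := by fun_prop
        have h0 := this.tendsto 0
        simp only [zero_mul, add_zero] at h0
        exact h0.eventually (lt_mem_nhds (hpos s))
      filter_upwards [hev] with t ht
      simp only [zero_mul, add_zero]
      refine hmax _ ⟨fun s => (ht s).le, fun r => ?_⟩
      simp only [mul_add, Finset.sum_add_distrib, mul_left_comm _ t, ← Finset.mul_sum]
      rw [hv r, hx.2 r]; simp
    have h0 := hloc.hasDerivAt_eq_zero hderiv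
    have h1 : ∑ s, ((-Real.log (x s) - 1) * v s + v s * Real.log (c s)) =
        -(∑ s, v s * (Real.log (x s) - Real.log (c s))) - ∑ s, v s := by
      rw [← Finset.sum_neg_distrib, ← Finset.sum_sub_distrib]
      exact Finset.sum_congr rfl fun s _ => by ring
    rw [h1, hv0] at h0
    linarith
  -- A linear form that vanishes on the common kernel of the rows of `T` is a combination of these
  -- rows. The coefficients `g` are the Lagrange multipliers.
  let form : (S → ℝ) → ((S → ℝ) →ₗ[ℝ] ℝ) := fun w => Fintype.linearCombination ℝ w
  have hspan : form (fun s => Real.log (x s) - Real.log (c s)) ∈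
      Submodule.span ℝ (Set.range fun r => form (fun s => (T r s : ℝ))) := by
    apply mem_span_of_iInf_ker_le_ker
    intro v hv
    simp only [Submodule.mem_iInf, LinearMap.mem_ker, form, Fintype.linearCombination_apply,
      smul_eq_mul] at hv ⊢
    exact hstat v fun r => by simpa only [mul_comm] using hv r
  obtain ⟨g, hg⟩ := (Submodule.mem_span_range_iff_exists_fun ℝ).1 hspan
  have hg' : ∀ s, ∑ r, g r * T r s = Real.log (x s) - Real.log (c s) := by
    intro s
    have := congrArg (fun f : (S → ℝ) →ₗ[ℝ] ℝ => f (Pi.single s 1)) hg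
    simpa [form, Fintype.linearCombination_apply, Pi.single_apply] using this
  refine ⟨g, fun r => ?_⟩
  refine Eq.trans ?_ (hx.2 r)
  refine Finset.sum_congr rfl fun s _ => ?_
  rw [hg', Real.exp_sub, Real.exp_log (hpos s), Real.exp_log (hc s),
    mul_div_cancel₀ _ (ne_of_gt (hc s))]

/-- A member of an exponential family is determined by its statistics. -/
theorem exponential_injective {T : R → S → ℤ} [Fintype R] {c : S → ℝ} (hc : ∀ s, 0 < c s)
    {g g' : R → ℝ} (h : ∀ r, ∑ s, (T r s : ℝ) * (c s * Real.exp (∑ r, g r * T r s)) =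
      ∑ s, (T r s : ℝ) * (c s * Real.exp (∑ r, g' r * T r s))) (s : S) :
    ∑ r, g r * T r s = ∑ r, g' r * T r s := by
  set a : S → ℝ := fun s => ∑ r, g r * T r s with ha
  set a' : S → ℝ := fun s => ∑ r, g' r * T r s with ha'
  -- Each product is nonnegative because `exp` is increasing. The sum vanishes because the exponents
  -- are combinations of the statistics, on which the two members agree; hence every product is
  -- zero.
  have hnn : ∀ s, 0 ≤ (a s - a' s) * (c s * Real.exp (a s) - c s * Real.exp (a' s)) := by
    intro s
    rw [← mul_sub, mul_left_comm]
    refine mul_nonneg (hc s).le ?_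
    rcases le_total (a s) (a' s) with h | h
    · exact mul_nonneg_of_nonpos_of_nonpos (by linarith) (by linarith [Real.exp_le_exp.2 h])
    · exact mul_nonneg (by linarith) (by linarith [Real.exp_le_exp.2 h])
  have hz : ∑ s, (a s - a' s) * (c s * Real.exp (a s) - c s * Real.exp (a' s)) = 0 := by
    have h1 : ∀ s, (a s - a' s) * (c s * Real.exp (a s) - c s * Real.exp (a' s)) =
        ∑ r, (g r - g' r) * (T r s * (c s * Real.exp (a s)) - T r s * (c s * Real.exp (a' s))) := by
      intro s
      conv_lhs => rw [ha, ha']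
      rw [← Finset.sum_sub_distrib, Finset.sum_mul]
      exact Finset.sum_congr rfl fun r _ => by ring
    simp_rw [h1]
    rw [Finset.sum_comm]
    refine Finset.sum_eq_zero fun r _ => ?_
    rw [← Finset.mul_sum, Finset.sum_sub_distrib, h r, sub_self, mul_zero]
  have h0 := (Finset.sum_eq_zero_iff_of_nonneg fun s _ => hnn s).1 hz s (Finset.mem_univ s)
  rcases mul_eq_zero.1 h0 with h1 | h1
  · exact sub_eq_zero.1 h1
  · rw [← mul_sub] at h1
    have h2 := (mul_eq_zero.1 h1).resolve_left (hc s).ne'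
    exact Real.exp_injective (sub_eq_zero.1 h2)

end Entropy

end

noncomputable section

/-! ### Mixing points of polyhedra -/

section PolySet

variable {J R : Type*} [Fintype J]

theorem combo_mem_polySet {T : R → J → ℤ} {c c' d : R → ℝ} {x x' : J → ℝ} {θ : ℝ}
    (hx : x ∈ polySet T c) (hx' : x' ∈ polySet T c') (h0 : 0 ≤ θ) (h1 : θ ≤ 1)
    (hd : ∀ r, (1 - θ) * c r + θ * c' r = d r) :
    (fun j => (1 - θ) * x j + θ * x' j) ∈ polySet T d := by
  refine ⟨fun j => add_nonneg (mul_nonneg (by linarith) (hx.1 j)) (mul_nonneg h0 (hx'.1 j)),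
    fun r => ?_⟩
  rw [← hd r, ← hx.2 r, ← hx'.2 r, Finset.mul_sum, Finset.mul_sum, ← Finset.sum_add_distrib]
  exact Finset.sum_congr rfl fun j _ => by ring

/-- The average of one witness per coordinate keeps the constraints and charges every coordinate. -/
theorem exists_pos_mem_polySet [Nonempty J] {T : R → J → ℤ} {c : R → ℝ}
    (h : ∀ j, ∃ x ∈ polySet T c, 0 < x j) : ∃ x ∈ polySet T c, ∀ j, 0 < x j := by
  choose y hy hpos using h
  have hn : (0 : ℝ) < Fintype.card J := by exact_mod_cast Fintype.card_pos
  refine ⟨fun j => (∑ i, y i j) / Fintype.card J, ⟨fun j => ?_, fun r => ?_⟩, fun j => ?_⟩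
  · exact div_nonneg (Finset.sum_nonneg fun i _ => (hy i).1 j) hn.le
  · have : ∀ j, (T r j : ℝ) * ((∑ i, y i j) / Fintype.card J) =
        (∑ i, (T r j : ℝ) * y i j) / Fintype.card J := fun j => by
      rw [← mul_div_assoc, Finset.mul_sum]
    simp_rw [this]
    rw [← Finset.sum_div, Finset.sum_comm]
    simp_rw [(hy _).2 r]
    rw [Finset.sum_const, Finset.card_univ, nsmul_eq_mul]
    field_simp
  · exact div_pos (Finset.sum_pos' (fun i _ => (hy i).1 j) ⟨j, Finset.mem_univ _, hpos j⟩) hn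

end PolySet

namespace DGLDPC

variable {ι : Type*} [Fintype ι] (D : DGLDPC ι)

/-! ### Weight enumerators -/

/-- All VNs of a type share their enumerator, so any of them serves as a witness. Encoders are given
for every index, which is why index `0` can be used below. -/
theorem B_pos_iff (n : ℕ) (t : ι) (i u v : ℕ) : 0 < D.B t u v ↔
    ∃ x : Fin (D.k t) → ZMod 2, hammingNorm x = u ∧ hammingNorm (D.vn n t i x) = v := by
  rw [← D.vn_iowef n t i u v, Nat.card_pos_iff]
  constructor
  · rintro ⟨⟨x⟩, -⟩
    exact ⟨x.1, x.2⟩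
  · rintro ⟨x, hx⟩
    exact ⟨⟨⟨x, hx⟩⟩, inferInstance⟩

theorem A_pos_iff (n j u : ℕ) : 0 < D.A u ↔
    ∃ c : Fin D.s → ZMod 2, c ∈ D.cn n j ∧ hammingNorm c = u := by
  rw [← D.cn_wef n j u, Nat.card_pos_iff]
  constructor
  · rintro ⟨⟨x⟩, -⟩
    exact ⟨x.1, x.2⟩
  · rintro ⟨x, hx⟩
    exact ⟨⟨⟨x, hx⟩⟩, inferInstance⟩

theorem le_k_of_B_pos {t : ι} {u v : ℕ} (h : 0 < D.B t u v) : u ≤ D.k t := by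
  obtain ⟨x, rfl, -⟩ := (D.B_pos_iff 0 t 0 u v).1 h
  simpa using hammingNorm_le_card_fintype (x := x)

theorem le_q_of_B_pos {t : ι} {u v : ℕ} (h : 0 < D.B t u v) : v ≤ D.q t := by
  obtain ⟨x, -, rfl⟩ := (D.B_pos_iff 0 t 0 u v).1 h
  simpa using hammingNorm_le_card_fintype (x := D.vn 0 t 0 x)

theorem le_s_of_A_pos {u : ℕ} (h : 0 < D.A u) : u ≤ D.s := by
  obtain ⟨x, -, rfl⟩ := (D.A_pos_iff 0 0 u).1 h
  simpa using hammingNorm_le_card_fintype (x := x)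

theorem B_zero_pos (t : ι) : 0 < D.B t 0 0 :=
  (D.B_pos_iff 0 t 0 0 0).2 ⟨0, by simp, by simp⟩

theorem A_zero_pos : 0 < D.A 0 := (D.A_pos_iff 0 0 0).2 ⟨0, Submodule.zero_mem _, by simp⟩

theorem eq_zero_of_B_zero_pos {t : ι} {v : ℕ} (h : 0 < D.B t 0 v) : v = 0 := by
  obtain ⟨x, hx, rfl⟩ := (D.B_pos_iff 0 t 0 0 v).1 h
  rw [hammingNorm_eq_zero] at hx
  simp [hx]

theorem exists_B_pos {t : ι} {u : ℕ} (hu : u ≤ D.k t) : ∃ v, 0 < D.B t u v := by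
  let x : Fin (D.k t) → ZMod 2 := fun i => if (i : ℕ) < u then 1 else 0
  refine ⟨_, (D.B_pos_iff 0 t 0 u _).2 ⟨x, ?_, rfl⟩⟩
  have : (Finset.univ.filter fun i => x i ≠ 0) = Finset.univ.filter fun i : Fin (D.k t) => (i : ℕ) < u := by
    ext i; simp [x]
  rw [hammingNorm, this, Fin.card_filter_val_lt, min_eq_right hu]

theorem exists_A_pos : ∃ u, 0 < u ∧ 0 < D.A u := by
  obtain ⟨c, hc, hc0⟩ := Submodule.exists_mem_ne_zero_of_ne_bot (D.cn_ne_bot 0 0)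
  exact ⟨hammingNorm c, hammingNorm_pos_iff.2 hc0, (D.A_pos_iff 0 0 _).2 ⟨c, hc, rfl⟩⟩

/-- An injective map on a nonzero space cannot land in the zero space. This makes the truncated
subtraction in the exponent `q t - 1` harmless. -/
theorem q_pos (t : ι) : 0 < D.q t := by
  by_contra h
  have hq : D.q t = 0 := by omega
  have : IsEmpty (Fin (D.q t)) := by rw [hq]; infer_instance
  have hsub : Subsingleton (Fin (D.k t) → ZMod 2) := (D.vn_injective 0 t 0).subsingleton
  have : Nonempty (Fin (D.k t)) := ⟨⟨0, D.k_pos t⟩⟩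
  have h1 := Subsingleton.elim (0 : Fin (D.k t) → ZMod 2) 1
  exact zero_ne_one h1

theorem lamInt_eq : D.lamInt = ∑ t, (D.lam t : ℝ) / D.q t := by
  rw [lamInt, intervalIntegral.integral_finsetSum]
  · refine Finset.sum_congr rfl fun t _ => ?_
    have hq : D.q t - 1 + 1 = D.q t := Nat.succ_pred_eq_of_pos (D.q_pos t)
    have hq' : ((D.q t - 1 : ℕ) : ℝ) + 1 = D.q t := by exact_mod_cast hq
    rw [intervalIntegral.integral_const_mul, integral_pow, hq, hq']
    simp [(D.q_pos t).ne', div_eq_mul_inv]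
  · intro t _
    exact (by fun_prop : Continuous fun x : ℝ => (D.lam t : ℝ) * x ^ (D.q t - 1)).intervalIntegrable _ _

theorem rhoInt_eq : D.rhoInt = 1 / D.s := by
  have hs : D.s - 1 + 1 = D.s := Nat.succ_pred_eq_of_pos D.s_pos
  have hs' : ((D.s - 1 : ℕ) : ℝ) + 1 = D.s := by exact_mod_cast hs
  rw [rhoInt, integral_pow, hs, hs']
  simp [D.s_pos.ne']

theorem nonempty_index {ι : Type*} [Fintype ι] (D : DGLDPC ι) : Nonempty ι := by
  by_contra h
  rw [not_nonempty_iff] at h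
  simpa using D.lam_sum

theorem lamInt_pos : 0 < D.lamInt := by
  rw [lamInt_eq]
  have := D.nonempty_index
  refine Finset.sum_pos (fun t _ => div_pos ?_ ?_) Finset.univ_nonempty
  · exact_mod_cast D.lam_pos t
  · exact_mod_cast D.q_pos t

theorem rhoInt_pos : 0 < D.rhoInt := by
  rw [rhoInt_eq]
  have : (0 : ℝ) < D.s := by exact_mod_cast D.s_pos
  positivity

theorem delta_pos (t : ι) : 0 < D.delta t := by
  have h1 : (0 : ℝ) < D.lam t := by exact_mod_cast D.lam_pos t
  have h2 : (0 : ℝ) < D.q t := by exact_mod_cast D.q_pos t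
  exact div_pos h1 (mul_pos h2 D.lamInt_pos)

/-- The number of CNs per VN. -/
def cnRatio : ℝ := D.rhoInt / D.lamInt

theorem cnRatio_pos : 0 < D.cnRatio := div_pos D.rhoInt_pos D.lamInt_pos

/-! ### Symbols -/

/-- The pairs of weights that occur in type-`t` VNs. -/
abbrev SymV (t : ι) : Type := {p : Fin (D.k t + 1) × Fin (D.q t + 1) // 0 < D.B t p.1 p.2}

/-- The weights that occur in CNs. -/
abbrev SymC : Type := {u : Fin (D.s + 1) // 0 < D.A u}

/-- Number of local inputs with given weights, as a real. -/
def mulV (t : ι) (s : D.SymV t) : ℝ := D.B t s.1.1 s.1.2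

/-- Number of local codewords of given weight, as a real. -/
def mulC (s : D.SymC) : ℝ := D.A s.1

theorem mulV_pos (t : ι) (s : D.SymV t) : 0 < D.mulV t s := by
  have := s.2
  unfold mulV
  exact_mod_cast this

theorem mulC_pos (s : D.SymC) : 0 < D.mulC s := by
  have := s.2
  unfold mulC
  exact_mod_cast this

/-- The statistics of type-`t` VNs: mass, input weight and output weight. -/
def statV (t : ι) : Fin 3 → D.SymV t → ℤ :=
  ![fun _ => 1, fun s => ((s.1.1 : ℕ) : ℤ), fun s => ((s.1.2 : ℕ) : ℤ)]

/-- The statistics of CNs: mass and weight. -/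
def statC : Fin 2 → D.SymC → ℤ := ![fun _ => 1, fun s => ((s.1 : ℕ) : ℤ)]

theorem mem_polySet_statV {t : ι} {d a b : ℝ} {x : D.SymV t → ℝ} :
    x ∈ polySet (D.statV t) ![d, a, b] ↔ (∀ s, 0 ≤ x s) ∧ ∑ s, x s = d ∧
      ∑ s, ((s.1.1 : ℕ) : ℝ) * x s = a ∧ ∑ s, ((s.1.2 : ℕ) : ℝ) * x s = b := by
  simp [polySet, statV, Fin.forall_fin_succ]

theorem mem_polySet_statC {d b : ℝ} {x : D.SymC → ℝ} :
    x ∈ polySet D.statC ![d, b] ↔ (∀ s, 0 ≤ x s) ∧ ∑ s, x s = d ∧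
      ∑ s, ((s.1 : ℕ) : ℝ) * x s = b := by
  simp [polySet, statC, Fin.forall_fin_succ]

/-- The symbol with given weights. -/
def symV {t : ι} {u v : ℕ} (h : 0 < D.B t u v) : D.SymV t :=
  ⟨(⟨u, Nat.lt_succ_of_le (D.le_k_of_B_pos h)⟩, ⟨v, Nat.lt_succ_of_le (D.le_q_of_B_pos h)⟩), h⟩

/-- The symbol with given weight. -/
def symC {u : ℕ} (h : 0 < D.A u) : D.SymC := ⟨⟨u, Nat.lt_succ_of_le (D.le_s_of_A_pos h)⟩, h⟩

instance (t : ι) : Nonempty (D.SymV t) := ⟨D.symV (D.B_zero_pos t)⟩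

instance : Nonempty D.SymC := ⟨D.symC D.A_zero_pos⟩

theorem sum_symV (t : ι) (f : ℕ → ℕ → ℝ) (hf : ∀ u v, ¬ 0 < D.B t u v → f u v = 0) :
    ∑ s : D.SymV t, f s.1.1 s.1.2 =
      ∑ u ∈ Finset.range (D.k t + 1), ∑ v ∈ Finset.range (D.q t + 1), f u v := by
  simp_rw [Finset.sum_range]
  rw [← Fintype.sum_prod_type' (f := fun (a : Fin (D.k t + 1)) (b : Fin (D.q t + 1)) => f a b)]
  rw [← Finset.sum_filter_of_ne (p := fun p : Fin (D.k t + 1) × Fin (D.q t + 1) =>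
    0 < D.B t p.1 p.2) (fun p _ hp => by
      by_contra h
      exact hp (hf _ _ h))]
  exact (Finset.sum_subtype _ (p := fun p : Fin (D.k t + 1) × Fin (D.q t + 1) =>
    0 < D.B t p.1 p.2) (by simp) (fun p => f p.1 p.2)).symm

theorem sum_symC (f : ℕ → ℝ) (hf : ∀ u, ¬ 0 < D.A u → f u = 0) :
    ∑ s : D.SymC, f s.1 = ∑ u ∈ Finset.range (D.s + 1), f u := by
  simp_rw [Finset.sum_range]
  rw [← Finset.sum_filter_of_ne (p := fun p : Fin (D.s + 1) => 0 < D.A p) (fun p _ hp => by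
      by_contra h
      exact hp (hf _ h))]
  exact (Finset.sum_subtype _ (p := fun p : Fin (D.s + 1) => 0 < D.A p) (by simp)
    (fun p => f p)).symm

theorem single_mem_statV {t : ι} {d : ℝ} (hd : 0 ≤ d) (s : D.SymV t) [DecidableEq (D.SymV t)] :
    Pi.single s d ∈ polySet (D.statV t) ![d, (s.1.1 : ℕ) * d, (s.1.2 : ℕ) * d] := by
  rw [mem_polySet_statV]
  refine ⟨fun s' => ?_, ?_, ?_, ?_⟩
  · rw [Pi.single_apply]; split_ifs <;> simp [hd]
  all_goals simp [Pi.single_apply]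

theorem single_mem_statC {d : ℝ} (hd : 0 ≤ d) (s : D.SymC) [DecidableEq D.SymC] :
    Pi.single s d ∈ polySet D.statC ![d, (s.1 : ℕ) * d] := by
  rw [mem_polySet_statC]
  refine ⟨fun s' => ?_, ?_, ?_⟩
  · rw [Pi.single_apply]; split_ifs <;> simp [hd]
  all_goals simp [Pi.single_apply]

/-! ### The linear programs -/

theorem U_pos_mem {t : ι} {i : ℕ} (hi : i ≤ D.k t) : 0 < D.B t i (D.U t i) :=
  Nat.sInf_mem (s := {j | 0 < D.B t i j}) (D.exists_B_pos hi)

theorem bddAbove_B (t : ι) (i : ℕ) : BddAbove {j | 0 < D.B t i j} :=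
  ⟨D.q t, fun _ hj => D.le_q_of_B_pos hj⟩

theorem V_pos_mem {t : ι} {i : ℕ} (hi : i ≤ D.k t) : 0 < D.B t i (D.V t i) :=
  Nat.sSup_mem (s := {j | 0 < D.B t i j}) (D.exists_B_pos hi) (D.bddAbove_B t i)

theorem U_le {t : ι} {i j : ℕ} (h : 0 < D.B t i j) : D.U t i ≤ j := Nat.sInf_le h

theorem le_V {t : ι} {i j : ℕ} (h : 0 < D.B t i j) : j ≤ D.V t i := le_csSup (D.bddAbove_B t i) h

theorem U_zero (t : ι) : D.U t 0 = 0 := D.eq_zero_of_B_zero_pos (D.U_pos_mem (Nat.zero_le _))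

theorem V_zero (t : ι) : D.V t 0 = 0 := D.eq_zero_of_B_zero_pos (D.V_pos_mem (Nat.zero_le _))

theorem lpSet_nonempty {t : ι} {a : ℝ} (h0 : 0 ≤ a) (h1 : a ≤ D.k t) : (D.lpSet t a).Nonempty := by
  have hk : (0 : ℝ) < D.k t := by exact_mod_cast D.k_pos t
  have hmem : D.k t ∈ Finset.Icc 1 (D.k t) := Finset.mem_Icc.2 ⟨D.k_pos t, le_rfl⟩
  refine ⟨fun i => if i = D.k t then a / D.k t else 0, fun i _ => ?_, ?_, ?_⟩
  · dsimp only
    split_ifs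
    exacts [by positivity, le_rfl]
  · rw [Finset.sum_ite_eq', if_pos hmem]
    exact (div_le_one hk).2 h1
  · simp only [mul_ite, mul_zero]
    rw [Finset.sum_ite_eq', if_pos hmem]
    field_simp

/-- `lpSet` itself is not compact, as coordinates outside `1, …, k t` are free. Setting them to zero
does not change the image and leaves a closed subset of a product of unit intervals. -/
theorem isCompact_lp_image (t : ι) (a : ℝ) (f : ℕ → ℝ) :
    IsCompact ((fun ω : ℕ → ℝ => ∑ i ∈ Finset.Icc 1 (D.k t), f i * ω i) '' D.lpSet t a) := by
  classical
  let C : Set (ℕ → ℝ) := Set.univ.pi (fun _ => Set.Icc (0 : ℝ) 1) ∩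
    ({ω | ∑ i ∈ Finset.Icc 1 (D.k t), ω i ≤ 1} ∩
      {ω | ∑ i ∈ Finset.Icc 1 (D.k t), (i : ℝ) * ω i = a})
  have hC : IsCompact C := by
    refine (isCompact_univ_pi fun _ => isCompact_Icc).inter_right ?_
    exact (isClosed_le (by fun_prop) continuous_const).inter
      (isClosed_eq (by fun_prop) continuous_const)
  have himg : (fun ω : ℕ → ℝ => ∑ i ∈ Finset.Icc 1 (D.k t), f i * ω i) '' D.lpSet t a =
      (fun ω : ℕ → ℝ => ∑ i ∈ Finset.Icc 1 (D.k t), f i * ω i) '' C := by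
    ext b
    constructor
    · rintro ⟨ω, ⟨h0, h1, h2⟩, rfl⟩
      refine ⟨fun i => if i ∈ Finset.Icc 1 (D.k t) then ω i else 0, ⟨?_, ?_, ?_⟩, ?_⟩
      · intro i _
        dsimp only
        split_ifs with hi
        · exact ⟨h0 i hi, (Finset.single_le_sum h0 hi).trans h1⟩
        · simp
      · exact (Finset.sum_congr rfl fun i hi => if_pos hi).trans_le h1
      · exact (Finset.sum_congr rfl fun i hi => by simp only [if_pos hi]).trans h2
      · exact Finset.sum_congr rfl fun i hi => by simp only [if_pos hi]
    · rintro ⟨ω, ⟨h0, h1, h2⟩, rfl⟩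
      exact ⟨ω, ⟨fun i _ => (h0 i trivial).1, h1, h2⟩, rfl⟩
  rw [himg]
  exact hC.image (by fun_prop)

/-- A feasible point of the linear program, with output weights given by `f`, as a distribution. -/
theorem exists_mem_of_lpSet {t : ι} {a d : ℝ} (hd : 0 ≤ d) {ω : ℕ → ℝ} (hω : ω ∈ D.lpSet t a)
    {f : ℕ → ℕ} (hf : ∀ i ≤ D.k t, 0 < D.B t i (f i)) (hf0 : f 0 = 0) :
    (polySet (D.statV t)
      ![d, d * a, d * ∑ i ∈ Finset.Icc 1 (D.k t), (f i : ℝ) * ω i]).Nonempty := by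
  classical
  obtain ⟨h0, h1, h2⟩ := hω
  -- The linear programs leave out `i = 0`; their slack is the share of the zero input, which has
  -- output weight zero.
  let w : ℕ → ℝ := fun i => if i = 0 then 1 - ∑ i ∈ Finset.Icc 1 (D.k t), ω i else ω i
  have hwi : ∀ i ∈ Finset.Icc 1 (D.k t), w i = ω i := fun i hi => by
    have := (Finset.mem_Icc.1 hi).1
    simp [w, show i ≠ 0 by omega]
  have hsum : ∀ g : ℕ → ℝ, ∑ i ∈ Finset.range (D.k t + 1), g i * w i =
      g 0 * w 0 + ∑ i ∈ Finset.Icc 1 (D.k t), g i * ω i := by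
    intro g
    rw [Finset.sum_range_eq_add_Ico _ (Nat.succ_pos _)]
    congr 1
    exact Finset.sum_congr (by ext; simp) fun i hi => by rw [hwi i hi]
  have hmain : ∀ g : ℕ → ℕ → ℝ, ∑ s : D.SymV t,
      g s.1.1 s.1.2 * (if (s.1.2 : ℕ) = f s.1.1 then d * w s.1.1 else 0) =
      d * ∑ i ∈ Finset.range (D.k t + 1), g i (f i) * w i := by
    intro g
    rw [Finset.mul_sum]
    have := D.sum_symV t (fun u v => if 0 < D.B t u v then
      g u v * (if v = f u then d * w u else 0) else 0) (fun u v h => if_neg h)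
    rw [Finset.sum_congr rfl fun s _ => if_pos s.2] at this
    rw [this]
    refine Finset.sum_congr rfl fun u hu => ?_
    have hu' : u ≤ D.k t := by simpa [Nat.lt_succ_iff] using hu
    rw [Finset.sum_eq_single (f u)]
    · rw [if_pos (hf u hu'), if_pos rfl]; ring
    · intro v _ hv
      rw [if_neg hv]; simp
    · intro h
      exact absurd (D.le_q_of_B_pos (hf u hu')) (by simpa using h)
  refine ⟨fun s => if (s.1.2 : ℕ) = f s.1.1 then d * w s.1.1 else 0, ?_⟩
  rw [mem_polySet_statV]
  refine ⟨fun s => ?_, ?_, ?_, ?_⟩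
  · split_ifs
    · refine mul_nonneg hd ?_
      by_cases hs : (s.1.1 : ℕ) = 0
      · simp only [w, hs, if_true]; linarith
      · have hm : (s.1.1 : ℕ) ∈ Finset.Icc 1 (D.k t) :=
          Finset.mem_Icc.2 ⟨by omega, Nat.lt_succ_iff.1 s.1.1.2⟩
        rw [hwi _ hm]; exact h0 _ hm
    · exact le_rfl
  · have := hmain fun _ _ => 1
    have h3 := hsum fun _ => 1
    simp only [one_mul] at this h3
    rw [this, h3]
    simp [w]
  · have := hmain fun u _ => (u : ℝ)
    rw [this, hsum fun u => (u : ℝ), h2]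
    simp
  · have := hmain fun _ v => (v : ℝ)
    rw [this, hsum fun u => (f u : ℝ), hf0]
    simp

/-- The input weight distribution of a distribution on symbols is feasible. -/
theorem exists_lpSet_of_mem {t : ι} {d a b : ℝ} (hd : 0 < d) {x : D.SymV t → ℝ}
    (hx : x ∈ polySet (D.statV t) ![d, a, b]) :
    ∃ ω ∈ D.lpSet t (a / d), ∀ f : ℕ → ℝ, f 0 = 0 →
      ∑ i ∈ Finset.Icc 1 (D.k t), f i * ω i = (∑ s : D.SymV t, f s.1.1 * x s) / d := by
  classical
  obtain ⟨h0, h1, h2, h3⟩ := D.mem_polySet_statV.1 hx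
  let ω : ℕ → ℝ := fun i => (∑ s : D.SymV t, if (s.1.1 : ℕ) = i then x s else 0) / d
  have key : ∀ f : ℕ → ℝ, ∑ i ∈ Finset.Icc 1 (D.k t), f i * ω i =
      (∑ s : D.SymV t, if (s.1.1 : ℕ) ∈ Finset.Icc 1 (D.k t) then f s.1.1 * x s else 0) / d := by
    intro f
    simp only [ω, ← mul_div_assoc, Finset.mul_sum]
    rw [← Finset.sum_div, Finset.sum_comm]
    congr 1
    refine Finset.sum_congr rfl fun s _ => ?_
    simp only [mul_ite, mul_zero]
    rw [Finset.sum_ite_eq]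
  have key0 : ∀ f : ℕ → ℝ, f 0 = 0 →
      ∑ i ∈ Finset.Icc 1 (D.k t), f i * ω i = (∑ s : D.SymV t, f s.1.1 * x s) / d := by
    intro f hf
    rw [key f]
    congr 1
    refine Finset.sum_congr rfl fun s _ => ?_
    split_ifs with h
    · rfl
    · have : (s.1.1 : ℕ) = 0 := by
        have := Nat.lt_succ_iff.1 s.1.1.2
        rw [Finset.mem_Icc] at h
        omega
      rw [this, hf, zero_mul]
  refine ⟨ω, ⟨fun i _ => ?_, ?_, ?_⟩, key0⟩
  · refine div_nonneg (Finset.sum_nonneg fun s _ => ?_) hd.le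
    split_ifs
    exacts [h0 s, le_rfl]
  · have := key fun _ => 1
    simp only [one_mul] at this
    rw [this, div_le_one hd, ← h1]
    refine Finset.sum_le_sum fun s _ => ?_
    split_ifs
    exacts [le_rfl, h0 s]
  · rw [key0 _ (by simp), h2]

/-- Compactness gives an optimal `ω`; putting its mass on inputs of minimal output weight realizes
the bound. -/
theorem exists_mem_lower {t : ι} {a : ℝ} (h0 : 0 ≤ a) (h1 : a ≤ D.delta t * D.k t) :
    (polySet (D.statV t) ![D.delta t, a, D.lower t a]).Nonempty := by
  have hd := D.delta_pos t
  have hne := D.lpSet_nonempty (t := t) (a := a / D.delta t) (by positivity)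
    ((div_le_iff₀ hd).2 (by linarith))
  obtain ⟨ω, hω, hv⟩ := (D.isCompact_lp_image t (a / D.delta t) (fun i => D.U t i)).sInf_mem
    (hne.image _)
  have := D.exists_mem_of_lpSet hd.le hω (fun i hi => D.U_pos_mem hi) (D.U_zero t)
  dsimp only at hv
  rw [hv, mul_div_cancel₀ _ hd.ne'] at this
  exact this

theorem exists_mem_upper {t : ι} {a : ℝ} (h0 : 0 ≤ a) (h1 : a ≤ D.delta t * D.k t) :
    (polySet (D.statV t) ![D.delta t, a, D.upper t a]).Nonempty := by
  have hd := D.delta_pos t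
  have hne := D.lpSet_nonempty (t := t) (a := a / D.delta t) (by positivity)
    ((div_le_iff₀ hd).2 (by linarith))
  obtain ⟨ω, hω, hv⟩ := (D.isCompact_lp_image t (a / D.delta t) (fun i => D.V t i)).sSup_mem
    (hne.image _)
  have := D.exists_mem_of_lpSet hd.le hω (fun i hi => D.V_pos_mem hi) (D.V_zero t)
  dsimp only at hv
  rw [hv, mul_div_cancel₀ _ hd.ne'] at this
  exact this

theorem mem_vnRegion_of_mem {t : ι} {a b : ℝ} {x : D.SymV t → ℝ}
    (hx : x ∈ polySet (D.statV t) ![D.delta t, a, b]) : (a, b) ∈ D.vnRegion t := by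
  have hd := D.delta_pos t
  obtain ⟨h0, h1, h2, h3⟩ := D.mem_polySet_statV.1 hx
  obtain ⟨ω, hω, hs⟩ := D.exists_lpSet_of_mem hd hx
  refine ⟨?_, ?_, ?_, ?_⟩
  · rw [← h2]; exact Finset.sum_nonneg fun s _ => mul_nonneg (Nat.cast_nonneg _) (h0 s)
  · rw [← h2, ← h1, Finset.sum_mul]
    refine Finset.sum_le_sum fun s _ => ?_
    rw [mul_comm]
    exact mul_le_mul_of_nonneg_left (by exact_mod_cast Nat.lt_succ_iff.1 s.1.1.2) (h0 s)
  · have h4 : D.lpMin t (a / D.delta t) ≤ b / D.delta t := by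
      refine (csInf_le (D.isCompact_lp_image t _ _).bddBelow ⟨ω, hω, rfl⟩).trans ?_
      dsimp only
      rw [hs (fun i => (D.U t i : ℝ)) (by simp [D.U_zero]), ← h3]
      refine div_le_div_of_nonneg_right (Finset.sum_le_sum fun s _ => ?_) hd.le
      exact mul_le_mul_of_nonneg_right (by exact_mod_cast D.U_le s.2) (h0 s)
    calc D.lower t a ≤ D.delta t * (b / D.delta t) := mul_le_mul_of_nonneg_left h4 hd.le
      _ = b := mul_div_cancel₀ _ hd.ne'
  · have h4 : b / D.delta t ≤ D.lpMax t (a / D.delta t) := by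
      refine le_trans ?_ (le_csSup (D.isCompact_lp_image t _ _).bddAbove ⟨ω, hω, rfl⟩)
      dsimp only
      rw [hs (fun i => (D.V t i : ℝ)) (by simp [D.V_zero]), ← h3]
      refine div_le_div_of_nonneg_right (Finset.sum_le_sum fun s _ => ?_) hd.le
      exact mul_le_mul_of_nonneg_right (by exact_mod_cast D.le_V s.2) (h0 s)
    calc b = D.delta t * (b / D.delta t) := (mul_div_cancel₀ _ hd.ne').symm
      _ ≤ D.upper t a := mul_le_mul_of_nonneg_left h4 hd.le

theorem convex_combo_self (θ c : ℝ) : (1 - θ) * c + θ * c = c := by ring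

theorem exists_convex_combo {l u b : ℝ} (h1 : l ≤ b) (h2 : b ≤ u) :
    ∃ θ : ℝ, 0 ≤ θ ∧ θ ≤ 1 ∧ (1 - θ) * l + θ * u = b := by
  rcases (h1.trans h2).eq_or_lt with h | h
  · exact ⟨0, le_rfl, zero_le_one, by linarith⟩
  · have hp : 0 < u - l := by linarith
    exact ⟨(b - l) / (u - l), div_nonneg (by linarith) hp.le, (div_le_one hp).2 (by linarith), by
      field_simp; ring⟩

/-- The two extreme output weights are attained, and mixing the extremal distributions reaches
everything in between. Conversely, the input weights of a distribution form a feasible point of both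
programs. -/
theorem mem_vnRegion_iff {t : ι} {a b : ℝ} :
    (a, b) ∈ D.vnRegion t ↔ (polySet (D.statV t) ![D.delta t, a, b]).Nonempty := by
  constructor
  · rintro ⟨h0, h1, h2, h3⟩
    obtain ⟨x, hx⟩ := D.exists_mem_lower h0 h1
    obtain ⟨y, hy⟩ := D.exists_mem_upper h0 h1
    obtain ⟨θ, ht0, ht1, ht⟩ := exists_convex_combo h2 h3
    refine ⟨_, combo_mem_polySet hx hy ht0 ht1 ?_⟩
    intro r
    fin_cases r
    · simp [convex_combo_self]
    · simp [convex_combo_self]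
    · simpa using ht
  · rintro ⟨x, hx⟩
    exact D.mem_vnRegion_of_mem hx

/-- A point off the upper and lower boundaries (or where these coincide) is the statistic of a
positive distribution. -/
theorem exists_pos_statV {t : ι} {a b : ℝ} (h0 : 0 < a) (h1 : a < D.delta t * D.k t)
    (hb : (D.lower t a < b ∧ b < D.upper t a) ∨ (D.lower t a = b ∧ b = D.upper t a)) :
    ∃ x ∈ polySet (D.statV t) ![D.delta t, a, b], ∀ s, 0 < x s := by
  classical
  have hd := D.delta_pos t
  apply exists_pos_mem_polySet
  intro s
  -- a distribution with the right input weight that charges `s`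
  obtain ⟨b', r, hr, hrs⟩ : ∃ b', ∃ r ∈ polySet (D.statV t) ![D.delta t, a, b'], 0 < r s := by
    have hs := D.single_mem_statV hd.le s
    -- Mix with a symbol of full input weight if `s` has too little input weight, and with the zero
    -- symbol if it has too much. The strict bounds on `a` keep the share of `s` positive.
    rcases le_or_gt ((s.1.1 : ℕ) * D.delta t) a with h | h
    · obtain ⟨v, hv⟩ := D.exists_B_pos (le_refl (D.k t))
      have he := D.single_mem_statV hd.le (D.symV hv)
      have hlt : (s.1.1 : ℕ) * D.delta t < D.delta t * D.k t := h.trans_lt h1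
      obtain ⟨θ, ht0, ht1, ht⟩ := exists_convex_combo h h1.le
      have ht1' : θ < 1 := by
        rcases ht1.eq_or_lt with h' | h'
        · rw [h'] at ht; linarith
        · exact h'
      refine ⟨_, _, combo_mem_polySet hs he ht0 ht1 (d := ![D.delta t, a,
        (1 - θ) * ((s.1.2 : ℕ) * D.delta t) + θ * (v * D.delta t)]) ?_, ?_⟩
      · intro r
        fin_cases r
        · simp [convex_combo_self]
        · simp only [symV]; simpa [mul_comm] using ht
        · simp [symV]
      · have : 0 ≤ (Pi.single (D.symV hv) (D.delta t) : D.SymV t → ℝ) s := he.1 s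
        simp only [Pi.single_eq_same]
        have := mul_pos (sub_pos.2 ht1') hd
        positivity
    · have he := D.single_mem_statV hd.le (D.symV (D.B_zero_pos t))
      obtain ⟨θ, ht0, ht1, ht⟩ := exists_convex_combo h0.le h.le
      have ht1' : 0 < θ := by
        rcases ht0.eq_or_lt with h' | h'
        · rw [← h'] at ht; linarith
        · exact h'
      refine ⟨_, _, combo_mem_polySet he hs ht0 ht1 (d := ![D.delta t, a,
        θ * ((s.1.2 : ℕ) * D.delta t)]) ?_, ?_⟩
      · intro r
        fin_cases r
        · simp [convex_combo_self]
        · simpa [symV] using ht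
        · simp [symV]
      · have : 0 ≤ (Pi.single (D.symV (D.B_zero_pos t)) (D.delta t) : D.SymV t → ℝ) s := he.1 s
        simp only [Pi.single_eq_same]
        have := mul_pos ht1' hd
        have h2 : 0 ≤ 1 - θ := by linarith
        positivity
  obtain ⟨-, -, hl, hu⟩ := D.mem_vnRegion_of_mem hr
  dsimp only at hl hu
  have mix : ∀ c, (polySet (D.statV t) ![D.delta t, a, c]).Nonempty →
      (∃ θ : ℝ, 0 ≤ θ ∧ θ < 1 ∧ (1 - θ) * b' + θ * c = b) →
      ∃ x ∈ polySet (D.statV t) ![D.delta t, a, b], 0 < x s := by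
    rintro c ⟨y, hy⟩ ⟨θ, ht0, ht1, ht⟩
    refine ⟨_, combo_mem_polySet hr hy ht0 ht1.le ?_, ?_⟩
    · intro r
      fin_cases r
      · simp [convex_combo_self]
      · simp [convex_combo_self]
      · simpa using ht
    · exact add_pos_of_pos_of_nonneg (mul_pos (by linarith) hrs) (mul_nonneg ht0 (hy.1 s))
  -- Strict bounds allow the output weight to be corrected without using up all of `r`. If the
  -- bounds coincide, `hl` and `hu` force `b' = b`.
  rcases lt_trichotomy b' b with h | h | h
  · rcases hb with hb | hb
    · refine mix _ (D.exists_mem_upper h0.le h1.le) ?_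
      have hp : 0 < D.upper t a - b' := by linarith [hb.2]
      exact ⟨(b - b') / (D.upper t a - b'), div_nonneg (by linarith) hp.le,
        (div_lt_one hp).2 (by linarith [hb.2]), by field_simp; ring⟩
    · linarith [hb.1]
  · exact ⟨r, h ▸ hr, hrs⟩
  · rcases hb with hb | hb
    · refine mix _ (D.exists_mem_lower h0.le h1.le) ?_
      have hp : 0 < b' - D.lower t a := by linarith [hb.1]
      exact ⟨(b' - b) / (b' - D.lower t a), div_nonneg (by linarith) hp.le,
        (div_lt_one hp).2 (by linarith [hb.1]), by field_simp; ring⟩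
    · linarith [hb.2]

/-! ### The range of the CN weights -/

/-- The maximum weight of a local codeword of a CN. -/
def maxC : ℕ := sSup {u | 0 < D.A u}

theorem bddAbove_A : BddAbove {u | 0 < D.A u} := ⟨D.s, fun _ h => D.le_s_of_A_pos h⟩

theorem A_maxC_pos : 0 < D.A D.maxC :=
  Nat.sSup_mem (s := {u | 0 < D.A u}) ⟨0, D.A_zero_pos⟩ D.bddAbove_A

theorem le_maxC {u : ℕ} (h : 0 < D.A u) : u ≤ D.maxC := le_csSup D.bddAbove_A h

theorem betaMax_eq : D.betaMax = D.cnRatio * D.maxC := rfl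

theorem mem_Icc_betaMax_iff {b : ℝ} :
    b ∈ Set.Icc 0 D.betaMax ↔ (polySet D.statC ![D.cnRatio, b]).Nonempty := by
  classical
  have hd := D.cnRatio_pos
  constructor
  · rintro ⟨h0, h1⟩
    obtain ⟨θ, ht0, ht1, ht⟩ := exists_convex_combo h0 h1
    refine ⟨_, combo_mem_polySet (D.single_mem_statC hd.le (D.symC D.A_zero_pos))
      (D.single_mem_statC hd.le (D.symC D.A_maxC_pos)) ht0 ht1 ?_⟩
    intro r
    fin_cases r
    · simp [convex_combo_self]
    · rw [betaMax_eq] at ht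
      simpa [symC, mul_comm] using ht
  · rintro ⟨x, hx⟩
    obtain ⟨h0, h1, h2⟩ := D.mem_polySet_statC.1 hx
    constructor
    · rw [← h2]; exact Finset.sum_nonneg fun s _ => mul_nonneg (Nat.cast_nonneg _) (h0 s)
    · rw [← h2, betaMax_eq, ← h1, Finset.sum_mul]
      refine Finset.sum_le_sum fun s _ => ?_
      rw [mul_comm]
      exact mul_le_mul_of_nonneg_left (by exact_mod_cast D.le_maxC s.2) (h0 s)

theorem exists_pos_statC {b : ℝ} (h0 : 0 < b) (h1 : b < D.betaMax) :
    ∃ x ∈ polySet D.statC ![D.cnRatio, b], ∀ s, 0 < x s := by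
  classical
  have hd := D.cnRatio_pos
  rw [betaMax_eq] at h1
  apply exists_pos_mem_polySet
  intro s
  have hs := D.single_mem_statC hd.le s
  rcases le_or_gt ((s.1 : ℕ) * D.cnRatio) b with h | h
  · have he := D.single_mem_statC hd.le (D.symC D.A_maxC_pos)
    obtain ⟨θ, ht0, ht1, ht⟩ := exists_convex_combo h h1.le
    have ht1' : θ < 1 := by
      rcases ht1.eq_or_lt with h' | h'
      · rw [h'] at ht; linarith
      · exact h'
    refine ⟨_, combo_mem_polySet hs he ht0 ht1 ?_, ?_⟩
    · intro r
      fin_cases r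
      · simp [convex_combo_self]
      · simp only [symC]; simpa [mul_comm] using ht
    · have : 0 ≤ (Pi.single (D.symC D.A_maxC_pos) D.cnRatio : D.SymC → ℝ) s := he.1 s
      simp only [Pi.single_eq_same]
      have := mul_pos (sub_pos.2 ht1') hd
      positivity
  · have he := D.single_mem_statC hd.le (D.symC D.A_zero_pos)
    obtain ⟨θ, ht0, ht1, ht⟩ := exists_convex_combo h0.le h.le
    have ht1' : 0 < θ := by
      rcases ht0.eq_or_lt with h' | h'
      · rw [← h'] at ht; linarith
      · exact h'
    refine ⟨_, combo_mem_polySet he hs ht0 ht1 ?_, ?_⟩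
    · intro r
      fin_cases r
      · simp [convex_combo_self]
      · simpa [symC] using ht
    · have : 0 ≤ (Pi.single (D.symC D.A_zero_pos) D.cnRatio : D.SymC → ℝ) s := he.1 s
      simp only [Pi.single_eq_same]
      have := mul_pos ht1' hd
      have h2 : 0 ≤ 1 - θ := by linarith
      positivity

/-! ### Saddle points -/

theorem iowef_eq (t : ι) (x y : ℝ) :
    D.iowef t x y = ∑ s : D.SymV t, D.mulV t s * (x ^ (s.1.1 : ℕ) * y ^ (s.1.2 : ℕ)) := by
  have := D.sum_symV t (fun u v => (D.B t u v : ℝ) * (x ^ u * y ^ v)) (fun u v h => by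
    simp [Nat.eq_zero_of_not_pos h])
  rw [iowef]
  simp_rw [mul_assoc]
  exact this.symm

theorem wef_eq (z : ℝ) : D.wef z = ∑ s : D.SymC, D.mulC s * z ^ (s.1 : ℕ) :=
  (D.sum_symC (fun u => (D.A u : ℝ) * z ^ u) (fun u h => by simp [Nat.eq_zero_of_not_pos h])).symm

theorem iowef_pos (t : ι) {x y : ℝ} (hx : 0 < x) (hy : 0 < y) : 0 < D.iowef t x y := by
  rw [iowef_eq]
  exact Finset.sum_pos (fun s _ => mul_pos (D.mulV_pos t s) (by positivity)) Finset.univ_nonempty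

theorem wef_pos {z : ℝ} (hz : 0 < z) : 0 < D.wef z := by
  rw [wef_eq]
  exact Finset.sum_pos (fun s _ => mul_pos (D.mulC_pos s) (by positivity)) Finset.univ_nonempty

theorem nat_mul_pow_pred_mul (m : ℕ) (x : ℝ) : (m : ℝ) * x ^ (m - 1) * x = m * x ^ m := by
  rcases m with _ | m
  · simp
  · rw [Nat.add_sub_cancel, mul_assoc, ← pow_succ]

theorem deriv_iowef_fst_mul (t : ι) (x y : ℝ) : deriv (fun x => D.iowef t x y) x * x =
    ∑ s : D.SymV t, ((s.1.1 : ℕ) : ℝ) * (D.mulV t s * (x ^ (s.1.1 : ℕ) * y ^ (s.1.2 : ℕ))) := by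
  simp_rw [iowef_eq]
  have h : HasDerivAt (fun x => ∑ s : D.SymV t, D.mulV t s * (x ^ (s.1.1 : ℕ) * y ^ (s.1.2 : ℕ)))
      (∑ s : D.SymV t, D.mulV t s * (((s.1.1 : ℕ) : ℝ) * x ^ ((s.1.1 : ℕ) - 1) *
        y ^ (s.1.2 : ℕ))) x :=
    HasDerivAt.fun_sum fun s _ => ((hasDerivAt_pow (s.1.1 : ℕ) x).mul_const _).const_mul _
  rw [h.deriv, Finset.sum_mul]
  refine Finset.sum_congr rfl fun s _ => ?_
  linear_combination D.mulV t s * y ^ (s.1.2 : ℕ) * nat_mul_pow_pred_mul (s.1.1 : ℕ) x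

theorem deriv_iowef_snd_mul (t : ι) (x y : ℝ) : deriv (fun y => D.iowef t x y) y * y =
    ∑ s : D.SymV t, ((s.1.2 : ℕ) : ℝ) * (D.mulV t s * (x ^ (s.1.1 : ℕ) * y ^ (s.1.2 : ℕ))) := by
  simp_rw [iowef_eq]
  have h : HasDerivAt (fun y => ∑ s : D.SymV t, D.mulV t s * (x ^ (s.1.1 : ℕ) * y ^ (s.1.2 : ℕ)))
      (∑ s : D.SymV t, D.mulV t s * (x ^ (s.1.1 : ℕ) *
        (((s.1.2 : ℕ) : ℝ) * y ^ ((s.1.2 : ℕ) - 1)))) y :=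
    HasDerivAt.fun_sum fun s _ => ((hasDerivAt_pow (s.1.2 : ℕ) y).const_mul _).const_mul _
  rw [h.deriv, Finset.sum_mul]
  refine Finset.sum_congr rfl fun s _ => ?_
  linear_combination D.mulV t s * x ^ (s.1.1 : ℕ) * nat_mul_pow_pred_mul (s.1.2 : ℕ) y

theorem deriv_wef_mul (z : ℝ) : deriv D.wef z * z =
    ∑ s : D.SymC, ((s.1 : ℕ) : ℝ) * (D.mulC s * z ^ (s.1 : ℕ)) := by
  rw [show D.wef = fun z => ∑ s : D.SymC, D.mulC s * z ^ (s.1 : ℕ) from funext D.wef_eq]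
  have h : HasDerivAt (fun z => ∑ s : D.SymC, D.mulC s * z ^ (s.1 : ℕ))
      (∑ s : D.SymC, D.mulC s * (((s.1 : ℕ) : ℝ) * z ^ ((s.1 : ℕ) - 1))) z :=
    HasDerivAt.fun_sum fun s _ => (hasDerivAt_pow (s.1 : ℕ) z).const_mul _
  rw [h.deriv, Finset.sum_mul]
  refine Finset.sum_congr rfl fun s _ => ?_
  linear_combination D.mulC s * nat_mul_pow_pred_mul (s.1 : ℕ) z

/-- The distribution on VN symbols given by a saddle point. -/
def gibbsV (t : ι) (p : ℝ × ℝ) (s : D.SymV t) : ℝ :=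
  D.delta t * (D.mulV t s * (p.1 ^ (s.1.1 : ℕ) * p.2 ^ (s.1.2 : ℕ))) / D.iowef t p.1 p.2

/-- The distribution on CN symbols given by a saddle point. -/
def gibbsC (z : ℝ) (s : D.SymC) : ℝ := D.cnRatio * (D.mulC s * z ^ (s.1 : ℕ)) / D.wef z

/-- The operator `x ∂/∂x` multiplies a monomial by its degree, so the saddle-point equations
prescribe the input and output weights of the Gibbs distribution. Its mass is right by
normalization. -/
theorem isSaddleVN_iff {t : ι} {a b : ℝ} {p : ℝ × ℝ} : D.IsSaddleVN t a b p ↔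
    0 < p.1 ∧ 0 < p.2 ∧ D.gibbsV t p ∈ polySet (D.statV t) ![D.delta t, a, b] := by
  have hd := D.delta_pos t
  unfold IsSaddleVN
  refine and_congr_right fun hx => and_congr_right fun hy => ?_
  have hB := D.iowef_pos t hx hy
  rw [mem_polySet_statV]
  have h0 : ∀ s, 0 ≤ D.gibbsV t p s := fun s =>
    div_nonneg (mul_nonneg hd.le (mul_nonneg (D.mulV_pos t s).le (by positivity))) hB.le
  have h1 : ∑ s, D.gibbsV t p s = D.delta t := by
    unfold gibbsV
    rw [← Finset.sum_div, ← Finset.mul_sum, ← iowef_eq]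
    field_simp
  have hg : ∀ f : D.SymV t → ℝ, ∑ s, f s * D.gibbsV t p s = D.delta t *
      (∑ s, f s * (D.mulV t s * (p.1 ^ (s.1.1 : ℕ) * p.2 ^ (s.1.2 : ℕ))) / D.iowef t p.1 p.2) := by
    intro f
    rw [Finset.mul_sum]
    refine Finset.sum_congr rfl fun s _ => ?_
    unfold gibbsV
    ring
  rw [hg, hg, ← Finset.sum_div, ← Finset.sum_div, ← deriv_iowef_fst_mul, ← deriv_iowef_snd_mul,
    mul_div_assoc, mul_div_assoc]
  simp only [h0, h1, implies_true, true_and]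
  rw [eq_div_iff hd.ne', eq_div_iff hd.ne', mul_comm (D.delta t), mul_comm (D.delta t)]

theorem isSaddleCN_iff {b z : ℝ} : D.IsSaddleCN b z ↔
    0 < z ∧ D.gibbsC z ∈ polySet D.statC ![D.cnRatio, b] := by
  have hd := D.cnRatio_pos
  unfold IsSaddleCN
  refine and_congr_right fun hz => ?_
  have hA := D.wef_pos hz
  rw [mem_polySet_statC]
  have h0 : ∀ s, 0 ≤ D.gibbsC z s := fun s =>
    div_nonneg (mul_nonneg hd.le (mul_nonneg (D.mulC_pos s).le (by positivity))) hA.le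
  have h1 : ∑ s, D.gibbsC z s = D.cnRatio := by
    unfold gibbsC
    rw [← Finset.sum_div, ← Finset.mul_sum, ← wef_eq]
    field_simp
  have hg : ∑ s, ((s.1 : ℕ) : ℝ) * D.gibbsC z s = D.cnRatio *
      (∑ s : D.SymC, ((s.1 : ℕ) : ℝ) * (D.mulC s * z ^ (s.1 : ℕ)) / D.wef z) := by
    rw [Finset.mul_sum]
    refine Finset.sum_congr rfl fun s _ => ?_
    unfold gibbsC
    ring
  rw [hg, ← Finset.sum_div, ← deriv_wef_mul]
  simp only [h0, h1, implies_true, true_and]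
  have hl := D.lamInt_pos
  have hr := D.rhoInt_pos
  unfold cnRatio
  constructor
  · intro h
    rw [mul_div_right_comm, h]
    field_simp
  · intro h
    rw [← h]
    field_simp

theorem gibbsV_eq_exp {t : ι} {p : ℝ × ℝ} (hx : 0 < p.1) (hy : 0 < p.2) (s : D.SymV t) :
    D.gibbsV t p s = D.mulV t s * Real.exp (∑ r, ![Real.log (D.delta t / D.iowef t p.1 p.2),
      Real.log p.1, Real.log p.2] r * D.statV t r s) := by
  have hB := D.iowef_pos t hx hy
  simp only [Fin.sum_univ_three, statV, Matrix.cons_val_zero, Matrix.cons_val_one, Matrix.cons_val,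
    Int.cast_one, mul_one, Int.cast_natCast]
  rw [Real.exp_add, Real.exp_add, Real.exp_log (div_pos (D.delta_pos t) hB), mul_comm (Real.log p.1),
    mul_comm (Real.log p.2), Real.exp_nat_mul, Real.exp_nat_mul, Real.exp_log hx, Real.exp_log hy]
  unfold gibbsV
  ring

theorem gibbsC_eq_exp {z : ℝ} (hz : 0 < z) (s : D.SymC) :
    D.gibbsC z s = D.mulC s * Real.exp (∑ r, ![Real.log (D.cnRatio / D.wef z),
      Real.log z] r * D.statC r s) := by
  have hA := D.wef_pos hz
  simp only [Fin.sum_univ_two, statC, Matrix.cons_val_zero, Matrix.cons_val_one, Int.cast_one,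
    mul_one, Int.cast_natCast]
  rw [Real.exp_add, Real.exp_log (div_pos D.cnRatio_pos hA), mul_comm (Real.log z),
    Real.exp_nat_mul, Real.exp_log hz]
  unfold gibbsC
  ring

/-- A positive distribution with these statistics forces an exponential-family member with the same
ones. Exponentiating the multipliers of the two weights gives the saddle point; the multiplier of
the mass is the normalization. -/
theorem exists_isSaddleVN {t : ι} {a b : ℝ} (h0 : 0 < a) (h1 : a < D.delta t * D.k t)
    (hb : (D.lower t a < b ∧ b < D.upper t a) ∨ (D.lower t a = b ∧ b = D.upper t a)) :
    ∃ p : ℝ × ℝ, D.IsSaddleVN t a b p := by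
  obtain ⟨y, hy, hpos⟩ := D.exists_pos_statV h0 h1 hb
  obtain ⟨g, hg⟩ := exists_exponential_mem (T := D.statV t) (r₀ := 0) (fun s => rfl)
    (D.mulV_pos t) hpos
  simp only [hy.2] at hg
  have hexp : ∀ s, Real.exp (∑ r, g r * D.statV t r s) = Real.exp (g 0) *
      (Real.exp (g 1) ^ (s.1.1 : ℕ) * Real.exp (g 2) ^ (s.1.2 : ℕ)) := by
    intro s
    simp only [Fin.sum_univ_three, statV, Matrix.cons_val_zero, Matrix.cons_val_one,
      Matrix.cons_val, Int.cast_one, mul_one, Int.cast_natCast]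
    rw [Real.exp_add, Real.exp_add, mul_comm (g 1), mul_comm (g 2), Real.exp_nat_mul,
      Real.exp_nat_mul]
    ring
  have hB := D.iowef_pos t (Real.exp_pos (g 1)) (Real.exp_pos (g 2))
  have hmass : Real.exp (g 0) = D.delta t / D.iowef t (Real.exp (g 1)) (Real.exp (g 2)) := by
    have := hg 0
    simp only [hexp] at this
    simp only [statV, Matrix.cons_val_zero, Int.cast_one, one_mul] at this
    rw [eq_div_iff hB.ne', iowef_eq, Finset.mul_sum, ← this]
    exact Finset.sum_congr rfl fun s _ => by ring
  refine ⟨(Real.exp (g 1), Real.exp (g 2)), D.isSaddleVN_iff.2 ⟨Real.exp_pos _, Real.exp_pos _, ?_⟩⟩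
  have hgib : D.gibbsV t (Real.exp (g 1), Real.exp (g 2)) =
      fun s => D.mulV t s * Real.exp (∑ r, g r * D.statV t r s) := by
    funext s
    rw [hexp, hmass]
    unfold gibbsV
    ring
  rw [hgib]
  exact ⟨fun s => (mul_pos (D.mulV_pos t s) (Real.exp_pos _)).le, hg⟩

/-- Two solutions define the same distribution. The symbol `(0, 0)` removes the normalization, so a
linear form in the two weights vanishes on all symbols. Averaging it over distributions at the lower
and at the upper bound kills the coefficient of the output weight, and a symbol of input weight `k
t` kills the other. When the bounds coincide the first step fails. -/
theorem isSaddleVN_unique {t : ι} {a b : ℝ} (hlt : D.lower t a < D.upper t a) {p p' : ℝ × ℝ}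
    (h : D.IsSaddleVN t a b p) (h' : D.IsSaddleVN t a b p') : p = p' := by
  obtain ⟨hx, hy, hm⟩ := D.isSaddleVN_iff.1 h
  obtain ⟨hx', hy', hm'⟩ := D.isSaddleVN_iff.1 h'
  obtain ⟨ha0, ha1, -, -⟩ := D.mem_vnRegion_of_mem hm
  have hinj := exponential_injective (T := D.statV t) (D.mulV_pos t)
    (g := ![Real.log (D.delta t / D.iowef t p.1 p.2), Real.log p.1, Real.log p.2])
    (g' := ![Real.log (D.delta t / D.iowef t p'.1 p'.2), Real.log p'.1, Real.log p'.2])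
    (fun r => by
      simp_rw [← D.gibbsV_eq_exp hx hy, ← D.gibbsV_eq_exp hx' hy']
      rw [hm.2, hm'.2])
  simp only [Fin.sum_univ_three, statV, Matrix.cons_val_zero, Matrix.cons_val_one, Matrix.cons_val,
    Int.cast_one, mul_one, Int.cast_natCast] at hinj
  have hc0 := hinj (D.symV (D.B_zero_pos t))
  simp only [symV, Nat.cast_zero, mul_zero, add_zero] at hc0
  set ξ := Real.log p.1 - Real.log p'.1 with hξ
  set ζ := Real.log p.2 - Real.log p'.2 with hζ
  have hlin : ∀ s : D.SymV t, ξ * ((s.1.1 : ℕ) : ℝ) + ζ * ((s.1.2 : ℕ) : ℝ) = 0 := by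
    intro s
    have := hinj s
    rw [hc0] at this
    rw [hξ, hζ]
    linarith
  have hζ0 : ζ = 0 := by
    have hval : ∀ c, (polySet (D.statV t) ![D.delta t, a, c]).Nonempty → ξ * a + ζ * c = 0 := by
      rintro c ⟨x, hx⟩
      obtain ⟨-, -, h2, h3⟩ := D.mem_polySet_statV.1 hx
      rw [← h2, ← h3, Finset.mul_sum, Finset.mul_sum, ← Finset.sum_add_distrib]
      refine Finset.sum_eq_zero fun s _ => ?_
      linear_combination x s * hlin s
    have hl := hval _ (D.exists_mem_lower ha0 ha1)
    have hu := hval _ (D.exists_mem_upper ha0 ha1)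
    have : ζ * (D.upper t a - D.lower t a) = 0 := by linarith
    exact (mul_eq_zero.1 this).resolve_right (by linarith)
  have hξ0 : ξ = 0 := by
    obtain ⟨v, hv⟩ := D.exists_B_pos (le_refl (D.k t))
    have := hlin (D.symV hv)
    rw [hζ0, zero_mul, add_zero] at this
    refine (mul_eq_zero.1 this).resolve_right ?_
    have := D.k_pos t
    simp only [symV]
    positivity
  refine Prod.ext ?_ ?_
  · exact Real.log_injOn_pos hx hx' (sub_eq_zero.1 hξ0)
  · exact Real.log_injOn_pos hy hy' (sub_eq_zero.1 hζ0)

theorem maxC_pos : 0 < D.maxC := by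
  obtain ⟨u, hu, hA⟩ := D.exists_A_pos
  exact hu.trans_le (D.le_maxC hA)

theorem exists_isSaddleCN {b : ℝ} (h0 : 0 < b) (h1 : b < D.betaMax) : ∃ z, D.IsSaddleCN b z := by
  obtain ⟨y, hy, hpos⟩ := D.exists_pos_statC h0 h1
  obtain ⟨g, hg⟩ := exists_exponential_mem (T := D.statC) (r₀ := 0) (fun s => rfl)
    D.mulC_pos hpos
  simp only [hy.2] at hg
  have hexp : ∀ s, Real.exp (∑ r, g r * D.statC r s) = Real.exp (g 0) *
      Real.exp (g 1) ^ (s.1 : ℕ) := by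
    intro s
    simp only [Fin.sum_univ_two, statC, Matrix.cons_val_zero, Matrix.cons_val_one, Int.cast_one,
      mul_one, Int.cast_natCast]
    rw [Real.exp_add, mul_comm (g 1), Real.exp_nat_mul]
  have hA := D.wef_pos (Real.exp_pos (g 1))
  have hmass : Real.exp (g 0) = D.cnRatio / D.wef (Real.exp (g 1)) := by
    have := hg 0
    simp only [hexp] at this
    simp only [statC, Matrix.cons_val_zero, Int.cast_one, one_mul] at this
    rw [eq_div_iff hA.ne', wef_eq, Finset.mul_sum, ← this]
    exact Finset.sum_congr rfl fun s _ => by ring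
  refine ⟨Real.exp (g 1), D.isSaddleCN_iff.2 ⟨Real.exp_pos _, ?_⟩⟩
  have hgib : D.gibbsC (Real.exp (g 1)) =
      fun s => D.mulC s * Real.exp (∑ r, g r * D.statC r s) := by
    funext s
    rw [hexp, hmass]
    unfold gibbsC
    ring
  rw [hgib]
  exact ⟨fun s => (mul_pos (D.mulC_pos s) (Real.exp_pos _)).le, hg⟩

/-- The zero codeword removes the normalization, and a codeword of maximal weight then determines
`log z`; this weight is positive as the codes are nonzero. -/
theorem isSaddleCN_unique {b z z' : ℝ} (h : D.IsSaddleCN b z) (h' : D.IsSaddleCN b z') :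
    z = z' := by
  obtain ⟨hz, hm⟩ := D.isSaddleCN_iff.1 h
  obtain ⟨hz', hm'⟩ := D.isSaddleCN_iff.1 h'
  have hinj := exponential_injective (T := D.statC) D.mulC_pos
    (g := ![Real.log (D.cnRatio / D.wef z), Real.log z])
    (g' := ![Real.log (D.cnRatio / D.wef z'), Real.log z'])
    (fun r => by
      simp_rw [← D.gibbsC_eq_exp hz, ← D.gibbsC_eq_exp hz']
      rw [hm.2, hm'.2])
  simp only [Fin.sum_univ_two, statC, Matrix.cons_val_zero, Matrix.cons_val_one, Int.cast_one,
    mul_one, Int.cast_natCast] at hinj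
  have hc0 := hinj (D.symC D.A_zero_pos)
  have hc1 := hinj (D.symC D.A_maxC_pos)
  simp only [symC, Nat.cast_zero, mul_zero, add_zero] at hc0 hc1
  rw [hc0] at hc1
  have hpos : ((D.maxC : ℕ) : ℝ) ≠ 0 := by exact_mod_cast D.maxC_pos.ne'
  exact Real.log_injOn_pos hz hz' (mul_right_cancel₀ hpos (add_left_cancel hc1))

/-! ### The functions `X` and `Y` -/

/-- The growth rate of the number of inputs of the type-`t` VNs with given statistics. -/
def rateV (t : ι) (p : ℝ × ℝ) : ℝ :=
  valueFn (D.statV t) (entFn (D.mulV t)) ![D.delta t, p.1, p.2]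

/-- The growth rate of the number of choices of CN codewords of given weight. -/
def rateC (b : ℝ) : ℝ := valueFn D.statC (entFn D.mulC) ![D.cnRatio, b]

/-- The growth rate of the probability that edge bits of given weight fit the CNs. -/
def rateY (b : ℝ) : ℝ := D.rateC b - Real.binEntropy (b * D.lamInt) / D.lamInt

theorem bounded_statV {t : ι} {a b : ℝ} :
    ∀ x ∈ polySet (D.statV t) ![D.delta t, a, b], ∀ s, x s ≤ (fun _ => D.delta t) s :=
  fun _ hx s => le_sum_of_mem_polySet (r₀ := 0) (fun _ => rfl) hx s

theorem bounded_statC {b : ℝ} :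
    ∀ x ∈ polySet D.statC ![D.cnRatio, b], ∀ s, x s ≤ (fun _ => D.cnRatio) s :=
  fun _ hx s => le_sum_of_mem_polySet (r₀ := 0) (fun _ => rfl) hx s

theorem continuousOn_rateV (t : ι) : ContinuousOn (D.rateV t) (D.vnRegion t) := by
  have h := continuousOn_valueFn (T := D.statV t) (continuous_entFn (D.mulV t))
    (Dom := (fun p : ℝ × ℝ => ![D.delta t, p.1, p.2]) '' D.vnRegion t) (M := fun _ => D.delta t)
    (by rintro _ ⟨p, -, rfl⟩; exact D.bounded_statV)
    (by rintro _ ⟨p, hp, rfl⟩; exact D.mem_vnRegion_iff.1 hp)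
  refine h.comp (f := fun p : ℝ × ℝ => ![D.delta t, p.1, p.2]) ?_ (Set.mapsTo_image _ _)
  refine Continuous.continuousOn (continuous_pi fun i => ?_)
  fin_cases i
  · exact continuous_const
  · exact continuous_fst
  · exact continuous_snd

theorem continuousOn_rateY : ContinuousOn D.rateY (Set.Icc 0 D.betaMax) := by
  have h := continuousOn_valueFn (T := D.statC) (continuous_entFn D.mulC)
    (Dom := (fun b : ℝ => ![D.cnRatio, b]) '' Set.Icc 0 D.betaMax) (M := fun _ => D.cnRatio)
    (by rintro _ ⟨p, -, rfl⟩; exact D.bounded_statC)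
    (by rintro _ ⟨p, hp, rfl⟩; exact D.mem_Icc_betaMax_iff.1 hp)
  refine ContinuousOn.sub (h.comp (f := fun b : ℝ => ![D.cnRatio, b]) ?_ (Set.mapsTo_image _ _)) ?_
  · refine Continuous.continuousOn (continuous_pi fun i => ?_)
    fin_cases i
    · exact continuous_const
    · exact continuous_id
  · exact ((Real.binEntropy_continuous.comp (continuous_mul_const _)).div_const _).continuousOn

/-- The linear term of the Gibbs inequality is constant on the polyhedron, so its bound is uniform
there and attained at the Gibbs distribution. Every saddle point gives this value, unique or not. -/
theorem rateV_eq_valX {t : ι} {a b : ℝ} {p : ℝ × ℝ} (h : D.IsSaddleVN t a b p) :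
    D.rateV t (a, b) = D.valX t a b p := by
  obtain ⟨hx, hy, hm⟩ := D.isSaddleVN_iff.1 h
  have hd := D.delta_pos t
  have hB := D.iowef_pos t hx hy
  set g : D.SymV t → ℝ := fun s => (s.1.1 : ℕ) * Real.log p.1 + (s.1.2 : ℕ) * Real.log p.2 with hg
  have hexp : ∀ s, Real.exp (g s) = p.1 ^ (s.1.1 : ℕ) * p.2 ^ (s.1.2 : ℕ) := fun s => by
    rw [hg, Real.exp_add, Real.exp_nat_mul, Real.exp_nat_mul, Real.exp_log hx, Real.exp_log hy]
  have hZ : ∑ s, D.mulV t s * Real.exp (g s) = D.iowef t p.1 p.2 := by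
    simp_rw [hexp]; rw [iowef_eq]
  have hlin : ∀ x ∈ polySet (D.statV t) ![D.delta t, a, b],
      ∑ s, x s * g s = a * Real.log p.1 + b * Real.log p.2 := by
    intro x hx
    obtain ⟨-, -, h2, h3⟩ := D.mem_polySet_statV.1 hx
    rw [← h2, ← h3, Finset.sum_mul, Finset.sum_mul, ← Finset.sum_add_distrib]
    exact Finset.sum_congr rfl fun s _ => by simp only [hg]; ring
  have hval : entFn (D.mulV t) (D.gibbsV t p) =
      D.delta t * Real.log (D.iowef t p.1 p.2) - (a * Real.log p.1 + b * Real.log p.2) := by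
    rw [entFn_eq (D.mulV_pos t) g hd (fun s => by rw [hZ, hexp]; rfl)
      (D.mem_polySet_statV.1 hm).2.1, hZ, hlin _ hm]
  have hv : D.rateV t (a, b) = entFn (D.mulV t) (D.gibbsV t p) := by
    refine valueFn_eq hm fun y hy => ?_
    rw [hval, ← hZ, ← hlin y hy]
    exact entFn_le (D.mulV_pos t) g hy.1 hd (D.mem_polySet_statV.1 hy).2.1
  rw [hv, hval, valX, Real.log_div (by positivity) (by positivity), Real.log_rpow hB,
    Real.log_mul (by positivity) (by positivity), Real.log_rpow hx, Real.log_rpow hy]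

theorem rateY_eq_valY {b z : ℝ} (h : D.IsSaddleCN b z) : D.rateY b = D.valY b z := by
  obtain ⟨hz, hm⟩ := D.isSaddleCN_iff.1 h
  have hd := D.cnRatio_pos
  have hA := D.wef_pos hz
  set g : D.SymC → ℝ := fun s => (s.1 : ℕ) * Real.log z with hg
  have hexp : ∀ s, Real.exp (g s) = z ^ (s.1 : ℕ) := fun s => by
    rw [hg, Real.exp_nat_mul, Real.exp_log hz]
  have hZ : ∑ s, D.mulC s * Real.exp (g s) = D.wef z := by
    simp_rw [hexp]; rw [wef_eq]
  have hlin : ∀ x ∈ polySet D.statC ![D.cnRatio, b], ∑ s, x s * g s = b * Real.log z := by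
    intro x hx
    obtain ⟨-, -, h2⟩ := D.mem_polySet_statC.1 hx
    rw [← h2, Finset.sum_mul]
    exact Finset.sum_congr rfl fun s _ => by simp only [hg]; ring
  have hval : entFn D.mulC (D.gibbsC z) =
      D.cnRatio * Real.log (D.wef z) - b * Real.log z := by
    rw [entFn_eq D.mulC_pos g hd (fun s => by rw [hZ, hexp]; rfl)
      (D.mem_polySet_statC.1 hm).2.1, hZ, hlin _ hm]
  have hv : D.rateC b = entFn D.mulC (D.gibbsC z) := by
    refine valueFn_eq hm fun y hy => ?_
    rw [hval, ← hZ, ← hlin y hy]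
    exact entFn_le D.mulC_pos g hy.1 hd (D.mem_polySet_statC.1 hy).2.1
  rw [rateY, hv, hval, valY, Real.log_div (by positivity) (by positivity), Real.log_rpow hA,
    Real.log_rpow hz]
  rfl

end DGLDPC

end

noncomputable section

/-! ### Counting sequences and configurations by profile -/

section Counting

open Nat

/-- Bijections over `κ` are families of bijections between the fibers. -/
def equivOverEquiv {A B κ : Type*} (f : A → κ) (g : B → κ) :
    {e : A ≃ B // ∀ a, g (e a) = f a} ≃ (∀ k, {a // f a = k} ≃ {b // g b = k}) where
  toFun e k := e.1.subtypeEquiv fun a => by rw [e.2 a]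
  invFun E := ⟨Equiv.ofFiberEquiv E, fun a => Equiv.ofFiberEquiv_map E a⟩
  left_inv e := by
    ext a
    rfl
  right_inv E := by
    funext k
    ext ⟨a, ha⟩
    subst ha
    rfl

/-- A label-preserving bijection consists of independent bijections between the fibers, which have
equal size. -/
theorem card_equivOver {A B κ : Type*} [Finite A] [Finite B] [Fintype κ] (f : A → κ) (g : B → κ)
    (h : ∀ k, Nat.card {a // f a = k} = Nat.card {b // g b = k}) :
    Nat.card {e : A ≃ B // ∀ a, g (e a) = f a} = ∏ k, (Nat.card {a // f a = k})! := by
  classical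
  have := Fintype.ofFinite A
  have := Fintype.ofFinite B
  rw [Nat.card_congr (equivOverEquiv f g), Nat.card_pi]
  refine Finset.prod_congr rfl fun k _ => ?_
  have h' := h k
  rw [Nat.card_eq_fintype_card, Nat.card_eq_fintype_card] at h'
  rw [Nat.card_eq_fintype_card, Nat.card_eq_fintype_card,
    Fintype.card_equiv (Fintype.equivOfCardEq h')]

variable {I J κ : Type*} [Fintype I] [Fintype J] [Fintype κ]

/-- The number of occurrences of each symbol in a sequence. -/
def profile {I J : Type*} (σ : I → J) (j : J) : ℕ := Nat.card {i // σ i = j}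

theorem sum_comp_eq_sum_profile (σ : I → J) (f : J → ℕ) :
    ∑ i, f (σ i) = ∑ j, profile σ j * f j := by
  classical
  rw [← Finset.sum_fiberwise Finset.univ σ]
  refine Finset.sum_congr rfl fun j _ => ?_
  rw [Finset.sum_congr rfl (g := fun _ => f j) (fun i hi => by rw [(Finset.mem_filter.1 hi).2]),
    Finset.sum_const, smul_eq_mul, profile, Nat.card_eq_fintype_card, Fintype.card_subtype]

theorem prod_comp_eq_prod_profile (σ : I → J) (f : J → ℕ) :
    ∏ i, f (σ i) = ∏ j, f j ^ profile σ j := by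
  classical
  rw [← Finset.prod_fiberwise Finset.univ σ]
  refine Finset.prod_congr rfl fun j _ => ?_
  rw [Finset.prod_congr rfl (g := fun _ => f j) (fun i hi => by rw [(Finset.mem_filter.1 hi).2]),
    Finset.prod_const, profile, Nat.card_eq_fintype_card, Fintype.card_subtype]

/-- The number of sequences over `κ` with a given profile, a product of multinomial coefficients. -/
theorem card_sequences_mul [DecidableEq κ] (cI : I → κ) (cJ : J → κ) (N : J → ℕ)
    (hN : ∀ k, profile cI k = ∑ j, if cJ j = k then N j else 0) :
    Nat.card {σ : I → J // (∀ i, cJ (σ i) = cI i) ∧ ∀ j, profile σ j = N j} * ∏ j, (N j)! =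
      ∏ k, (profile cI k)! := by
  classical
  -- Double counting of the class-preserving bijections from `I` to `N j` labelled copies of each
  -- symbol `j`: forgetting the labels gives a sequence with profile `N`, and each sequence arises
  -- `∏ j, (N j)!` times.
  let B := Σ j, Fin (N j)
  have hfibJ : ∀ j, Nat.card {b : B // b.1 = j} = N j := by
    intro j
    rw [Nat.card_congr (Equiv.sigmaSubtype (β := fun j => Fin (N j)) j), Nat.card_fin]
  have hfibK : ∀ k, profile cI k = Nat.card {b : B // cJ b.1 = k} := by
    intro k
    rw [hN k, Nat.card_congr (Equiv.subtypeSigmaEquiv (fun j => Fin (N j)) (fun j => cJ j = k)),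
      Nat.card_sigma, ← Finset.sum_filter]
    simp only [Nat.card_fin]
    exact Finset.sum_subtype _ (by simp) N
  have hprof : ∀ (e : I ≃ B) j, profile (fun i => (e i).1) j = N j := by
    intro e j
    rw [← hfibJ j]
    exact Nat.card_congr (e.subtypeEquiv fun i => Iff.rfl)
  rw [show (∏ k, (profile cI k)!) = _ from (card_equivOver cI (fun b : B => cJ b.1) hfibK).symm,
    ← Nat.card_congr (Equiv.sigmaSubtypeFiberEquivSubtype
    (fun (e : I ≃ B) i => (e i).1) (p := fun e => ∀ i, cJ (e i).1 = cI i)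
    (q := fun σ => (∀ i, cJ (σ i) = cI i) ∧ ∀ j, profile σ j = N j)
    (fun e => ⟨fun h => ⟨h, hprof e⟩, fun h => h.1⟩)), Nat.card_sigma]
  rw [Finset.sum_congr rfl (g := fun _ => ∏ j, (N j)!), Finset.sum_const, Finset.card_univ,
    smul_eq_mul, Nat.card_eq_fintype_card]
  rintro ⟨σ, hσ⟩ -
  have h1 := card_equivOver σ (fun b : B => b.1) (fun j => (hσ.2 j).trans (hfibJ j).symm)
  rw [Nat.card_congr (Equiv.subtypeEquivRight
    (q := fun e : I ≃ B => ∀ i, (e i).1 = σ i) fun e => funext_iff), h1]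
  exact Finset.prod_congr rfl fun j _ => congrArg _ (hσ.2 j)

/-- The number of families of local configurations with a given profile. -/
theorem card_configs_mul [DecidableEq κ] {X : I → Type*} [∀ i, Finite (X i)] (sym : ∀ i, X i → J)
    (cI : I → κ) (cJ : J → κ) (hsym : ∀ i x, cJ (sym i x) = cI i) (c : J → ℕ)
    (hc : ∀ i j, cJ j = cI i → Nat.card {x : X i // sym i x = j} = c j) (N : J → ℕ)
    (hN : ∀ k, profile cI k = ∑ j, if cJ j = k then N j else 0) :
    Nat.card {x : ∀ i, X i // ∀ j, profile (fun i => sym i (x i)) j = N j} * ∏ j, (N j)! =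
      (∏ k, (profile cI k)!) * ∏ j, c j ^ N j := by
  classical
  rw [← card_sequences_mul cI cJ N hN, ← Nat.card_congr (Equiv.sigmaSubtypeFiberEquivSubtype
    (fun (x : ∀ i, X i) i => sym i (x i))
    (p := fun x => ∀ j, profile (fun i => sym i (x i)) j = N j)
    (q := fun σ => (∀ i, cJ (σ i) = cI i) ∧ ∀ j, profile σ j = N j)
    (fun x => ⟨fun h => ⟨fun i => hsym i _, h⟩, fun h => h.2⟩)), Nat.card_sigma]
  rw [Finset.sum_congr rfl (g := fun _ => ∏ j, c j ^ N j), Finset.sum_const, Finset.card_univ,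
    smul_eq_mul, Nat.card_eq_fintype_card]
  · ring
  rintro ⟨σ, hσ⟩ -
  have h1 : {x : ∀ i, X i // (fun i => sym i (x i)) = σ} ≃ ∀ i, {x : X i // sym i x = σ i} :=
    (Equiv.subtypeEquivRight fun x => funext_iff).trans
      (Equiv.subtypePiEquivPi (p := fun i x => sym i x = σ i))
  rw [Nat.card_congr h1, Nat.card_pi,
    Finset.prod_congr rfl fun i _ => hc i (σ i) (hσ.1 i), prod_comp_eq_prod_profile]
  exact Finset.prod_congr rfl fun j _ => by rw [hσ.2 j]

end Counting

end

noncomputable section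

namespace DGLDPC

variable {ι : Type*} [Fintype ι] (D : DGLDPC ι)

/-! ### The expected weight distribution as a sum over profiles -/

/-- All symbols: pairs of weights of VNs, tagged with the type, and weights of CNs. -/
abbrev Sym : Type _ := (Σ t : ι, D.SymV t) ⊕ D.SymC

/-- The class of nodes that a symbol belongs to, `none` being that of the CNs. -/
def symClass : D.Sym → Option ι := Sum.elim (fun s => some s.1) (fun _ => none)

/-- The nodes of a member of `M_n`. -/
abbrev Node (n : ℕ) : Type _ := D.VNode n ⊕ Fin (D.numCN n)

/-- The class of a node. -/
def nodeClass (n : ℕ) : D.Node n → Option ι := Sum.elim (fun p => some p.1) (fun _ => none)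

/-- The number of nodes of each class. -/
def classSize (n : ℕ) : Option ι → ℕ
  | some t => D.numVN n t
  | none => D.numCN n

/-- The local configurations of a node: inputs of VNs, codewords of CNs. -/
def Local (n : ℕ) : D.Node n → Type
  | .inl p => Fin (D.k p.1) → ZMod 2
  | .inr j => D.cn n j

instance (n : ℕ) (i : D.Node n) : Fintype (D.Local n i) :=
  match i with
  | .inl p => inferInstanceAs (Fintype (Fin (D.k p.1) → ZMod 2))
  | .inr j => Fintype.ofFinite (D.cn n j)

/-- The symbol of a local configuration. -/
def localSym (n : ℕ) : ∀ i : D.Node n, D.Local n i → D.Sym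
  | .inl p, x => .inl ⟨p.1, D.symV ((D.B_pos_iff n p.1 p.2 _ _).2 ⟨x, rfl, rfl⟩)⟩
  | .inr j, c => .inr (D.symC ((D.A_pos_iff n j _).2 ⟨c.1, c.2, rfl⟩))

/-- The number of local configurations with a given symbol. -/
def symMul : D.Sym → ℕ := Sum.elim (fun s => D.B s.1 s.2.1.1 s.2.1.2) (fun s => D.A s.1)

/-- The contribution of a symbol to the weight of the word. -/
def inWt : D.Sym → ℕ := Sum.elim (fun s => s.2.1.1) (fun _ => 0)

/-- The contribution of a symbol to the weight of the VN outputs. -/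
def outWt : D.Sym → ℕ := Sum.elim (fun s => s.2.1.2) (fun _ => 0)

/-- The contribution of a symbol to the weight of the CN codewords. -/
def chkWt : D.Sym → ℕ := Sum.elim (fun _ => 0) (fun s => s.1)

theorem symClass_localSym (n : ℕ) (i : D.Node n) (x : D.Local n i) :
    D.symClass (D.localSym n i x) = D.nodeClass n i := by
  rcases i with p | j <;> rfl

theorem card_localSym (n : ℕ) (i : D.Node n) (j : D.Sym) (h : D.symClass j = D.nodeClass n i) :
    Nat.card {x : D.Local n i // D.localSym n i x = j} = D.symMul j := by
  rcases i with p | i <;> rcases j with s | s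
  · obtain ⟨t, s⟩ := s
    have ht : t = p.1 := Option.some.inj h
    subst ht
    refine (Nat.card_congr (Equiv.subtypeEquivRight fun x => ?_)).trans
      (D.vn_iowef n p.1 p.2 s.1.1 s.1.2)
    simp [localSym, symV, Subtype.ext_iff, Prod.ext_iff, Fin.ext_iff]
  · exact absurd h (by simp [symClass, nodeClass])
  · exact absurd h (by simp [symClass, nodeClass])
  · refine Eq.trans ?_ (D.cn_wef n i s.1)
    refine (Nat.card_congr (Equiv.subtypeEquivRight (q := fun x : D.cn n i =>
      hammingNorm x.1 = s.1) fun x => ?_)).trans (Nat.card_congr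
        (Equiv.subtypeSubtypeEquivSubtypeInter (fun c => c ∈ D.cn n i)
          (fun c => hammingNorm c = (s.1 : ℕ))))
    simp [localSym, symC, Subtype.ext_iff, Fin.ext_iff]

theorem profile_nodeClass (n : ℕ) (k : Option ι) :
    profile (D.nodeClass n) k = D.classSize n k := by
  classical
  rw [profile, Nat.card_eq_fintype_card, Fintype.card_subtype, Finset.card_filter, Fintype.sum_sum_type, Fintype.sum_sigma]
  rcases k with _ | t
  · simp [nodeClass, classSize]
  · simp [nodeClass, classSize, Finset.sum_ite_eq']

theorem sum_card_subtype_comm {α β : Type*} [Fintype α] [Fintype β] (P : β → Prop)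
    [DecidablePred P] (Q : α → β → Prop) :
    ∑ a, Nat.card {b // P b ∧ Q a b} = ∑ b with P b, Nat.card {a // Q a b} := by
  classical
  simp_rw [Nat.card_eq_fintype_card, Fintype.card_subtype, Finset.card_filter]
  rw [Finset.sum_comm, Finset.sum_filter]
  refine Finset.sum_congr rfl fun b _ => ?_
  by_cases h : P b <;> simp [h]

/-- A choice of local configurations of all nodes. -/
abbrev Config (n : ℕ) : Type _ := ∀ i : D.Node n, D.Local n i

/-- The bits that a choice of local configurations puts on the VN sockets. -/
def vBit (n : ℕ) (x : D.Config n) (e : D.VSocket n) : ZMod 2 :=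
  D.edgeBit n (fun p => x (.inl p)) e

/-- The bits that a choice of local configurations puts on the CN sockets. -/
def cBit (n : ℕ) (x : D.Config n) (e : D.CSocket n) : ZMod 2 := (x (.inr e.1)).1 e.2

/-- The word and the permutation already determine the CN codewords, so including these adds no
freedom. It turns the condition on the permutation into a matching of bits, which is easy to count.
-/
theorem numCodewords_eq (n : ℕ) (π : D.VSocket n ≃ D.CSocket n) (w : ℕ) :
    D.numCodewords n π w = Nat.card {x : D.Config n //
      ∑ i, D.inWt (D.localSym n i (x i)) = w ∧ ∀ e, D.cBit n x (π e) = D.vBit n x e} := by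
  have hw : ∀ x : D.Config n, ∑ i, D.inWt (D.localSym n i (x i)) =
      ∑ p : D.VNode n, hammingNorm (show Fin (D.k p.1) → ZMod 2 from x (.inl p)) := by
    intro x
    rw [Fintype.sum_sum_type]
    simp [localSym, inWt, symV]
  refine Nat.card_congr ⟨fun u => ⟨fun i => match i with
      | .inl p => u.1 p
      | .inr j => ⟨_, u.2.1 j⟩, ?_, ?_⟩, fun x => ⟨fun p => x.1 (.inl p), ?_, ?_⟩, ?_, ?_⟩
  · rw [hw]; exact u.2.2
  · intro e
    simp [cBit, vBit]
  · intro j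
    have h : (fun l => D.edgeBit n (fun p => x.1 (.inl p)) (π.symm (j, l))) = (x.1 (.inr j)).1 := by
      funext l
      have := x.2.2 (π.symm (j, l))
      rw [Equiv.apply_symm_apply] at this
      exact this.symm
    rw [h]
    exact (x.1 (.inr j)).2
  · exact (hw x.1).symm.trans x.2.1
  · intro u
    rfl
  · rintro ⟨x, hx⟩
    apply Subtype.ext
    funext i
    rcases i with p | j
    · rfl
    · apply Subtype.ext
      funext l
      have := hx.2 (π.symm (j, l))
      rw [Equiv.apply_symm_apply] at this
      exact this.symm

theorem card_vBit (n : ℕ) (x : D.Config n) : Nat.card {e // D.vBit n x e = 1} =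
    ∑ i, D.outWt (D.localSym n i (x i)) := by
  classical
  rw [Nat.card_eq_fintype_card, Fintype.card_subtype, Finset.card_filter, Fintype.sum_sigma,
    Fintype.sum_sum_type]
  simp only [localSym, outWt, symV, Sum.elim_inl, Sum.elim_inr, Finset.sum_const_zero, add_zero]
  refine Finset.sum_congr rfl fun p _ => ?_
  rw [hammingNorm, Finset.card_filter]
  refine Finset.sum_congr rfl fun l _ => ?_
  have h2 : ∀ z : ZMod 2, z = 1 ↔ z ≠ 0 := by decide
  exact if_congr (h2 _) rfl rfl

theorem card_cBit (n : ℕ) (x : D.Config n) : Nat.card {e // D.cBit n x e = 1} =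
    ∑ i, D.chkWt (D.localSym n i (x i)) := by
  classical
  rw [Nat.card_eq_fintype_card, Fintype.card_subtype, Finset.card_filter, Fintype.sum_prod_type,
    Fintype.sum_sum_type]
  simp only [localSym, chkWt, symC, Sum.elim_inl, Sum.elim_inr, Finset.sum_const_zero, zero_add]
  refine Finset.sum_congr rfl fun p _ => ?_
  rw [hammingNorm, Finset.card_filter]
  refine Finset.sum_congr rfl fun l _ => ?_
  have h2 : ∀ z : ZMod 2, z = 1 ↔ z ≠ 0 := by decide
  exact if_congr (h2 _) rfl rfl

open Nat in
/-- The number of bijections that carry one binary labelling to another. -/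
theorem card_equiv_binary {A B : Type*} [Fintype A] [Fintype B]
    (hAB : Fintype.card A = Fintype.card B) (f : A → ZMod 2) (g : B → ZMod 2) :
    Nat.card {e : A ≃ B // ∀ a, g (e a) = f a} =
      if Nat.card {a // f a = 1} = Nat.card {b // g b = 1} then
        (Nat.card {a // f a = 1})! * (Fintype.card A - Nat.card {a // f a = 1})! else 0 := by
  classical
  have h2 : ∀ z : ZMod 2, z = 0 ↔ ¬ z = 1 := by decide
  have hzeroA : Nat.card {a // f a = 0} = Fintype.card A - Nat.card {a // f a = 1} := by
    rw [Nat.card_eq_fintype_card, Nat.card_eq_fintype_card, ← Fintype.card_subtype_compl]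
    exact Fintype.card_congr (Equiv.subtypeEquivRight fun c => h2 _)
  have hzeroB : Nat.card {b // g b = 0} = Fintype.card B - Nat.card {b // g b = 1} := by
    rw [Nat.card_eq_fintype_card, Nat.card_eq_fintype_card, ← Fintype.card_subtype_compl]
    exact Fintype.card_congr (Equiv.subtypeEquivRight fun c => h2 _)
  split_ifs with h
  · rw [card_equivOver f g]
    · change ∏ k : Fin 2, (Nat.card {a // f a = k})! = _
      rw [Fin.prod_univ_two, mul_comm, ← hzeroA]
      rfl
    · intro k
      have hk : ∀ z : ZMod 2, z = 0 ∨ z = 1 := by decide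
      rcases hk k with rfl | rfl
      · rw [hzeroA, hzeroB, hAB, h]
      · exact h
  · rw [Nat.card_eq_zero]
    left
    refine ⟨fun e => h ?_⟩
    exact Nat.card_congr (e.1.subtypeEquiv fun a => by rw [e.2 a])

/-- The number of edges. -/
def numEdges (n : ℕ) : ℕ := D.numCN n * D.s

theorem card_CSocket (n : ℕ) : Fintype.card (D.CSocket n) = D.numEdges n := by
  simp [numEdges]

/-- Both sides have `n / ∫λ` edges: type `t` contributes the fraction `λ_t` of them, and the
fractions add up to one. -/
theorem card_VSocket {n : ℕ} (hn : D.Admissible n) : Fintype.card (D.VSocket n) = D.numEdges n := by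
  have h1 : Fintype.card (D.VSocket n) = ∑ t, D.numVN n t * D.q t := by
    simp [Fintype.card_sigma, Fintype.sum_sigma]
  have hl := D.lamInt_pos
  have hs : (0 : ℝ) < D.s := by exact_mod_cast D.s_pos
  have h2 : ((∑ t, D.numVN n t * D.q t : ℕ) : ℝ) = (D.numEdges n : ℝ) := by
    rw [numEdges]
    push_cast
    rw [hn.2.2, rhoInt_eq]
    have : ∀ t, (D.numVN n t : ℝ) * D.q t = n / D.lamInt * D.lam t := by
      intro t
      have hq : (0 : ℝ) < D.q t := by exact_mod_cast D.q_pos t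
      rw [hn.2.1 t, delta]
      field_simp
    simp_rw [this]
    have hsum : ∑ t, (D.lam t : ℝ) = 1 := by exact_mod_cast congrArg (Rat.cast : ℚ → ℝ) D.lam_sum
    rw [← Finset.mul_sum, hsum]
    field_simp
  rw [h1]
  exact_mod_cast h2

/-- The profiles of the configurations that contribute to codewords of weight `w`. -/
def profiles (n w : ℕ) : Set (D.Sym → ℕ) := by
  classical
  exact {N | (∀ k, D.classSize n k = ∑ j, if D.symClass j = k then N j else 0) ∧
    ∑ j, N j * D.inWt j = w ∧ ∑ j, N j * D.outWt j = ∑ j, N j * D.chkWt j}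

open Nat in
/-- The contribution of a profile to the expected number of codewords. -/
def profileTerm (n : ℕ) (N : D.Sym → ℕ) : ℝ :=
  ((∏ k, (D.classSize n k)! : ℕ) * (∏ j, D.symMul j ^ N j : ℕ) / (∏ j, (N j)! : ℕ)) *
    (((∑ j, N j * D.chkWt j)! * (D.numEdges n - ∑ j, N j * D.chkWt j)! : ℕ) / (D.numEdges n)! )

theorem le_of_mem_profiles {n w : ℕ} {N : D.Sym → ℕ} (hN : N ∈ D.profiles n w) (j : D.Sym) :
    N j ≤ D.classSize n (D.symClass j) := by
  classical
  have h1 := hN.1 (D.symClass j)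
  rw [h1]
  refine le_trans ?_ (Finset.single_le_sum (fun _ _ => Nat.zero_le _) (Finset.mem_univ j))
  simp

theorem finite_profiles (n w : ℕ) : (D.profiles n w).Finite := by
  classical
  refine (Set.finite_Iic (fun j => D.classSize n (D.symClass j))).subset ?_
  intro N hN j
  exact D.le_of_mem_profiles hN j

/-- Exchange the sums over permutations and configurations. Matching permutations are counted by
`card_equiv_binary`, a number that depends only on the profile, and the configurations of a profile
by `card_configs_mul`. -/
theorem expNum_eq {n : ℕ} (hn : D.Admissible n) (w : ℕ) :
    D.expNum n w = ∑ N ∈ (D.finite_profiles n w).toFinset, D.profileTerm n N := by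
  classical
  have hE : Fintype.card (D.VSocket n) = Fintype.card (D.CSocket n) := by
    rw [D.card_VSocket hn, D.card_CSocket]
  have hcard : Fintype.card (D.VSocket n ≃ D.CSocket n) = (D.numEdges n).factorial := by
    rw [Fintype.card_equiv (Fintype.equivOfCardEq hE), D.card_VSocket hn]
  let prof : D.Config n → D.Sym → ℕ := fun x => profile fun i => D.localSym n i (x i)
  have hin : ∀ x : D.Config n, ∑ i, D.inWt (D.localSym n i (x i)) = ∑ j, prof x j * D.inWt j :=
    fun x => sum_comp_eq_sum_profile (fun i => D.localSym n i (x i)) D.inWt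
  have hout : ∀ x : D.Config n, ∑ i, D.outWt (D.localSym n i (x i)) = ∑ j, prof x j * D.outWt j :=
    fun x => sum_comp_eq_sum_profile (fun i => D.localSym n i (x i)) D.outWt
  have hchk : ∀ x : D.Config n, ∑ i, D.chkWt (D.localSym n i (x i)) = ∑ j, prof x j * D.chkWt j :=
    fun x => sum_comp_eq_sum_profile (fun i => D.localSym n i (x i)) D.chkWt
  have hcls : ∀ (x : D.Config n) k,
      D.classSize n k = ∑ j, if D.symClass j = k then prof x j else 0 := by
    intro x k
    rw [← profile_nodeClass]
    have h1 := sum_comp_eq_sum_profile (fun i => D.localSym n i (x i))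
      (fun j => if D.symClass j = k then 1 else 0)
    simp only [D.symClass_localSym, mul_ite, mul_one, mul_zero] at h1
    rw [← h1, profile, Nat.card_eq_fintype_card, Fintype.card_subtype, Finset.card_filter]
  have hsum : ∑ π : D.VSocket n ≃ D.CSocket n, D.numCodewords n π w =
      ∑ x : D.Config n, if prof x ∈ D.profiles n w then
        (∑ j, prof x j * D.chkWt j).factorial *
          (D.numEdges n - ∑ j, prof x j * D.chkWt j).factorial else 0 := by
    simp_rw [numCodewords_eq]
    rw [sum_card_subtype_comm (fun x : D.Config n => ∑ i, D.inWt (D.localSym n i (x i)) = w)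
      (fun (π : D.VSocket n ≃ D.CSocket n) x => ∀ e, D.cBit n x (π e) = D.vBit n x e),
      Finset.sum_filter]
    refine Finset.sum_congr rfl fun x _ => ?_
    rw [card_equiv_binary hE, card_vBit, card_cBit, hin, hout, hchk, D.card_VSocket hn]
    by_cases h1 : ∑ j, prof x j * D.inWt j = w
    · by_cases h2 : ∑ j, prof x j * D.outWt j = ∑ j, prof x j * D.chkWt j
      · rw [if_pos h1, if_pos h2, if_pos ⟨hcls x, h1, h2⟩, h2]
      · rw [if_pos h1, if_neg h2, if_neg fun h => h2 h.2.2]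
    · rw [if_neg h1, if_neg fun h => h1 h.2.1]
  have hcount : ∀ N ∈ D.profiles n w, ((Finset.univ.filter fun x => prof x = N).card : ℝ) =
      ((∏ k, (D.classSize n k).factorial : ℕ) * (∏ j, D.symMul j ^ N j : ℕ) /
        (∏ j, (N j).factorial : ℕ)) := by
    intro N hN
    have h1 := card_configs_mul (D.localSym n) (D.nodeClass n) D.symClass (D.symClass_localSym n)
      D.symMul (D.card_localSym n) N (fun k => by rw [profile_nodeClass]; exact hN.1 k)
    simp only [profile_nodeClass] at h1
    have h2 : (∏ j, (N j).factorial : ℕ) ≠ 0 :=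
      Finset.prod_ne_zero_iff.2 fun j _ => Nat.factorial_ne_zero _
    rw [eq_div_iff (by exact_mod_cast h2)]
    have h3 : (Finset.univ.filter fun x => prof x = N).card =
        Nat.card {x : D.Config n // ∀ j, profile (fun i => D.localSym n i (x i)) j = N j} := by
      rw [← Fintype.card_subtype, ← Nat.card_eq_fintype_card]
      exact Nat.card_congr (Equiv.subtypeEquivRight fun x => funext_iff)
    rw [h3]
    exact_mod_cast h1
  have hsumR : (∑ π : D.VSocket n ≃ D.CSocket n, (D.numCodewords n π w : ℝ)) =
      ((∑ π : D.VSocket n ≃ D.CSocket n, D.numCodewords n π w : ℕ) : ℝ) := by push_cast; rfl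
  have hexp : D.expNum n w = (∑ π : D.VSocket n ≃ D.CSocket n, (D.numCodewords n π w : ℝ)) /
      Fintype.card (D.VSocket n ≃ D.CSocket n) := by
    unfold expNum
    congr!
  rw [hexp, hsumR, hsum, hcard, ← Finset.sum_filter,
    ← Finset.sum_fiberwise_of_maps_to (t := (D.finite_profiles n w).toFinset) (g := prof)
      (fun x hx => by simpa using hx)]
  push_cast
  rw [Finset.sum_div]
  refine Finset.sum_congr rfl fun N hN => ?_
  have hN' : N ∈ D.profiles n w := by simpa using hN
  have hfil : (Finset.univ.filter fun x => prof x ∈ D.profiles n w).filter (fun x => prof x = N) =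
      Finset.univ.filter fun x => prof x = N := by
    ext x
    simp only [Finset.mem_filter, Finset.mem_univ, true_and, and_iff_right_iff_imp]
    rintro rfl
    exact hN'
  rw [hfil, Finset.sum_congr rfl (g := fun _ => (((∑ j, N j * D.chkWt j).factorial *
    (D.numEdges n - ∑ j, N j * D.chkWt j).factorial : ℕ) : ℝ)) (fun x hx => by
      rw [(Finset.mem_filter.1 hx).2]; push_cast; rfl), Finset.sum_const, nsmul_eq_mul,
    hcount N hN', profileTerm, mul_div_assoc]

end DGLDPC

end

/-! ### Stirling's formula and the exponent of a profile -/

noncomputable section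

/-- A weak form of the Stirling formula. -/
theorem log_factorial_bounds (n : ℕ) :
    0 ≤ Real.log (n.factorial : ℝ) + Real.negMulLog n + n ∧
      Real.log (n.factorial : ℝ) + Real.negMulLog n + n ≤ Real.log n + 1 := by
  induction n with
  | zero => simp
  | succ n ih =>
    rcases Nat.eq_zero_or_pos n with rfl | hn
    · simp
    · have hn0 : (0 : ℝ) < n := by exact_mod_cast hn
      have hn1 : (0 : ℝ) < (n : ℝ) + 1 := by positivity
      have hq : 0 < ((n : ℝ) + 1) / n := by positivity
      have hlog : Real.log (((n : ℝ) + 1) / n) = Real.log (n + 1) - Real.log n :=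
        Real.log_div hn1.ne' hn0.ne'
      have h1 := Real.log_le_sub_one_of_pos hq
      have h2 := Real.one_sub_inv_le_log_of_pos hq
      rw [hlog] at h1 h2
      -- This and the next inequality say that the remainder grows by an amount between `0` and `log
      -- (n + 1) - log n`.
      have h1' : n * (Real.log (n + 1) - Real.log n) ≤ 1 := by
        have := mul_le_mul_of_nonneg_left h1 hn0.le
        have e : (n : ℝ) * (((n : ℝ) + 1) / n - 1) = 1 := by field_simp; ring
        linarith
      have h2' : 1 ≤ (n + 1) * (Real.log (n + 1) - Real.log n) := by
        have := mul_le_mul_of_nonneg_left h2 hn1.le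
        have e : ((n : ℝ) + 1) * (1 - (((n : ℝ) + 1) / n)⁻¹) = 1 := by field_simp; ring
        linarith
      rw [Nat.factorial_succ]
      push_cast
      rw [Real.log_mul hn1.ne' (by positivity)]
      simp only [Real.negMulLog] at ih ⊢
      constructor <;> nlinarith [ih.1, ih.2]

namespace DGLDPC

variable {ι : Type*} [Fintype ι] (D : DGLDPC ι)

open Classical in
/-- The statistics of a profile: the class sizes, the weight of the word, and the difference of the
weights at the two ends of the edges. -/
def statG : Option ι ⊕ Fin 2 → D.Sym → ℤ :=
  Sum.elim (fun k j => if D.symClass j = k then 1 else 0)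
    ![fun j => D.inWt j, fun j => D.outWt j - D.chkWt j]

/-- The number of nodes of each class per VN. -/
def density : Option ι → ℝ
  | some t => D.delta t
  | none => D.cnRatio

/-- The statistics of the normalized profiles of the configurations of weight `α n`. -/
def target (α : ℝ) : Option ι ⊕ Fin 2 → ℝ := Sum.elim D.density ![α, 0]

open Classical in
/-- The mass of a class of symbols. -/
def mass (x : D.Sym → ℝ) (k : Option ι) : ℝ := ∑ j, if D.symClass j = k then x j else 0

/-- The weight of the CN codewords. -/
def chkSum (x : D.Sym → ℝ) : ℝ := ∑ j, x j * D.chkWt j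

/-- The exponent of the contribution of a profile to the expected number of codewords. -/
def exponent (x : D.Sym → ℝ) : ℝ :=
  ∑ j, (Real.negMulLog (x j) + x j * Real.log (D.symMul j)) - ∑ k, Real.negMulLog (D.mass x k) +
    (Real.negMulLog (D.mass x none * D.s) - Real.negMulLog (D.chkSum x) -
      Real.negMulLog (D.mass x none * D.s - D.chkSum x))

theorem mem_polySet_statG {c : Option ι → ℝ} {a b : ℝ} {x : D.Sym → ℝ} :
    x ∈ polySet D.statG (Sum.elim c ![a, b]) ↔ (∀ j, 0 ≤ x j) ∧ (∀ k, D.mass x k = c k) ∧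
      ∑ j, x j * D.inWt j = a ∧ ∑ j, x j * D.outWt j - D.chkSum x = b := by
  have h1 : ∑ j, x j * (D.outWt j : ℝ) - D.chkSum x =
      ∑ j, ((D.outWt j : ℝ) - D.chkWt j) * x j := by
    rw [chkSum, ← Finset.sum_sub_distrib]
    exact Finset.sum_congr rfl fun j _ => by ring
  rw [h1]
  refine and_congr_right fun _ => ?_
  rw [Sum.forall, Fin.forall_fin_two]
  refine and_congr (forall_congr' fun k => ?_) (and_congr ?_ ?_)
  · simp only [statG, mass, Sum.elim_inl, Int.cast_ite, Int.cast_one, Int.cast_zero, ite_mul,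
      one_mul, zero_mul]
  · simp only [statG, Sum.elim_inr, Matrix.cons_val_zero, Int.cast_natCast]
    rw [Finset.sum_congr rfl fun j _ => mul_comm (D.inWt j : ℝ) (x j)]
  · simp only [statG, Sum.elim_inr, Matrix.cons_val_one, Matrix.cons_val_zero, Int.cast_sub,
      Int.cast_natCast]

theorem sum_mass (x : D.Sym → ℝ) : ∑ k, D.mass x k = ∑ j, x j := by
  classical
  unfold mass
  rw [Finset.sum_comm]
  simp

theorem continuous_mass (k : Option ι) : Continuous fun x => D.mass x k := by
  classical
  unfold mass
  refine continuous_finsetSum _ fun j _ => ?_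
  split_ifs
  · exact continuous_apply j
  · exact continuous_const

theorem continuous_chkSum : Continuous D.chkSum := by
  unfold chkSum
  fun_prop

theorem continuous_exponent : Continuous D.exponent := by
  unfold exponent
  have h := D.continuous_mass none
  have h' := D.continuous_chkSum
  refine ((continuous_finsetSum _ fun j _ => ?_).sub (continuous_finsetSum _ fun k _ => ?_)).add
    (Continuous.sub (Continuous.sub ?_ ?_) ?_)
  · exact (Real.continuous_negMulLog.comp (continuous_apply j)).add (by fun_prop)
  · exact Real.continuous_negMulLog.comp (D.continuous_mass k)
  · exact Real.continuous_negMulLog.comp (by fun_prop)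
  · exact Real.continuous_negMulLog.comp h'
  · exact Real.continuous_negMulLog.comp (by fun_prop)

theorem mass_smul (c : ℝ) (x : D.Sym → ℝ) (k : Option ι) :
    D.mass (fun j => c * x j) k = c * D.mass x k := by
  classical
  simp only [mass, Finset.mul_sum, mul_ite, mul_zero]

theorem chkSum_smul (c : ℝ) (x : D.Sym → ℝ) : D.chkSum (fun j => c * x j) = c * D.chkSum x := by
  simp only [chkSum, Finset.mul_sum, mul_assoc]

/-- The class masses add up to the total mass, and the ones and zeros add up to all edges, so the
terms in `log c` cancel. This permits normalizing profiles by `n`. -/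
theorem exponent_smul (c : ℝ) (x : D.Sym → ℝ) :
    D.exponent (fun j => c * x j) = c * D.exponent x := by
  unfold exponent
  simp only [mass_smul, chkSum_smul, mul_assoc, ← mul_sub]
  simp only [Real.negMulLog_mul c, Finset.sum_add_distrib, ← Finset.sum_mul, ← Finset.mul_sum,
    D.sum_mass]
  ring

/-! ### Size bounds -/

/-- A bound on the numbers of nodes of each class and of edges per VN. -/
def sizeBound : ℝ := 1 + ∑ k, D.density k + D.cnRatio * D.s

theorem density_pos (k : Option ι) : 0 < D.density k := by
  rcases k with _ | t
  · exact D.cnRatio_pos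
  · exact D.delta_pos t

theorem density_le_sizeBound (k : Option ι) : D.density k ≤ D.sizeBound := by
  have h1 := Finset.single_le_sum (fun k _ => (D.density_pos k).le) (Finset.mem_univ k)
  have h2 := D.cnRatio_pos
  have h3 : 0 ≤ D.cnRatio * D.s := by positivity
  unfold sizeBound
  linarith

theorem one_le_sizeBound : 1 ≤ D.sizeBound := by
  have h1 : 0 ≤ ∑ k, D.density k := Finset.sum_nonneg fun k _ => (D.density_pos k).le
  have h2 := D.cnRatio_pos
  have h3 : 0 ≤ D.cnRatio * D.s := by positivity
  unfold sizeBound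
  linarith

theorem classSize_eq {n : ℕ} (hn : D.Admissible n) (k : Option ι) :
    (D.classSize n k : ℝ) = n * D.density k := by
  rcases k with _ | t
  · exact hn.2.2
  · exact hn.2.1 t

theorem classSize_le {n : ℕ} (hn : D.Admissible n) (k : Option ι) :
    (D.classSize n k : ℝ) ≤ D.sizeBound * n := by
  rw [D.classSize_eq hn, mul_comm]
  exact mul_le_mul_of_nonneg_right (D.density_le_sizeBound k) (Nat.cast_nonneg n)

theorem numEdges_le {n : ℕ} (hn : D.Admissible n) : (D.numEdges n : ℝ) ≤ D.sizeBound * n := by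
  have h1 : (D.numEdges n : ℝ) = D.cnRatio * D.s * n := by
    have := D.classSize_eq hn none
    simp only [classSize, density] at this
    rw [numEdges]
    push_cast
    rw [this]
    ring
  rw [h1]
  refine mul_le_mul_of_nonneg_right ?_ (Nat.cast_nonneg n)
  have h1 : 0 ≤ ∑ k, D.density k := Finset.sum_nonneg fun k _ => (D.density_pos k).le
  unfold sizeBound
  linarith

theorem mass_natCast {n w : ℕ} {N : D.Sym → ℕ} (hN : N ∈ D.profiles n w) (k : Option ι) :
    D.mass (fun j => (N j : ℝ)) k = D.classSize n k := by
  classical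
  rw [hN.1 k, mass]
  push_cast
  rfl

theorem chkSum_natCast (N : D.Sym → ℕ) :
    D.chkSum (fun j => (N j : ℝ)) = ((∑ j, N j * D.chkWt j : ℕ) : ℝ) := by
  rw [chkSum]
  push_cast
  rfl

theorem chk_le_numEdges {n w : ℕ} {N : D.Sym → ℕ} (hN : N ∈ D.profiles n w) :
    ∑ j, N j * D.chkWt j ≤ D.numEdges n := by
  classical
  have h := hN.1 none
  simp only [classSize] at h
  rw [numEdges, h, Finset.sum_mul]
  refine Finset.sum_le_sum fun j _ => ?_
  rcases j with s | s
  · simp [chkWt]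
  · simp only [symClass, Sum.elim_inr, if_true, chkWt]
    exact Nat.mul_le_mul_left _ (Nat.lt_succ_iff.1 s.1.2)

/-- The error in the exponential approximation of the contribution of a profile. -/
def termError (n : ℕ) : ℝ :=
  (Fintype.card (Option ι) + Fintype.card D.Sym + 3) * (Real.log (D.sizeBound * n + 1) + 1)

theorem symMul_pos (j : D.Sym) : 0 < D.symMul j := by
  rcases j with s | s
  · exact s.2.2
  · exact s.2

theorem profileTerm_pos (n : ℕ) (N : D.Sym → ℕ) : 0 < D.profileTerm n N := by
  have h1 : 0 < ∏ k, (D.classSize n k).factorial :=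
    Finset.prod_pos fun k _ => Nat.factorial_pos _
  have h2 : 0 < ∏ j, D.symMul j ^ N j := Finset.prod_pos fun j _ => pow_pos (D.symMul_pos j) _
  have h3 : 0 < ∏ j, (N j).factorial := Finset.prod_pos fun k _ => Nat.factorial_pos _
  have h4 := Nat.factorial_pos (∑ j, N j * D.chkWt j)
  have h5 := Nat.factorial_pos (D.numEdges n - ∑ j, N j * D.chkWt j)
  have h6 := Nat.factorial_pos (D.numEdges n)
  unfold profileTerm
  positivity

/-- The contribution of a profile is its exponential up to a factor of polynomial size. -/
theorem abs_log_profileTerm_sub_le {n w : ℕ} (hn : D.Admissible n) {N : D.Sym → ℕ}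
    (hN : N ∈ D.profiles n w) :
    |Real.log (D.profileTerm n N) - D.exponent (fun j => (N j : ℝ))| ≤ D.termError n := by
  set l := ∑ j, N j * D.chkWt j with hl
  set E := D.numEdges n with hE
  have hlE : l ≤ E := D.chk_le_numEdges hN
  set L := Real.log (D.sizeBound * n + 1) + 1 with hL
  let rem : ℕ → ℝ := fun m => Real.log (m.factorial : ℝ) + Real.negMulLog m + m
  have hrem : ∀ m : ℕ, (m : ℝ) ≤ D.sizeBound * n → |rem m| ≤ L := by
    intro m hm
    obtain ⟨h0, h1⟩ := log_factorial_bounds m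
    rw [abs_of_nonneg h0]
    refine h1.trans ?_
    rw [hL]
    gcongr ?_ + 1
    rcases Nat.eq_zero_or_pos m with rfl | hm0
    · simp only [Nat.cast_zero, Real.log_zero]
      exact Real.log_nonneg (by simpa using hm)
    · exact Real.log_le_log (by exact_mod_cast hm0) (by linarith)
  have hlog : Real.log (D.profileTerm n N) =
      ∑ k, Real.log ((D.classSize n k).factorial : ℝ) + ∑ j, (N j : ℝ) * Real.log (D.symMul j) -
        ∑ j, Real.log ((N j).factorial : ℝ) + (Real.log (l.factorial : ℝ) +
          Real.log ((E - l).factorial : ℝ) - Real.log (E.factorial : ℝ)) := by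
    have hf : ∀ m : ℕ, (m.factorial : ℝ) ≠ 0 := fun m => by exact_mod_cast m.factorial_ne_zero
    have hc : ∀ j, (D.symMul j : ℝ) ≠ 0 := fun j => by exact_mod_cast (D.symMul_pos j).ne'
    have hp1 : ∏ k, ((D.classSize n k).factorial : ℝ) ≠ 0 := Finset.prod_ne_zero_iff.2 fun k _ => hf _
    have hp2 : ∏ j, (D.symMul j : ℝ) ^ N j ≠ 0 :=
      Finset.prod_ne_zero_iff.2 fun j _ => pow_ne_zero _ (hc j)
    have hp3 : ∏ j, ((N j).factorial : ℝ) ≠ 0 := Finset.prod_ne_zero_iff.2 fun k _ => hf _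
    rw [profileTerm, ← hl, ← hE]
    push_cast
    rw [Real.log_mul (div_ne_zero (mul_ne_zero hp1 hp2) hp3)
      (div_ne_zero (mul_ne_zero (hf _) (hf _)) (hf _)), Real.log_div (mul_ne_zero hp1 hp2) hp3,
      Real.log_mul hp1 hp2, Real.log_div (mul_ne_zero (hf _) (hf _)) (hf _),
      Real.log_mul (hf _) (hf _), Real.log_prod fun k _ => hf _,
      Real.log_prod fun j _ => pow_ne_zero _ (hc j), Real.log_prod fun j _ => hf _]
    simp only [Real.log_pow]
  have hmass := D.mass_natCast hN
  -- With this and `l + (E - l) = E`, the linear terms of Stirling's formula cancel.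
  have hsum : ∑ k, (D.classSize n k : ℝ) = ∑ j, (N j : ℝ) := by
    rw [← D.sum_mass (fun j => (N j : ℝ))]
    exact Finset.sum_congr rfl fun k _ => (hmass k).symm
  have hedge : D.mass (fun j => (N j : ℝ)) none * D.s = E := by
    rw [hmass, hE, numEdges]
    push_cast
    rfl
  have hdiff : Real.log (D.profileTerm n N) - D.exponent (fun j => (N j : ℝ)) =
      ∑ k, rem (D.classSize n k) - ∑ j, rem (N j) + (rem l + rem (E - l) - rem E) := by
    rw [hlog, exponent, hedge, chkSum_natCast, ← hl, ← Nat.cast_sub hlE]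
    simp only [hmass, rem, Finset.sum_add_distrib, hsum]
    rw [Nat.cast_sub hlE]
    ring
  have hE1 := D.numEdges_le hn
  have hl1 : (l : ℝ) ≤ D.sizeBound * n := le_trans (by exact_mod_cast hlE) hE1
  have hE2 : ((E - l : ℕ) : ℝ) ≤ D.sizeBound * n :=
    le_trans (by exact_mod_cast Nat.sub_le E l) hE1
  have b1 : |∑ k, rem (D.classSize n k)| ≤ Fintype.card (Option ι) * L := by
    refine (Finset.abs_sum_le_sum_abs _ _).trans ?_
    refine (Finset.sum_le_sum fun k _ => hrem _ (D.classSize_le hn k)).trans ?_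
    rw [Finset.sum_const, Finset.card_univ, nsmul_eq_mul]
  have b2 : |∑ j, rem (N j)| ≤ Fintype.card D.Sym * L := by
    refine (Finset.abs_sum_le_sum_abs _ _).trans ?_
    refine (Finset.sum_le_sum fun j _ => hrem _ (le_trans ?_ (D.classSize_le hn
      (D.symClass j)))).trans ?_
    · exact_mod_cast D.le_of_mem_profiles hN j
    · rw [Finset.sum_const, Finset.card_univ, nsmul_eq_mul]
  have b3 := abs_le.1 (hrem l hl1)
  have b4 := abs_le.1 (hrem _ hE2)
  have b5 := abs_le.1 (hrem E hE1)
  have b1' := abs_le.1 b1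
  have b2' := abs_le.1 b2
  rw [hdiff, termError, ← hL, abs_le]
  constructor <;> nlinarith [b1'.1, b1'.2, b2'.1, b2'.2, b3.1, b3.2, b4.1, b4.2, b5.1, b5.2]

theorem normalize_mem {n w : ℕ} (hn : D.Admissible n) {N : D.Sym → ℕ} (hN : N ∈ D.profiles n w) :
    (fun j => (n : ℝ)⁻¹ * (N j : ℝ)) ∈ polySet D.statG (D.target ((w : ℝ) / n)) := by
  have hn0 : (0 : ℝ) < n := by exact_mod_cast hn.1
  rw [target, mem_polySet_statG]
  refine ⟨fun j => by positivity, fun k => ?_, ?_, ?_⟩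
  · rw [mass_smul, D.mass_natCast hN, D.classSize_eq hn]
    field_simp
  · have h : ∑ j, (N j : ℝ) * D.inWt j = w := by exact_mod_cast hN.2.1
    simp only [mul_assoc, ← Finset.mul_sum]
    rw [h, inv_mul_eq_div]
  · have h : ∑ j, (N j : ℝ) * D.outWt j = ∑ j, (N j : ℝ) * D.chkWt j := by exact_mod_cast hN.2.2
    rw [chkSum_smul, chkSum]
    simp only [mul_assoc, ← Finset.mul_sum]
    rw [h, sub_self]

theorem exponent_natCast {n : ℕ} (hn : 0 < n) (N : D.Sym → ℕ) :
    D.exponent (fun j => (N j : ℝ)) = n * D.exponent (fun j => (n : ℝ)⁻¹ * (N j : ℝ)) := by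
  have hn0 : (n : ℝ) ≠ 0 := by exact_mod_cast hn.ne'
  rw [exponent_smul, ← mul_assoc, mul_inv_cancel₀ hn0, one_mul]

theorem bounded_statG {α : ℝ} :
    ∀ x ∈ polySet D.statG (D.target α), ∀ j, x j ≤ (fun j => D.density (D.symClass j)) j := by
  classical
  intro x hx j
  obtain ⟨h0, h1, -⟩ := D.mem_polySet_statG.1 hx
  dsimp only
  rw [← h1, mass]
  refine le_trans ?_ (Finset.single_le_sum (fun i _ => ?_) (Finset.mem_univ j))
  · simp
  · split_ifs
    exacts [h0 i, le_rfl]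

/-- The maximal exponent of the profiles of weight `α n`. -/
def maxExponent (α : ℝ) : ℝ := valueFn D.statG D.exponent (D.target α)

theorem continuousOn_maxExponent :
    ContinuousOn D.maxExponent {α | (polySet D.statG (D.target α)).Nonempty} := by
  have h := continuousOn_valueFn (T := D.statG) D.continuous_exponent
    (Dom := D.target '' {α | (polySet D.statG (D.target α)).Nonempty})
    (M := fun j => D.density (D.symClass j))
    (by rintro _ ⟨α, -, rfl⟩; exact D.bounded_statG)
    (by rintro _ ⟨α, hα, rfl⟩; exact hα)
  refine h.comp (f := D.target) ?_ (Set.mapsTo_image _ _)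
  refine Continuous.continuousOn (continuous_pi fun r => ?_)
  rcases r with k | i
  · exact continuous_const
  · fin_cases i
    · exact continuous_id
    · exact continuous_const

theorem expNum_pos_iff {n w : ℕ} (hn : D.Admissible n) :
    0 < D.expNum n w ↔ (D.profiles n w).Nonempty := by
  rw [D.expNum_eq hn]
  constructor
  · intro h
    by_contra hne
    rw [Set.not_nonempty_iff_eq_empty] at hne
    rw [show (D.finite_profiles n w).toFinset = ∅ by simpa using hne] at h
    simp at h
  · rintro ⟨N, hN⟩
    exact Finset.sum_pos (fun N _ => D.profileTerm_pos n N) ⟨N, by simpa using hN⟩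

theorem card_profiles_le {n w : ℕ} (hn : D.Admissible n) :
    ((D.finite_profiles n w).toFinset.card : ℝ) ≤ (D.sizeBound * n + 1) ^ Fintype.card D.Sym := by
  classical
  have hsub : (D.finite_profiles n w).toFinset ⊆
      Fintype.piFinset fun j => Finset.range (D.classSize n (D.symClass j) + 1) := by
    intro N hN
    rw [Fintype.mem_piFinset]
    intro j
    rw [Finset.mem_range, Nat.lt_succ_iff]
    exact D.le_of_mem_profiles (by simpa using hN) j
  have h1 := Finset.card_le_card hsub
  rw [Fintype.card_piFinset] at h1
  have h2 : ((D.finite_profiles n w).toFinset.card : ℝ) ≤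
      ∏ j, ((D.classSize n (D.symClass j) : ℝ) + 1) := by
    have := (Nat.cast_le (α := ℝ)).2 h1
    simpa using this
  refine h2.trans ?_
  rw [← Finset.card_univ, ← Finset.prod_const]
  exact Finset.prod_le_prod (fun j _ => by positivity)
    fun j _ => by linarith [D.classSize_le hn (D.symClass j)]

/-! ### Exponential bounds on the expectation and their limit -/

/-- The upper bound for the expected weight distribution. -/
theorem log_expNum_le {n w : ℕ} (hn : D.Admissible n) (hpos : 0 < D.expNum n w) :
    1 / (n : ℝ) * Real.log (D.expNum n w) ≤ D.maxExponent ((w : ℝ) / n) +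
      (D.termError n + Fintype.card D.Sym * Real.log (D.sizeBound * n + 1)) / n := by
  have hn0 : (0 : ℝ) < n := by exact_mod_cast hn.1
  have hb : 0 < D.sizeBound * n + 1 := by
    have := D.one_le_sizeBound
    positivity
  have hterm : ∀ N ∈ (D.finite_profiles n w).toFinset, D.profileTerm n N ≤
      Real.exp (n * D.maxExponent ((w : ℝ) / n) + D.termError n) := by
    intro N hN
    have hN' : N ∈ D.profiles n w := by simpa using hN
    rw [← Real.log_le_iff_le_exp (D.profileTerm_pos n N)]
    have h1 := (abs_le.1 (D.abs_log_profileTerm_sub_le hn hN')).2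
    have h2 := le_valueFn D.continuous_exponent D.bounded_statG (D.normalize_mem hn hN')
    have h3 := mul_le_mul_of_nonneg_left h2 hn0.le
    rw [← D.exponent_natCast hn.1] at h3
    have h4 : (n : ℝ) * valueFn D.statG D.exponent (D.target ((w : ℝ) / n)) =
      n * D.maxExponent ((w : ℝ) / n) := rfl
    linarith
  have h1 : D.expNum n w ≤ (D.sizeBound * n + 1) ^ Fintype.card D.Sym *
      Real.exp (n * D.maxExponent ((w : ℝ) / n) + D.termError n) := by
    rw [D.expNum_eq hn]
    refine (Finset.sum_le_card_nsmul _ _ _ hterm).trans ?_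
    rw [nsmul_eq_mul]
    exact mul_le_mul_of_nonneg_right (D.card_profiles_le hn) (Real.exp_pos _).le
  have h2 := Real.log_le_log hpos h1
  rw [Real.log_mul (pow_pos hb _).ne' (Real.exp_ne_zero _), Real.log_exp, Real.log_pow] at h2
  rw [one_div, inv_mul_le_iff₀ hn0]
  have h3 : (n : ℝ) * (D.maxExponent ((w : ℝ) / n) +
      (D.termError n + Fintype.card D.Sym * Real.log (D.sizeBound * n + 1)) / n) =
      n * D.maxExponent ((w : ℝ) / n) +
      (D.termError n + Fintype.card D.Sym * Real.log (D.sizeBound * n + 1)) := by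
    field_simp
  rw [h3]
  linarith

/-- The lower bound for the expected weight distribution given by one profile. -/
theorem le_log_expNum {n w : ℕ} (hn : D.Admissible n) {N : D.Sym → ℕ} (hN : N ∈ D.profiles n w) :
    D.exponent (fun j => (n : ℝ)⁻¹ * (N j : ℝ)) - D.termError n / n ≤
      1 / (n : ℝ) * Real.log (D.expNum n w) := by
  have hn0 : (0 : ℝ) < n := by exact_mod_cast hn.1
  have h1 : D.profileTerm n N ≤ D.expNum n w := by
    rw [D.expNum_eq hn]
    exact Finset.single_le_sum (fun N _ => (D.profileTerm_pos n N).le) (by simpa using hN)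
  have h2 := Real.log_le_log (D.profileTerm_pos n N) h1
  have h3 := (abs_le.1 (D.abs_log_profileTerm_sub_le hn hN)).1
  rw [D.exponent_natCast hn.1] at h3
  rw [one_div, ← div_eq_inv_mul, le_div_iff₀ hn0, sub_mul, div_mul_cancel₀ _ hn0.ne']
  linarith

theorem tendsto_log_div (c : ℝ) (hc : 0 < c) :
    Tendsto (fun n : ℕ => Real.log (c * n + 1) / n) atTop (𝓝 0) := by
  have h1 : Tendsto (fun x : ℝ => Real.log x / x) atTop (𝓝 0) :=
    Real.isLittleO_log_id_atTop.tendsto_div_nhds_zero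
  have h2 : Tendsto (fun n : ℕ => c * (n : ℝ) + 1) atTop atTop :=
    tendsto_atTop_add_const_right _ _ (tendsto_natCast_atTop_atTop.const_mul_atTop hc)
  have h3 : Tendsto (fun n : ℕ => (c * (n : ℝ) + 1) / n) atTop (𝓝 c) := by
    have h4 : Tendsto (fun n : ℕ => c + 1 / (n : ℝ)) atTop (𝓝 (c + 0)) :=
      tendsto_const_nhds.add tendsto_one_div_atTop_nhds_zero_nat
    rw [add_zero] at h4
    refine h4.congr' ?_
    filter_upwards [eventually_gt_atTop 0] with n hn
    have : (n : ℝ) ≠ 0 := by exact_mod_cast hn.ne'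
    field_simp
  have h5 := (h1.comp h2).mul h3
  rw [zero_mul] at h5
  refine h5.congr' ?_
  filter_upwards [eventually_gt_atTop 0] with n hn
  have hn0 : (0 : ℝ) < n := by exact_mod_cast hn
  have : c * (n : ℝ) + 1 ≠ 0 := by positivity
  simp only [Function.comp]
  field_simp

theorem tendsto_termError_div : Tendsto (fun n : ℕ => D.termError n / n) atTop (𝓝 0) := by
  have hb : 0 < D.sizeBound := by linarith [D.one_le_sizeBound]
  have h := ((tendsto_log_div _ hb).add tendsto_one_div_atTop_nhds_zero_nat).const_mul
    ((Fintype.card (Option ι) : ℝ) + Fintype.card D.Sym + 3)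
  simp only [add_zero, mul_zero] at h
  refine h.congr fun n => ?_
  rw [termError]
  ring

theorem eventually_growthFilter (α : ℝ) : ∀ᶠ p in D.growthFilter α,
    D.Admissible p.1 ∧ 0 < D.expNum p.1 p.2 :=
  (le_principal_iff.1 inf_le_right : _ ∈ D.growthFilter α)

theorem tendsto_fst_growthFilter (α : ℝ) : Tendsto Prod.fst (D.growthFilter α) atTop :=
  tendsto_comap.mono_left (inf_le_left.trans inf_le_left)

theorem tendsto_div_growthFilter (α : ℝ) :
    Tendsto (fun p : ℕ × ℕ => (p.2 : ℝ) / p.1) (D.growthFilter α) (𝓝 α) :=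
  tendsto_comap.mono_left (inf_le_left.trans inf_le_right)

/-- The upper bound passes to the limit by continuity of `maxExponent`. For the lower bound, one
integer profile close to the scaled real maximizer suffices. -/
theorem tendsto_log_expNum {α : ℝ} (hα : (polySet D.statG (D.target α)).Nonempty) :
    Tendsto (fun p : ℕ × ℕ => 1 / (p.1 : ℝ) * Real.log (D.expNum p.1 p.2)) (D.growthFilter α)
      (𝓝 (D.maxExponent α)) := by
  classical
  have hb : 0 < D.sizeBound := by linarith [D.one_le_sizeBound]
  have hfst := D.tendsto_fst_growthFilter α
  have hdiv := D.tendsto_div_growthFilter α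
  have hev := D.eventually_growthFilter α
  have herr := D.tendsto_termError_div.comp hfst
  refine tendsto_order.2 ⟨fun a ha => ?_, fun a ha => ?_⟩
  · obtain ⟨x, hx, hxv⟩ := exists_eq_valueFn D.continuous_exponent D.bounded_statG hα
    change D.exponent x = D.maxExponent α at hxv
    obtain ⟨K, hK, hH⟩ := exists_hoffman_nat D.statG
    set ε := (D.maxExponent α - a) / 2 with hε
    have hε0 : 0 < ε := by rw [hε]; linarith
    obtain ⟨δ, hδ, hcont⟩ := Metric.continuousAt_iff.1 (D.continuous_exponent.continuousAt (x := x))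
      ε hε0
    have hinv : Tendsto (fun p : ℕ × ℕ => 1 / (p.1 : ℝ)) (D.growthFilter α) (𝓝 0) :=
      tendsto_one_div_atTop_nhds_zero_nat.comp hfst
    have hclose : Tendsto (fun p : ℕ × ℕ => K * (1 / (p.1 : ℝ) + |α - (p.2 : ℝ) / p.1|))
        (D.growthFilter α) (𝓝 0) := by
      have h1 : Tendsto (fun p : ℕ × ℕ => |α - (p.2 : ℝ) / p.1|) (D.growthFilter α) (𝓝 0) := by
        have := (hdiv.const_sub α).abs
        simpa using this
      simpa using (hinv.add h1).const_mul K
    filter_upwards [hev, hclose.eventually (gt_mem_nhds hδ),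
      herr.eventually (gt_mem_nhds hε0)] with p hp hp1 hp2
    obtain ⟨n, w⟩ := p
    dsimp only at hp hp1 hp2 ⊢
    have hn := hp.1
    have hn0 : (0 : ℝ) < n := by exact_mod_cast hn.1
    -- Positivity of the expectation supplies one integer profile with the exact statistics, which
    -- removes divisibility obstructions. The profile `N` near `n * x` shares the statistics of `M`.
    obtain ⟨M, hM⟩ := (D.expNum_pos_iff hn).1 hp.2
    obtain ⟨N, hNT, hNd⟩ := hH (fun j => n * x j) M (fun j => mul_nonneg hn0.le (hx.1 j))
    -- the statistics of the two profiles
    have hMstat : (fun j => (M j : ℝ)) ∈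
        polySet D.statG (Sum.elim (fun k => (D.classSize n k : ℝ)) ![(w : ℝ), 0]) := by
      rw [mem_polySet_statG]
      refine ⟨fun j => Nat.cast_nonneg _, fun k => D.mass_natCast hM k, by exact_mod_cast hM.2.1, ?_⟩
      rw [chkSum, sub_eq_zero]
      exact_mod_cast hM.2.2
    have hNstat : (fun j => (N j : ℝ)) ∈
        polySet D.statG (Sum.elim (fun k => (D.classSize n k : ℝ)) ![(w : ℝ), 0]) :=
      ⟨fun j => Nat.cast_nonneg _, fun r => (hNT r).trans (hMstat.2 r)⟩
    have hN : N ∈ D.profiles n w := by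
      obtain ⟨-, h1, h2, h3⟩ := D.mem_polySet_statG.1 hNstat
      refine ⟨fun k => ?_, by exact_mod_cast h2, ?_⟩
      · have := (h1 k).symm
        rw [mass] at this
        exact_mod_cast this
      · rw [chkSum, sub_eq_zero] at h3
        exact_mod_cast h3
    -- Class sizes are exactly `n` times the densities and the edge weights balance, so only the
    -- weight of the word contributes, with an error that is `o(n)`.
    have hdist : ∑ r, |∑ j, (D.statG r j : ℝ) * (n * x j) - ∑ j, (D.statG r j : ℝ) * (M j : ℝ)| =
        |n * α - w| := by
      have h1 : ∀ r, ∑ j, (D.statG r j : ℝ) * (n * x j) = n * D.target α r := by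
        intro r
        rw [← hx.2 r, Finset.mul_sum]
        exact Finset.sum_congr rfl fun j _ => by ring
      simp_rw [h1, hMstat.2]
      rw [Fintype.sum_sum_type, Fin.sum_univ_two]
      simp [target, D.classSize_eq hn]
    have hclose' : dist (fun j => (n : ℝ)⁻¹ * (N j : ℝ)) x < δ := by
      refine (dist_pi_lt_iff hδ).2 fun j => ?_
      have h1 := hNd j
      rw [hdist] at h1
      rw [Real.dist_eq]
      have h2 : (n : ℝ)⁻¹ * (N j : ℝ) - x j = (n : ℝ)⁻¹ * ((N j : ℝ) - n * x j) := by field_simp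
      rw [h2, abs_mul, abs_of_pos (inv_pos.2 hn0)]
      calc (n : ℝ)⁻¹ * |(N j : ℝ) - n * x j| ≤ (n : ℝ)⁻¹ * (K * (1 + |n * α - w|)) :=
            mul_le_mul_of_nonneg_left h1 (inv_pos.2 hn0).le
        _ = K * (1 / (n : ℝ) + |α - (w : ℝ) / n|) := by
            have h3 : α - (w : ℝ) / n = (n : ℝ)⁻¹ * (n * α - w) := by field_simp
            rw [h3, abs_mul, abs_of_pos (inv_pos.2 hn0)]
            ring
        _ < δ := hp1
    have h4 := hcont hclose'
    rw [Real.dist_eq, hxv] at h4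
    have h5 := D.le_log_expNum hn hN
    have h6 := (abs_lt.1 h4).1
    simp only [Function.comp] at hp2
    have h7 : D.maxExponent α - a = 2 * ε := by rw [hε]; ring
    linarith
  · have hup : Tendsto (fun p : ℕ × ℕ => D.maxExponent ((p.2 : ℝ) / p.1) +
        (D.termError p.1 + Fintype.card D.Sym * Real.log (D.sizeBound * p.1 + 1)) / p.1)
        (D.growthFilter α) (𝓝 (D.maxExponent α)) := by
      have h1 : Tendsto (fun p : ℕ × ℕ => D.maxExponent ((p.2 : ℝ) / p.1)) (D.growthFilter α)
          (𝓝 (D.maxExponent α)) := by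
        refine (D.continuousOn_maxExponent α hα).tendsto.comp (tendsto_nhdsWithin_iff.2 ⟨hdiv, ?_⟩)
        filter_upwards [hev] with p hp
        obtain ⟨M, hM⟩ := (D.expNum_pos_iff hp.1).1 hp.2
        exact ⟨_, D.normalize_mem hp.1 hM⟩
      have h2 := ((tendsto_log_div _ hb).comp hfst).const_mul (Fintype.card D.Sym : ℝ)
      have h3 := h1.add (herr.add h2)
      simp only [mul_zero, add_zero] at h3
      refine h3.congr fun p => ?_
      simp only [Function.comp]
      ring
    filter_upwards [hev, hup.eventually (gt_mem_nhds ha)] with p hp hp1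
    exact (D.log_expNum_le hp.1 hp.2).trans_lt hp1

/-! ### Existence of the pairs of length and weight -/

/-- Rationality of `λ_t` enters here: it turns the class-size constraints into integer equations
after clearing denominators. -/
theorem exists_rat_density (k : Option ι) : ∃ r : ℚ, (r : ℝ) = D.density k := by
  rcases k with _ | t
  · refine ⟨(1 / D.s) / ∑ t, D.lam t / D.q t, ?_⟩
    simp only [density, cnRatio, rhoInt_eq, lamInt_eq]
    push_cast
    rfl
  · refine ⟨D.lam t / (D.q t * ∑ t, D.lam t / D.q t), ?_⟩
    simp only [density, delta, lamInt_eq]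
    push_cast
    rfl

theorem admissible_of_natCast {n : ℕ} (hn : 0 < n) {m : Option ι → ℕ}
    (hm : ∀ k, (m k : ℝ) = n * D.density k) : D.Admissible n ∧ ∀ k, D.classSize n k = m k := by
  have h1 : ∀ t, D.numVN n t = m (some t) := fun t => by
    have := hm (some t)
    simp only [density] at this
    rw [numVN, ← this, Nat.floor_natCast]
  have h2 : D.numCN n = m none := by
    have := hm none
    simp only [density, cnRatio] at this
    rw [numCN, ← this, Nat.floor_natCast]
  refine ⟨⟨hn, fun t => by rw [h1]; exact hm (some t), by rw [h2]; exact hm none⟩, fun k => ?_⟩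
  rcases k with _ | t
  · exact h2
  · exact h1 t

/-- For every `i`, the real solution `i * (x, 1, α)` of a homogeneous integer system in profile,
length and weight lies within a constant of an integer solution. These have lengths tending to
infinity and weight ratios tending to `α`. -/
theorem growthFilter_neBot {α : ℝ} (hα : (polySet D.statG (D.target α)).Nonempty) :
    (D.growthFilter α).NeBot := by
  classical
  obtain ⟨x, hx⟩ := hα
  obtain ⟨hx0, hx1, hx2, hx3⟩ := D.mem_polySet_statG.1 hx
  have hα0 : 0 ≤ α := by
    rw [← hx2]
    exact Finset.sum_nonneg fun j _ => mul_nonneg (hx0 j) (Nat.cast_nonneg _)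
  choose dr hdr using D.exists_rat_density
  -- profiles, number of VNs and weight as the variables of one homogeneous system
  let T : Option ι ⊕ Fin 2 → D.Sym ⊕ Fin 2 → ℤ := Sum.elim
    (fun k => Sum.elim (fun j => if D.symClass j = k then ((dr k).den : ℤ) else 0)
      ![-(dr k).num, 0])
    ![Sum.elim (fun j => (D.inWt j : ℤ)) ![0, -1],
      Sum.elim (fun j => (D.outWt j : ℤ) - D.chkWt j) ![0, 0]]
  have hT : ∀ (y : D.Sym ⊕ Fin 2 → ℝ), (∀ r, ∑ j, (T r j : ℝ) * y j = 0) ↔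
      (∀ k, D.mass (fun j => y (.inl j)) k = y (.inr 0) * D.density k) ∧
      ∑ j, y (.inl j) * D.inWt j = y (.inr 1) ∧
      ∑ j, y (.inl j) * D.outWt j - D.chkSum (fun j => y (.inl j)) = 0 := by
    intro y
    rw [Sum.forall, Fin.forall_fin_two]
    refine and_congr (forall_congr' fun k => ?_) (and_congr ?_ ?_)
    · have hden : ((dr k).den : ℝ) ≠ 0 := by exact_mod_cast (dr k).den_ne_zero
      have hnum : ((dr k).num : ℝ) = (dr k).den * D.density k := by
        rw [← hdr k, mul_comm]
        exact_mod_cast (Rat.mul_den_eq_num (dr k)).symm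
      have h1 : ∑ j, (T (.inl k) j : ℝ) * y j =
          (dr k).den * (D.mass (fun j => y (.inl j)) k - y (.inr 0) * D.density k) := by
        rw [Fintype.sum_sum_type, Fin.sum_univ_two]
        simp only [T, Sum.elim_inl, Sum.elim_inr, mass, Int.cast_ite, Int.cast_natCast,
          Int.cast_zero, ite_mul, zero_mul, Matrix.cons_val_zero, Matrix.cons_val_one,
          Int.cast_neg, hnum, mul_sub, Finset.mul_sum, mul_ite, mul_zero]
        ring
      rw [h1, mul_eq_zero, or_iff_right hden, sub_eq_zero]
    · rw [Fintype.sum_sum_type, Fin.sum_univ_two]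
      simp only [T, Sum.elim_inl, Sum.elim_inr, Matrix.cons_val_zero, Matrix.cons_val_one,
        Int.cast_natCast, Int.cast_zero, zero_mul, zero_add, Int.cast_neg, Int.cast_one]
      rw [neg_one_mul, ← sub_eq_add_neg, sub_eq_zero]
      simp only [mul_comm]
    · rw [Fintype.sum_sum_type, Fin.sum_univ_two, chkSum, ← Finset.sum_sub_distrib]
      simp only [T, Sum.elim_inl, Sum.elim_inr, Matrix.cons_val_zero, Matrix.cons_val_one,
        Int.cast_natCast, Int.cast_zero, zero_mul, add_zero, Int.cast_sub]
      rw [Finset.sum_congr rfl fun j _ => show ((D.outWt j : ℝ) - D.chkWt j) * y (.inl j) =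
        y (.inl j) * D.outWt j - y (.inl j) * D.chkWt j by ring]
  obtain ⟨K, hK, hH⟩ := exists_hoffman_nat T
  -- The system being homogeneous, zero is the integer point that the rounding requires.
  have hz : ∀ r, ∑ j, (T r j : ℝ) * ((0 : ℕ) : ℝ) = 0 := fun r => by simp
  have hseq : ∀ i : ℕ, ∃ X : D.Sym ⊕ Fin 2 → ℕ, (∀ r, ∑ j, (T r j : ℝ) * (X j : ℝ) = 0) ∧
      |(X (.inr 0) : ℝ) - i| ≤ K ∧ |(X (.inr 1) : ℝ) - i * α| ≤ K := by
    intro i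
    let y : D.Sym ⊕ Fin 2 → ℝ := Sum.elim (fun j => (i : ℝ) * x j) ![(i : ℝ), i * α]
    have hy0 : ∀ j, 0 ≤ y j := by
      rintro (j | j)
      · exact mul_nonneg (Nat.cast_nonneg _) (hx0 j)
      · fin_cases j
        · exact Nat.cast_nonneg _
        · exact mul_nonneg (Nat.cast_nonneg _) hα0
    have hyT : ∀ r, ∑ j, (T r j : ℝ) * y j = 0 := by
      rw [hT]
      refine ⟨fun k => ?_, ?_, ?_⟩
      · simp only [y, Sum.elim_inl, Sum.elim_inr, Matrix.cons_val_zero, mass_smul, hx1]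
      · simp only [y, Sum.elim_inl, Sum.elim_inr, Matrix.cons_val_one,
          mul_assoc, ← Finset.mul_sum, hx2]
        rfl
      · simp only [y, Sum.elim_inl, mul_assoc, ← Finset.mul_sum, chkSum_smul, ← mul_sub, hx3,
          mul_zero]
    obtain ⟨X, hX, hXd⟩ := hH y (fun _ => 0) hy0
    simp only [hyT, hz, sub_self, abs_zero, Finset.sum_const_zero, add_zero, mul_one] at hX hXd
    exact ⟨X, hX, hXd (.inr 0), hXd (.inr 1)⟩
  choose X hXT hXn hXw using hseq
  let u : ℕ → ℕ × ℕ := fun i => (X i (.inr 0), X i (.inr 1))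
  have hnR : Tendsto (fun i => (X i (.inr 0) : ℝ)) atTop atTop := by
    refine tendsto_atTop_mono (f := fun i : ℕ => (i : ℝ) - K) (fun i => ?_)
      (tendsto_atTop_add_const_right _ _ tendsto_natCast_atTop_atTop)
    linarith [(abs_le.1 (hXn i)).1]
  have hn : Tendsto (fun i => X i (.inr 0)) atTop atTop := tendsto_natCast_atTop_iff.1 hnR
  have hw : Tendsto (fun i => (X i (.inr 1) : ℝ) / X i (.inr 0)) atTop (𝓝 α) := by
    rw [tendsto_iff_norm_sub_tendsto_zero]
    have h1 : Tendsto (fun i => (K + K * α) / (X i (.inr 0) : ℝ)) atTop (𝓝 0) :=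
      hnR.const_div_atTop _
    refine squeeze_zero' (Eventually.of_forall fun i => norm_nonneg _) ?_ h1
    filter_upwards [hnR.eventually_gt_atTop 0] with i hi
    have e : (X i (.inr 1) : ℝ) / X i (.inr 0) - α =
        ((X i (.inr 1) - i * α) - (X i (.inr 0) - i) * α) / X i (.inr 0) := by
      field_simp
      ring
    rw [e, norm_div, Real.norm_eq_abs, Real.norm_eq_abs, abs_of_pos hi]
    refine div_le_div_of_nonneg_right ?_ hi.le
    refine (abs_sub _ _).trans (add_le_add (hXw i) ?_)
    rw [abs_mul, abs_of_nonneg hα0]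
    exact mul_le_mul_of_nonneg_right (hXn i) hα0
  have hgood : ∀ᶠ i in atTop, D.Admissible (u i).1 ∧ 0 < D.expNum (u i).1 (u i).2 := by
    filter_upwards [hn.eventually_gt_atTop 0] with i hi
    obtain ⟨h1, h2, h3⟩ := (hT fun j => (X i j : ℝ)).1 (hXT i)
    let m : Option ι → ℕ := fun k => ∑ j, if D.symClass j = k then X i (.inl j) else 0
    have hm : ∀ k, (m k : ℝ) = (X i (.inr 0) : ℕ) * D.density k := fun k => by
      rw [← h1 k, mass]
      push_cast [m]
      rfl
    obtain ⟨hadm, hcls⟩ := D.admissible_of_natCast hi hm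
    refine ⟨hadm, (D.expNum_pos_iff hadm).2 ⟨fun j => X i (.inl j), fun k => ?_, ?_, ?_⟩⟩
    · exact hcls k
    · exact_mod_cast h2
    · rw [chkSum, sub_eq_zero] at h3
      exact_mod_cast h3
  have hu : Tendsto u atTop (D.growthFilter α) := by
    refine tendsto_inf.2 ⟨tendsto_inf.2 ⟨tendsto_comap_iff.2 hn, tendsto_comap_iff.2 hw⟩,
      tendsto_principal.2 hgood⟩
  exact hu.neBot

theorem isGrowthRate_maxExponent {α : ℝ} (hα : (polySet D.statG (D.target α)).Nonempty) :
    D.IsGrowthRate α (D.maxExponent α) :=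
  ⟨D.growthFilter_neBot hα, D.tendsto_log_expNum hα⟩

/-! ### Maximization over the weights of each type -/

/-- The part of a profile that belongs to type-`t` VNs. -/
def partV (x : D.Sym → ℝ) (t : ι) (s : D.SymV t) : ℝ := x (.inl ⟨t, s⟩)

/-- The part of a profile that belongs to CNs. -/
def partC (x : D.Sym → ℝ) (s : D.SymC) : ℝ := x (.inr s)

theorem mass_some (x : D.Sym → ℝ) (t : ι) : D.mass x (some t) = ∑ s, D.partV x t s := by
  classical
  simp only [mass, partV, Fintype.sum_sum_type, Fintype.sum_sigma, symClass, Sum.elim_inl,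
    Sum.elim_inr, Option.some.injEq, reduceCtorEq, if_false, Finset.sum_const_zero, add_zero]
  rw [Finset.sum_eq_single t]
  · simp
  · intro t' _ h
    simp [h]
  · simp

theorem mass_none (x : D.Sym → ℝ) : D.mass x none = ∑ s, D.partC x s := by
  classical
  simp only [mass, partC, Fintype.sum_sum_type, symClass, Sum.elim_inl, Sum.elim_inr,
    reduceCtorEq, if_false, Finset.sum_const_zero, zero_add, if_true]

theorem sum_inWt (x : D.Sym → ℝ) :
    ∑ j, x j * D.inWt j = ∑ t, ∑ s, ((s.1.1 : ℕ) : ℝ) * D.partV x t s := by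
  simp only [partV, Fintype.sum_sum_type, Fintype.sum_sigma, inWt, Sum.elim_inl, Sum.elim_inr,
    Nat.cast_zero, zero_mul, Finset.sum_const_zero, add_zero, mul_comm]

theorem sum_outWt (x : D.Sym → ℝ) :
    ∑ j, x j * D.outWt j = ∑ t, ∑ s, ((s.1.2 : ℕ) : ℝ) * D.partV x t s := by
  simp only [partV, Fintype.sum_sum_type, Fintype.sum_sigma, outWt, Sum.elim_inl, Sum.elim_inr,
    Nat.cast_zero, zero_mul, Finset.sum_const_zero, add_zero, mul_comm]

theorem chkSum_eq (x : D.Sym → ℝ) : D.chkSum x = ∑ s, ((s.1 : ℕ) : ℝ) * D.partC x s := by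
  simp only [chkSum, partC, Fintype.sum_sum_type, chkWt, Sum.elim_inl, Sum.elim_inr,
    Nat.cast_zero, zero_mul, Finset.sum_const_zero, zero_add, mul_comm]

theorem negMulLog_split {E l : ℝ} (hE : E ≠ 0) :
    Real.negMulLog E - Real.negMulLog l - Real.negMulLog (E - l) =
      -(E * Real.binEntropy (l / E)) := by
  rw [Real.binEntropy_eq_negMulLog_add_negMulLog_one_sub]
  have h1 : l = E * (l / E) := by field_simp
  have h2 : E - l = E * (1 - l / E) := by field_simp
  have h3 := Real.negMulLog_mul E (l / E)
  have h4 := Real.negMulLog_mul E (1 - l / E)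
  rw [← h1] at h3
  rw [← h2] at h4
  rw [h3, h4]
  ring

/-- Classes interact only through the edge term, and there are `1 / ∫λ` edges per VN, so that term
is minus a rescaled binary entropy. -/
theorem exponent_eq {x : D.Sym → ℝ} (hx : D.mass x none = D.cnRatio) :
    D.exponent x = ∑ t, entFn (D.mulV t) (D.partV x t) + (entFn D.mulC (D.partC x) -
      Real.binEntropy (D.chkSum x * D.lamInt) / D.lamInt) := by
  have hl := D.lamInt_pos
  have hs : (0 : ℝ) < D.s := by exact_mod_cast D.s_pos
  have hE : D.mass x none * D.s = 1 / D.lamInt := by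
    rw [hx, cnRatio, rhoInt_eq]
    field_simp
  rw [exponent, hE, negMulLog_split (by positivity)]
  simp only [Fintype.sum_option, mass_none, mass_some, entFn, Fintype.sum_sum_type,
    Fintype.sum_sigma, Finset.sum_sub_distrib, div_div_eq_mul_div, div_one]
  simp only [partV, partC, symMul, mulV, mulC, Sum.elim_inl, Sum.elim_inr]
  ring

/-- The statistics of the parts of a profile. -/
theorem exists_feasible_of_mem {α : ℝ} {x : D.Sym → ℝ}
    (hx : x ∈ polySet D.statG (D.target α)) : ∃ p ∈ D.feasible α,
      (∀ t, D.partV x t ∈ polySet (D.statV t) ![D.delta t, p.1 t, p.2 t]) ∧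
        D.partC x ∈ polySet D.statC ![D.cnRatio, ∑ t, p.2 t] ∧ D.chkSum x = ∑ t, p.2 t := by
  obtain ⟨h0, h1, h2, h3⟩ := D.mem_polySet_statG.1 hx
  rw [sum_inWt] at h2
  rw [sum_outWt, sub_eq_zero] at h3
  have hV : ∀ t, D.partV x t ∈ polySet (D.statV t) ![D.delta t,
      ∑ s, ((s.1.1 : ℕ) : ℝ) * D.partV x t s, ∑ s, ((s.1.2 : ℕ) : ℝ) * D.partV x t s] := fun t =>
    D.mem_polySet_statV.2 ⟨fun s => h0 _, (D.mass_some x t).symm.trans (h1 _), rfl, rfl⟩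
  have hC : D.partC x ∈ polySet D.statC ![D.cnRatio,
      ∑ t, ∑ s, ((s.1.2 : ℕ) : ℝ) * D.partV x t s] :=
    D.mem_polySet_statC.2 ⟨fun s => h0 _, (D.mass_none x).symm.trans (h1 _),
      (D.chkSum_eq x).symm.trans h3.symm⟩
  exact ⟨(_, _), ⟨fun t => D.mem_vnRegion_of_mem (hV t), h2,
    (D.mem_Icc_betaMax_iff.2 ⟨_, hC⟩).2⟩, hV, hC, h3.symm⟩

theorem nonneg_of_mem_vnRegion {t : ι} {a b : ℝ} (h : (a, b) ∈ D.vnRegion t) : 0 ≤ b := by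
  obtain ⟨x, hx⟩ := D.mem_vnRegion_iff.1 h
  obtain ⟨h0, -, -, h3⟩ := D.mem_polySet_statV.1 hx
  rw [← h3]
  exact Finset.sum_nonneg fun s _ => mul_nonneg (Nat.cast_nonneg _) (h0 s)

/-- The value of the objective at a feasible point is the exponent of a profile. -/
theorem exists_mem_of_feasible {α : ℝ} {p : (ι → ℝ) × (ι → ℝ)} (hp : p ∈ D.feasible α) :
    ∃ x ∈ polySet D.statG (D.target α),
      D.exponent x = ∑ t, D.rateV t (p.1 t, p.2 t) + D.rateY (∑ t, p.2 t) := by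
  obtain ⟨hreg, hα, hβ⟩ := hp
  have hβ0 : 0 ≤ ∑ t, p.2 t := Finset.sum_nonneg fun t _ => D.nonneg_of_mem_vnRegion (hreg t)
  have hV : ∀ t, ∃ y ∈ polySet (D.statV t) ![D.delta t, p.1 t, p.2 t],
      entFn (D.mulV t) y = D.rateV t (p.1 t, p.2 t) := fun t =>
    exists_eq_valueFn (continuous_entFn _) D.bounded_statV (D.mem_vnRegion_iff.1 (hreg t))
  choose y hy hyv using hV
  obtain ⟨z, hz, hzv⟩ := exists_eq_valueFn (continuous_entFn D.mulC) D.bounded_statC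
    (D.mem_Icc_betaMax_iff.1 ⟨hβ0, hβ⟩)
  let x : D.Sym → ℝ := Sum.elim (fun s => y s.1 s.2) z
  have hxV : ∀ t, D.partV x t = y t := fun t => rfl
  have hxC : D.partC x = z := rfl
  obtain ⟨hz0, hz1, hz2⟩ := D.mem_polySet_statC.1 hz
  have hmn : D.mass x none = D.cnRatio := by rw [mass_none, hxC, hz1]
  have hchk : D.chkSum x = ∑ t, p.2 t := by rw [chkSum_eq, hxC, hz2]
  refine ⟨x, D.mem_polySet_statG.2 ⟨?_, ?_, ?_, ?_⟩, ?_⟩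
  · rintro (⟨t, s⟩ | s)
    · exact (hy t).1 s
    · exact hz0 s
  · rintro (_ | t)
    · exact hmn
    · rw [mass_some, hxV]
      exact (D.mem_polySet_statV.1 (hy t)).2.1
  · rw [sum_inWt, ← hα]
    exact Finset.sum_congr rfl fun t _ => by rw [hxV]; exact (D.mem_polySet_statV.1 (hy t)).2.2.1
  · rw [sum_outWt, hchk, sub_eq_zero]
    exact Finset.sum_congr rfl fun t _ => by rw [hxV]; exact (D.mem_polySet_statV.1 (hy t)).2.2.2
  · rw [D.exponent_eq hmn, hchk, hxC, hzv]
    simp only [hxV, hyv]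
    rfl

theorem exponent_le {α : ℝ} {x : D.Sym → ℝ} (hx : x ∈ polySet D.statG (D.target α)) :
    ∃ p ∈ D.feasible α,
      D.exponent x ≤ ∑ t, D.rateV t (p.1 t, p.2 t) + D.rateY (∑ t, p.2 t) := by
  obtain ⟨p, hp, hV, hC, hchk⟩ := D.exists_feasible_of_mem hx
  refine ⟨p, hp, ?_⟩
  rw [D.exponent_eq ((D.mem_polySet_statG.1 hx).2.1 none), hchk]
  refine add_le_add (Finset.sum_le_sum fun t _ => ?_) (sub_le_sub_right ?_ _)
  · exact le_valueFn (continuous_entFn _) D.bounded_statV (hV t)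
  · exact le_valueFn (continuous_entFn _) D.bounded_statC hC

/-- Maximization in two stages: gluing optimal distributions of all classes gives a profile, and
cutting a profile into its classes gives a feasible point of no smaller value. -/
theorem isGreatest_maxExponent {α : ℝ} (hα : (polySet D.statG (D.target α)).Nonempty) :
    IsGreatest ((fun p : (ι → ℝ) × (ι → ℝ) =>
      ∑ t, D.rateV t (p.1 t, p.2 t) + D.rateY (∑ t, p.2 t)) '' D.feasible α)
        (D.maxExponent α) := by
  have hub : ∀ p ∈ D.feasible α,
      ∑ t, D.rateV t (p.1 t, p.2 t) + D.rateY (∑ t, p.2 t) ≤ D.maxExponent α := by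
    intro p hp
    obtain ⟨x, hx, hxv⟩ := D.exists_mem_of_feasible hp
    rw [← hxv]
    exact le_valueFn D.continuous_exponent D.bounded_statG hx
  constructor
  · obtain ⟨x, hx, hxv⟩ := exists_eq_valueFn D.continuous_exponent D.bounded_statG hα
    obtain ⟨p, hp, hle⟩ := D.exponent_le hx
    exact ⟨p, hp, le_antisymm (hub p hp) (hxv.symm.trans_le hle)⟩
  · rintro _ ⟨p, hp, rfl⟩
    exact hub p hp

end DGLDPC

end

theorem proposition1 {ι : Type*} [Fintype ι] (D : DGLDPC ι) :
    -- existence and uniqueness of `z₀`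
    (∀ β : ℝ, 0 < β → β < D.betaMax → ∃! z : ℝ, D.IsSaddleCN β z) ∧
    -- existence and uniqueness of `(x₀, y₀)`
    (∀ (t : ι) (a b : ℝ), 0 < a → a < D.delta t * D.k t → D.lower t a < b → b < D.upper t a →
      ∃! p : ℝ × ℝ, D.IsSaddleVN t a b p) ∧
    -- degenerate VN types (such as repetition codes), where the two bounds coincide and
    -- `(x₀, y₀)` exists but is not unique
    (∀ (t : ι) (a b : ℝ), 0 < a → a < D.delta t * D.k t → D.lower t a = b → b = D.upper t a →
      ∃ p : ℝ × ℝ, D.IsSaddleVN t a b p) ∧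
    -- `X t` and `Y` are given by the saddle points, and by continuity at those boundary points of
    -- their domains where there is no positive saddle point
    ∃ (X : ι → ℝ × ℝ → ℝ) (Y : ℝ → ℝ),
      (∀ t, ContinuousOn (X t) (D.vnRegion t)) ∧
      (∀ (t : ι) (a b : ℝ) (p : ℝ × ℝ), D.IsSaddleVN t a b p → X t (a, b) = D.valX t a b p) ∧
      ContinuousOn Y (Set.Icc 0 D.betaMax) ∧
      (∀ β z : ℝ, D.IsSaddleCN β z → Y β = D.valY β z) ∧
      -- the growth rate is the constrained maximum
      ∀ α : ℝ, (D.feasible α).Nonempty →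
        ∃ G : ℝ, D.IsGrowthRate α G ∧
          IsGreatest ((fun p : (ι → ℝ) × (ι → ℝ) =>
            ∑ t, X t (p.1 t, p.2 t) + Y (∑ t, p.2 t)) '' D.feasible α) G := by
  -- `X` and `Y` are defined through optimal values, without reference to saddle points, hence also
  -- where none exist.
  refine ⟨fun β h0 h1 => ?_, fun t a b h0 h1 hl hu => ?_, fun t a b h0 h1 hl hu => ?_,
    D.rateV, D.rateY, D.continuousOn_rateV, fun t a b p h => D.rateV_eq_valX h,
    D.continuousOn_rateY, fun β z h => D.rateY_eq_valY h, fun α hα => ?_⟩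
  · obtain ⟨z, hz⟩ := D.exists_isSaddleCN h0 h1
    exact ⟨z, hz, fun z' hz' => D.isSaddleCN_unique hz' hz⟩
  · obtain ⟨p, hp⟩ := D.exists_isSaddleVN h0 h1 (Or.inl ⟨hl, hu⟩)
    exact ⟨p, hp, fun p' hp' => D.isSaddleVN_unique (hl.trans hu) hp' hp⟩
  · exact D.exists_isSaddleVN h0 h1 (Or.inr ⟨hl, hu⟩)
  · obtain ⟨p, hp⟩ := hα
    obtain ⟨x, hx, -⟩ := D.exists_mem_of_feasible hp
    exact ⟨D.maxExponent α, D.isGrowthRate_maxExponent ⟨x, hx⟩, D.isGreatest_maxExponent ⟨x, hx⟩⟩
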